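/- Let $G=(V,E)$ be a finite, simple, undirected, connected graph with $n$ vertices. A set $C\subseteq V$ is m-convex if it contains every vertex of every induced path of $G$ between two vertices of $C$, and an m-halfspace is an m-convex set whose complement is m-convex. For an edge $ab$, let $\mathcal H_m(ab)$ be the set of m-halfspaces $H$ with $a\in H$ and $b\notin H$. Call a vertex nontrivial if it lies in some but not in all members of $\mathcal H_m(ab)$. A cell decomposition of $\mathcal H_m(ab)$ is a structure $(\{C_1',C_1'',\dots,C_k',C_k''\},\mathcal C_1,\dots,\mathcal C_p)$ with $k\ge 0$ and $p\ge 1$, where the sets $C_i=C_i'\cup C_i''\subseteq V$ are nonempty and pairwise disjoint, $C_i'\cap C_i''=\varnothing$ (one of $C_i'$, $C_i''$ may be empty), and $\mathcal C_1,\dots,\mathcal C_p$ is a partition of $\{C_1,\dots,C_k\}$ into nonempty blocks (if $k=0$, then $p=1$ and $\mathcal C_1=\varnothing$), such that: two vertices $x,y$ lie in a common set among $C_1',C_1'',\dots,C_k',C_k''$ if and only if both are nontrivial and $x\in H\Leftrightarrow y\in H$ for all $H\in\mathcal H_m(ab)$; and $x,y$ lie in the two different halves $C_i',C_i''$ of a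 common $C_i$ if and only if both are nontrivial and $x\in H\Leftrightarrow y\notin H$ for all $H\in\mathcal H_m(ab)$. Write $\mathcal C_{<\ell}=\mathcal C_1\cup\dots\cup\mathcal C_{\ell-1}$ and $\mathcal C_{>\ell}=\mathcal C_{\ell+1}\cup\dots\cup\mathcal C_p$. Theorem (cell decomposition of m-halfspaces). Let $ab\in E$ with $\mathcal H_m(ab)\ne\varnothing$. There exist a set $A^*\subseteq V$ and a cell decomposition $(\{C_1',C_1'',\dots,C_k',C_k''\},\mathcal C_1,\dots,\mathcal C_p)$ of $\mathcal H_m(ab)$, with $A^*$ disjoint from every $C_i$, such that for every $H\subseteq V$ we have $H\in\mathcal H_m(ab)$ if and only if $$H=A^*\cup\Bigl(\bigcup_{C_i\in\mathcal C_{<\ell}\cup\mathcal C_\ell'}C_i'\Bigr)\cup\Bigl(\bigcup_{C_i\in(\mathcal C_\ell\setminus\mathcal C_\ell')\cup\mathcal C_{>\ell}}C_i''\Bigr)\quad\text{for some }\ell\in\{1,\dots,p\}\text{ and }\mathcal C_\ell'\subseteq\mathcal C_\ell.$$ Moreover, such a set $A^*$ and such a cell decomposition can be computed in polynomial time: there are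 a single random access machine program and a polynomial $q$ such that, for all $G$ and $ab$ as above, the program, started on $n$, the adjacency matrix of $G$ (for any numbering of the vertices) and the numbers of $a$ and $b$, halts after at most $q(n)$ elementary steps and outputs $A^*$, the sets $C_i'$, $C_i''$ and the partition into blocks. (The elementary operations on natural numbers are addition, truncated subtraction, test for zero, and reading and writing of variables and of array entries.) -/

import Mathlib

namespace Monophonic

/-! ### Monophonic convexity -/

section Convexity

variable {V : Type*} (G : SimpleGraph V)

/-- The monophonic interval `I_m(u, v)`: all vertices that lie on an induced path from `u` to `v`. -/
def interval (u v : V) : Set V :=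
  {z | ∃ p : G.Walk u v, p.IsPath ∧ p.IsChordless ∧ z ∈ p.support}

/-- Monophonically convex (m-convex) sets of vertices. -/
def MConvex (A : Set V) : Prop :=
  ∀ u ∈ A, ∀ v ∈ A, interval G u v ⊆ A

/-- Monophonic halfspaces (m-halfspaces): m-convex sets with m-convex complement. -/
def IsHalfspace (H : Set V) : Prop :=
  MConvex G H ∧ MConvex G Hᶜ

/-- `H_m(ab)`: the m-halfspaces that contain `a` and avoid `b`. -/
def halfspaces (a b : V) : Set (Set V) :=
  {H | IsHalfspace G H ∧ a ∈ H ∧ b ∉ H}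

end Convexity

/-! ### Cell decompositions -/

/-- A family `(C'_1, C''_1), …, (C'_k, C''_k)` of twin cells with blocks `𝒞_1, …, 𝒞_p`
(indices start at `0` here).  The sets `C_i = C'_i ∪ C''_i` are nonempty and pairwise disjoint, each
`C_i` is the disjoint union of `C'_i` and `C''_i` (one of which may be empty), and the blocks
`𝒞_ℓ = {C_i | blockOf i = ℓ}` partition `{C_1, …, C_k}` into nonempty parts; if there are no
cells at all then there is exactly one block, the empty one. -/
structure CellDecomposition (V : Type*) where
  /-- the number of pairs of twin cells -/
  k : ℕ
  /-- the number of blocks -/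
  p : ℕ
  /-- the first halves `C'_i` -/
  fst : Fin k → Set V
  /-- the second halves `C''_i` -/
  snd : Fin k → Set V
  /-- the index of the block that contains `C_i` -/
  blockOf : Fin k → Fin p
  cell_nonempty : ∀ i, (fst i ∪ snd i).Nonempty
  cell_disjoint : ∀ i j, i ≠ j → Disjoint (fst i ∪ snd i) (fst j ∪ snd j)
  twin_disjoint : ∀ i, Disjoint (fst i) (snd i)
  p_pos : 0 < p
  block_nonempty : 0 < k → ∀ l, ∃ i, blockOf i = l
  p_eq_one : k = 0 → p = 1

namespace CellDecomposition

variable {V : Type*}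

/-- `C_i = C'_i ∪ C''_i`. -/
def cell (D : CellDecomposition V) (i : Fin D.k) : Set V :=
  D.fst i ∪ D.snd i

/-- The block `𝒞_ℓ`, as a set of cell indices. -/
def block (D : CellDecomposition V) (l : Fin D.p) : Set (Fin D.k) :=
  {i | D.blockOf i = l}

/-- `𝒞_{<ℓ}`: the union of the blocks before the block `ℓ`. -/
def before (D : CellDecomposition V) (l : Fin D.p) : Set (Fin D.k) :=
  {i | D.blockOf i < l}

/-- `𝒞_{>ℓ}`: the union of the blocks after the block `ℓ`. -/
def after (D : CellDecomposition V) (l : Fin D.p) : Set (Fin D.k) :=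
  {i | l < D.blockOf i}

end CellDecomposition

section Cells

variable {V : Type*} (G : SimpleGraph V) (a b : V)

/-- A vertex is nontrivial if it is not on the same side for all members of `H_m(ab)`. -/
def Nontriv (x : V) : Prop :=
  (∃ H ∈ halfspaces G a b, x ∈ H) ∧ (∃ H ∈ halfspaces G a b, x ∉ H)

/-- `D` is a cell decomposition of `H_m(ab)`, with all cells disjoint from `A`: the halves
`C'_i`, `C''_i` group the nontrivial vertices according to the members of `H_m(ab)`.  Two vertices
are in the same half iff they are nontrivial and on the same side for all `H` in `H_m(ab)`, and in
twin halves iff they are nontrivial and on opposite sides for all `H` in `H_m(ab)`. -/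
structure IsCellDecompositionOf (A : Set V) (D : CellDecomposition V) : Prop where
  disjoint_cell : ∀ i, Disjoint A (D.cell i)
  same_half : ∀ x y : V,
    (∃ i, (x ∈ D.fst i ∧ y ∈ D.fst i) ∨ (x ∈ D.snd i ∧ y ∈ D.snd i)) ↔
      Nontriv G a b x ∧ Nontriv G a b y ∧ ∀ H ∈ halfspaces G a b, (x ∈ H ↔ y ∈ H)
  twin_half : ∀ x y : V,
    (∃ i, (x ∈ D.fst i ∧ y ∈ D.snd i) ∨ (x ∈ D.snd i ∧ y ∈ D.fst i)) ↔
      Nontriv G a b x ∧ Nontriv G a b y ∧ ∀ H ∈ halfspaces G a b, (x ∈ H ↔ y ∉ H)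

end Cells

/-! ### A random access machine

Structured programs over natural numbers, with scalar variables `x_0, x_1, …` and two-dimensional
arrays `M_0, M_1, …` of unbounded extent.  The only arithmetic operations are addition and
truncated subtraction, so that a unit cost for each operation is polynomially equivalent to the
running time of a Turing machine. -/

/-- Expressions. -/
inductive Expr : Type
  | const (c : ℕ)
  | var (x : ℕ)
  | get (m : ℕ) (i j : Expr)
  | add (e f : Expr)
  | sub (e f : Expr)

/-- Programs. -/
inductive Prog : Type
  | skip
  | assign (x : ℕ) (e : Expr)
  | store (m : ℕ) (i j e : Expr)
  | seq (c d : Prog)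
  | ite (e : Expr) (c d : Prog)
  | while (e : Expr) (c : Prog)

/-- Memory contents: the values of the scalar variables and of the array entries. -/
structure Memory where
  /-- the values of the scalar variables -/
  var : ℕ → ℕ
  /-- the entries of the arrays: `arr m i j` is the entry `M_m[i, j]` -/
  arr : ℕ → ℕ → ℕ → ℕ

namespace Memory

/-- The memory after the assignment of `v` to the variable `x`. -/
def setVar (s : Memory) (x v : ℕ) : Memory :=
  { s with var := fun y => if y = x then v else s.var y }

/-- The memory after the assignment of `v` to the array entry `M_m[i, j]`. -/
def setArr (s : Memory) (m i j v : ℕ) : Memory :=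
  { s with arr := fun m' i' j' => if m' = m ∧ i' = i ∧ j' = j then v else s.arr m' i' j' }

end Memory

namespace Expr

/-- The value of an expression. -/
def eval (s : Memory) : Expr → ℕ
  | const c => c
  | var x => s.var x
  | get m i j => s.arr m (i.eval s) (j.eval s)
  | add e f => e.eval s + f.eval s
  | sub e f => e.eval s - f.eval s

/-- The number of elementary steps that the evaluation of an expression takes. -/
def cost : Expr → ℕ
  | const _ => 1
  | var _ => 1
  | get _ i j => i.cost + j.cost + 1
  | add e f => e.cost + f.cost + 1
  | sub e f => e.cost + f.cost + 1

end Expr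

/-- `Exec c s s' t`: started in the memory `s`, the program `c` halts after exactly `t` elementary
steps, in the memory `s'`.  A condition is true if its value is not `0`. -/
inductive Exec : Prog → Memory → Memory → ℕ → Prop
  | skip (s : Memory) : Exec .skip s s 1
  | assign (s : Memory) (x : ℕ) (e : Expr) :
      Exec (.assign x e) s (s.setVar x (e.eval s)) (e.cost + 1)
  | store (s : Memory) (m : ℕ) (i j e : Expr) :
      Exec (.store m i j e) s (s.setArr m (i.eval s) (j.eval s) (e.eval s))
        (i.cost + j.cost + e.cost + 1)
  | seq {c d : Prog} {s s' s'' : Memory} {t t' : ℕ} :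
      Exec c s s' t → Exec d s' s'' t' → Exec (.seq c d) s s'' (t + t')
  | ite_true {e : Expr} {c d : Prog} {s s' : Memory} {t : ℕ} :
      e.eval s ≠ 0 → Exec c s s' t → Exec (.ite e c d) s s' (e.cost + 1 + t)
  | ite_false {e : Expr} {c d : Prog} {s s' : Memory} {t : ℕ} :
      e.eval s = 0 → Exec d s s' t → Exec (.ite e c d) s s' (e.cost + 1 + t)
  | while_true {e : Expr} {c : Prog} {s s' s'' : Memory} {t t' : ℕ} :
      e.eval s ≠ 0 → Exec c s s' t → Exec (.while e c) s' s'' t' →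
        Exec (.while e c) s s'' (e.cost + 1 + t + t')
  | while_false {e : Expr} {c : Prog} {s : Memory} :
      e.eval s = 0 → Exec (.while e c) s s (e.cost + 1)

/-- A program has at most one run from a given memory, so that `Exec` speaks of the run. -/
theorem Exec.deterministic {c : Prog} {s s₁ s₂ : Memory} {t₁ t₂ : ℕ}
    (h₁ : Exec c s s₁ t₁) (h₂ : Exec c s s₂ t₂) : s₁ = s₂ ∧ t₁ = t₂ := by
  induction h₁ generalizing s₂ t₂ with
  | skip s => cases h₂; exact ⟨rfl, rfl⟩
  | assign s x e => cases h₂; exact ⟨rfl, rfl⟩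
  | store s m i j e => cases h₂; exact ⟨rfl, rfl⟩
  | seq _ _ ih ih' =>
    cases h₂ with
    | seq k k' =>
      obtain ⟨rfl, rfl⟩ := ih k
      obtain ⟨rfl, rfl⟩ := ih' k'
      exact ⟨rfl, rfl⟩
  | ite_true he _ ih =>
    cases h₂ with
    | ite_true _ k => obtain ⟨rfl, rfl⟩ := ih k; exact ⟨rfl, rfl⟩
    | ite_false hf _ => exact absurd hf he
  | ite_false he _ ih =>
    cases h₂ with
    | ite_true hf _ => exact absurd he hf
    | ite_false _ k => obtain ⟨rfl, rfl⟩ := ih k; exact ⟨rfl, rfl⟩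
  | while_true he _ _ ih ih' =>
    cases h₂ with
    | while_true _ k k' =>
      obtain ⟨rfl, rfl⟩ := ih k
      obtain ⟨rfl, rfl⟩ := ih' k'
      exact ⟨rfl, rfl⟩
    | while_false hf => exact absurd hf he
  | while_false he =>
    cases h₂ with
    | while_true hf _ _ => exact absurd he hf
    | while_false _ => exact ⟨rfl, rfl⟩

/-! ### Input and output formats -/

section Encoding

variable {V : Type*} {n : ℕ}

open Classical in
/-- The input memory for a graph `G` with `n` vertices, numbered by `e`, and two vertices `a`, `b`:
`x_0 = n`, `x_1` and `x_2` are the numbers of `a` and `b`, `M_0` is the adjacency matrix of `G`,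
and everything else is `0`. -/
noncomputable def inputMemory (e : V ≃ Fin n) (G : SimpleGraph V) (a b : V) : Memory where
  var x := if x = 0 then n else if x = 1 then (e a : ℕ) else if x = 2 then (e b : ℕ) else 0
  arr m i j :=
    if m = 0 ∧ ∃ u v : V, (e u : ℕ) = i ∧ (e v : ℕ) = j ∧ G.Adj u v then 1 else 0

/-- The memory `s` holds the output `(A, D)`: `x_0 = k` and `x_1 = p`, the array `M_0` holds the
indicator function of `A`, the rows of `M_1` and `M_2` hold the indicator functions of the
first and second halves `C'_i` and `C''_i`, and `M_3` holds the block indices of the cells. -/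
structure HoldsOutput (e : V ≃ Fin n) (s : Memory) (A : Set V) (D : CellDecomposition V) :
    Prop where
  k_eq : s.var 0 = D.k
  p_eq : s.var 1 = D.p
  mem_base : ∀ v : V, s.arr 0 (e v) 0 = A.indicator 1 v
  mem_fst : ∀ (i : Fin D.k) (v : V), s.arr 1 i (e v) = (D.fst i).indicator 1 v
  mem_snd : ∀ (i : Fin D.k) (v : V), s.arr 2 i (e v) = (D.snd i).indicator 1 v
  block_eq : ∀ i : Fin D.k, s.arr 3 i 0 = D.blockOf i

end Encoding

end Monophonic

/-! Fix the edge `ab`. In a connected graph, `H` is a halfspace iff the vertices of `H` with a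
neighbour outside form a clique, and the same holds for `Hᶜ` (`mem_halfspaces_iff`). Since `a` and
`b` are themselves boundary vertices, an edge from `x ∈ H` to `y ∉ H` needs `x ∈ N[a]` and `y ∈
N[b]`. Therefore a vertex `x ≠ b` adjacent to `a` but not to `b` always lies in `H`. So for `x ∈
N(a)`, `x ≠ b`, one literal suffices to witness that `x` is a boundary vertex: `x ∈ H` if `x` is
adjacent to `b`, and `y ∉ H` for some neighbour `y` otherwise. Hence "no two nonadjacent boundary
vertices" becomes a set of two-literal clauses, and membership in `H_m(ab)` is a 2-SAT problem
(`mem_halfspaces_iff_excl`). As soon as one solution exists, entailment between undecided literals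
is reachability in the implication graph (`Entails.derives`).

Each nontrivial vertex is always on the same side as some nontrivial common neighbour of `a` and `b`
(a central vertex). A single implication between undecided literals is either reversible or, up to
contraposition and exchange of `a` and `b`, leads from a central vertex outside some neighbourhood
`N(x)` to a central vertex inside it; all central vertices outside `N(x)` entail all those inside
(`isCut_neighborSet`, `Imp.reversible_or_cutStep`). A proper entailment thus passes through central
`s`, `t` such that every nontrivial `z` satisfies `s → z` or `z → t` (`Entails.exists_cut`). Two
consequences follow: proper entailments only join literals of equal sign (`Entails.same_sign`), and
on vertices they are negatively transitive (`Entails.interpolate`), so they form a strict weak order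
on the cells. The blocks are its incomparability classes, the most entailed ones first.

A set that respects twins and is upward closed for this order makes any two of its true literals
jointly satisfiable. Because all clauses are binary, it is then itself a halfspace
(`assemble_mem_halfspaces`). Upward closed sets of a weak order consist of all blocks before some
block and an arbitrary part of that block, which is the claimed form.

For the running time, Warshall's algorithm on the `2n` literals computes derivability; cells,
representatives and ranks are then given by terms with sums over indices below `2n`. A compiler for
such terms with polynomial cost bounds (`Tm.runs_code`) gives the program. -/

namespace Monophonic

/-! ### Halfspaces and boundary cliques -/

section Boundary

variable {V : Type*} {G : SimpleGraph V}

/-- A chord between two non-consecutive vertices would shortcut a geodesic. -/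
theorem isChordless_of_length_eq_dist {u v : V} (p : G.Walk u v) (hp : p.length = G.dist u v) :
    p.IsChordless := by
  have key : ∀ i j, i < j → j ≤ p.length → G.Adj (p.getVert i) (p.getVert j) →
      s(p.getVert i, p.getVert j) ∈ p.edges := by
    intro i j hij hj hadj
    have h := G.dist_le ((p.take i).append (.cons hadj (p.drop j)))
    rw [SimpleGraph.Walk.length_append, SimpleGraph.Walk.length_cons,
      SimpleGraph.Walk.take_length, SimpleGraph.Walk.drop_length] at h
    -- The walk through the edge has length `i + 1 + (p.length - j)`, which cannot be less than
    -- `p.length`.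
    obtain rfl : j = i + 1 := by omega
    rw [← SimpleGraph.Walk.adj_toSubgraph_iff_mem_edges]
    exact p.toSubgraph_adj_getVert (by omega)
  rw [SimpleGraph.Walk.isChordless_iff_forall_mem_edges]
  intro x y hx hy hadj
  obtain ⟨i, rfl, hi⟩ := SimpleGraph.Walk.mem_support_iff_exists_getVert.1 hx
  obtain ⟨j, rfl, hj⟩ := SimpleGraph.Walk.mem_support_iff_exists_getVert.1 hy
  rcases lt_trichotomy i j with h | rfl | h
  · exact key i j h hj hadj
  · exact absurd rfl hadj.ne
  · rw [Sym2.eq_swap]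
    exact key j i h hi hadj.symm

/-- A geodesic of the induced subgraph has no chord there, and every edge of `G` between its
vertices belongs to the induced subgraph. -/
theorem exists_chordless_path_of_reachable {S : Set V} {u v : S}
    (h : (G.induce S).Reachable u v) :
    ∃ p : G.Walk u v, p.IsPath ∧ p.IsChordless ∧ ∀ z ∈ p.support, z ∈ S := by
  obtain ⟨q, hq, hl⟩ := h.exists_path_of_dist
  let f : G.induce S →g G := (SimpleGraph.Embedding.induce S).toHom
  have key : ∃ p : G.Walk (f u) (f v), p.IsPath ∧ p.IsChordless ∧ ∀ z ∈ p.support, z ∈ S := by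
    refine ⟨q.map f, hq.map Subtype.val_injective, ?_, ?_⟩
    · rw [SimpleGraph.Walk.isChordless_iff_forall_mem_edges]
      intro x y hx hy hadj
      rw [SimpleGraph.Walk.support_map, List.mem_map] at hx hy
      obtain ⟨x, hx, rfl⟩ := hx
      obtain ⟨y, hy, rfl⟩ := hy
      rw [SimpleGraph.Walk.edges_map, List.mem_map]
      exact ⟨s(x, y), (isChordless_of_length_eq_dist q hl).mem_edges hx hy hadj, rfl⟩
    · intro z hz
      rw [SimpleGraph.Walk.support_map, List.mem_map] at hz
      obtain ⟨z, -, rfl⟩ := hz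
      exact z.2
  exact key

/-- The vertices of `H` with a neighbour outside `H` form a clique. -/
def BoundaryClique (G : SimpleGraph V) (H : Set V) : Prop :=
  ∀ x y x' y', x ∈ H → x' ∈ H → y ∉ H → y' ∉ H → G.Adj x y → G.Adj x' y' → x = x' ∨ G.Adj x x'

/-- Geodesics are induced paths, so those between points of `K` stay in `K`. -/
theorem MConvex.reachable (hG : G.Connected) {K : Set V} (hK : MConvex G K) (u v : K) :
    (G.induce K).Reachable u v := by
  obtain ⟨p, hp, hl⟩ := hG.exists_path_of_dist u v
  exact ⟨p.induce K fun z hz => hK u u.2 v v.2 ⟨p, hp, isChordless_of_length_eq_dist p hl, hz⟩⟩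

/-- Two nonadjacent boundary vertices could be joined by an induced path through the complement,
which is connected; convexity of `H` forbids this. -/
theorem boundaryClique_of_mConvex (hG : G.Connected) {H : Set V} (hH : MConvex G H)
    (hH' : MConvex G Hᶜ) : BoundaryClique G H := by
  intro x y x' y' hx hx' hy hy' hxy hxy'
  by_contra! hne
  let S : Set V := insert x (insert x' Hᶜ)
  have hS : Hᶜ ⊆ S := fun z hz => Or.inr (Or.inr hz)
  have hr : (G.induce S).Reachable ⟨y, hS hy⟩ ⟨y', hS hy'⟩ :=
    (hH'.reachable hG ⟨y, hy⟩ ⟨y', hy'⟩).map (SimpleGraph.induceHomOfLE G hS).toHom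
  have hxS : x ∈ S := Or.inl rfl
  have hxS' : x' ∈ S := Or.inr (Or.inl rfl)
  have h1 : (G.induce S).Adj ⟨x, hxS⟩ ⟨y, hS hy⟩ := hxy
  have h2 : (G.induce S).Adj ⟨y', hS hy'⟩ ⟨x', hxS'⟩ := hxy'.symm
  obtain ⟨p, hp, hc, hs⟩ :=
    exists_chordless_path_of_reachable ((h1.reachable.trans hr).trans h2.reachable)
  cases p with
  | nil => exact hne.1 rfl
  | @cons _ z _ h q =>
    have hz : z ∈ (SimpleGraph.Walk.cons h q).support := by simp
    -- The second vertex of the path lies in `H` by convexity, so within `S` it can only be `x` or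
    -- `x'`; the first would be a loop, the second an edge `xx'`.
    have hzH : z ∈ H := hH x hx x' hx' ⟨_, hp, hc, hz⟩
    rcases hs z hz with rfl | rfl | h'
    · exact absurd rfl h.ne
    · exact hne.2 h
    · exact h' hzH

theorem exists_exit {u v : V} (p : G.Walk u v) {H : Set V} {i j : ℕ} (hij : i ≤ j)
    (hi : p.getVert i ∈ H) (hj : p.getVert j ∉ H) :
    ∃ k, i ≤ k ∧ k < j ∧ p.getVert k ∈ H ∧ p.getVert (k + 1) ∉ H := by
  induction j, hij using Nat.le_induction with
  | base => exact absurd hi hj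
  | succ j hij ih =>
    by_cases h : p.getVert j ∈ H
    · exact ⟨j, hij, by omega, h, hj⟩
    · obtain ⟨k, h1, h2, h3⟩ := ih h
      exact ⟨k, h1, by omega, h3⟩

/-- An induced path that leaves `H` and returns does so at two boundary vertices that are not
consecutive on the path; their adjacency would be a chord. -/
theorem mConvex_of_boundaryClique {H : Set V} (hH : BoundaryClique G H) : MConvex G H := by
  rintro u hu v hv z ⟨p, hp, hc, hz⟩
  by_contra hzH
  obtain ⟨m, rfl, hm⟩ := SimpleGraph.Walk.mem_support_iff_exists_getVert.1 hz
  obtain ⟨i, -, him, hi, hi'⟩ := exists_exit p (Nat.zero_le m) (by simpa using hu) hzH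
  obtain ⟨j, hmj, hj, hj', hj''⟩ := exists_exit p (H := Hᶜ) hm hzH (by simpa using hv)
  rw [Set.mem_compl_iff, not_not] at hj''
  have hinj := hp.getVert_injOn
  have hne : ∀ k l, k ≤ p.length → l ≤ p.length → p.getVert k = p.getVert l → k = l :=
    fun k l hk hl h => hinj hk hl h
  -- The path leaves `H` after position `i < m` and re-enters at position `j + 1 > m`, so the two
  -- positions differ by at least two.
  rcases hH _ _ _ _ hi hj'' hi' hj' (p.adj_getVert_succ (by omega))
      (p.adj_getVert_succ (by omega)).symm with h | h
  · have := hne _ _ (by omega) (by omega) h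
    omega
  · have h' := hc.mem_edges (p.getVert_mem_support _) (p.getVert_mem_support _) h
    rw [← SimpleGraph.Walk.adj_toSubgraph_iff_mem_edges,
      SimpleGraph.Walk.toSubgraph_adj_iff] at h'
    obtain ⟨k, hk, hkl⟩ := h'
    rw [Sym2.eq_iff] at hk
    rcases hk with ⟨h1, h2⟩ | ⟨h1, h2⟩
    · have := hne _ _ (by omega) (by omega) h1
      have := hne _ _ (by omega) (by omega) h2
      omega
    · have := hne _ _ (by omega) (by omega) h1
      have := hne _ _ (by omega) (by omega) h2
      omega

theorem mem_halfspaces_iff (hG : G.Connected) {a b : V} {H : Set V} :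
    H ∈ halfspaces G a b ↔ a ∈ H ∧ b ∉ H ∧ BoundaryClique G H ∧ BoundaryClique G Hᶜ := by
  constructor
  · rintro ⟨⟨h, h'⟩, ha, hb⟩
    exact ⟨ha, hb, boundaryClique_of_mConvex hG h h',
      boundaryClique_of_mConvex hG h' (by rwa [compl_compl])⟩
  · rintro ⟨ha, hb, h, h'⟩
    exact ⟨⟨mConvex_of_boundaryClique h, mConvex_of_boundaryClique h'⟩, ha, hb⟩

/-- The symmetry that exchanges `a` and `b`; it halves most of the case distinctions below. -/
theorem compl_mem_halfspaces {a b : V} {H : Set V} (h : H ∈ halfspaces G a b) :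
    Hᶜ ∈ halfspaces G b a := by
  obtain ⟨⟨h1, h2⟩, ha, hb⟩ := h
  exact ⟨⟨h2, by rwa [compl_compl]⟩, hb, fun h => h ha⟩

end Boundary

/-! ### Description by two-literal clauses -/

section Literals

variable {V : Type*}

/-- The truth value of a literal: `inl v` says that `v ∈ H`, `inr v` says that `v ∉ H`. -/
def Holds (H : Set V) : V ⊕ V → Prop
  | .inl v => v ∈ H
  | .inr v => v ∉ H

@[simp] theorem holds_inl {H : Set V} {v : V} : Holds H (.inl v) ↔ v ∈ H := Iff.rfl

@[simp] theorem holds_inr {H : Set V} {v : V} : Holds H (.inr v) ↔ v ∉ H := Iff.rfl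

@[simp] theorem holds_swap {H : Set V} {p : V ⊕ V} : Holds H p.swap ↔ ¬ Holds H p := by
  cases p <;> simp

theorem holds_compl {H : Set V} {p : V ⊕ V} : Holds Hᶜ p ↔ ¬ Holds H p := by
  cases p <;> simp

/-- The literals that witness that `x` is a boundary vertex of `H`. -/
def Gate (G : SimpleGraph V) (a b x : V) (p : V ⊕ V) : Prop :=
  G.Adj x a ∧ x ≠ b ∧ ((G.Adj x b ∧ p = .inl x) ∨ (¬ G.Adj x b ∧ ∃ y, G.Adj x y ∧ p = .inr y))

/-- Pairs of witnesses for two boundary vertices that are not adjacent. -/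
def BoundaryExcl (G : SimpleGraph V) (a b : V) (p q : V ⊕ V) : Prop :=
  ∃ x x', x ≠ x' ∧ ¬ G.Adj x x' ∧ Gate G a b x p ∧ Gate G a b x' q

/-- `x` and `y` are adjacent, and never `x ∈ H` and `y ∉ H`. -/
def EdgeExcl (G : SimpleGraph V) (a b x y : V) : Prop :=
  G.Adj x y ∧ ((x ≠ a ∧ ¬ G.Adj x a) ∨ (y ≠ b ∧ ¬ G.Adj y b))

/-- The clauses: pairs of literals that do not both hold. -/
def Excl (G : SimpleGraph V) (a b : V) (p q : V ⊕ V) : Prop :=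
  (p = .inr a ∧ q = .inr a) ∨ (p = .inl b ∧ q = .inl b) ∨
  (∃ x y, EdgeExcl G a b x y ∧ ((p = .inl x ∧ q = .inr y) ∨ (p = .inr y ∧ q = .inl x))) ∨
  BoundaryExcl G a b p q ∨ BoundaryExcl G b a p.swap q.swap

/-- The implications given by the clauses. -/
def Imp (G : SimpleGraph V) (a b : V) (p q : V ⊕ V) : Prop :=
  Excl G a b p q.swap

variable {G : SimpleGraph V} {a b : V}

theorem BoundaryExcl.symm {p q : V ⊕ V} (h : BoundaryExcl G a b p q) : BoundaryExcl G a b q p := by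
  obtain ⟨x, x', h1, h2, h3, h4⟩ := h
  exact ⟨x', x, h1.symm, fun h => h2 h.symm, h4, h3⟩

theorem Excl.symm {p q : V ⊕ V} (h : Excl G a b p q) : Excl G a b q p := by
  rcases h with ⟨h, h'⟩ | ⟨h, h'⟩ | ⟨x, y, h, h'⟩ | h | h
  · exact Or.inl ⟨h', h⟩
  · exact Or.inr (Or.inl ⟨h', h⟩)
  · exact Or.inr (Or.inr (Or.inl ⟨x, y, h, by tauto⟩))
  · exact Or.inr (Or.inr (Or.inr (Or.inl h.symm)))
  · exact Or.inr (Or.inr (Or.inr (Or.inr h.symm)))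

theorem EdgeExcl.swap {x y : V} (h : EdgeExcl G a b x y) : EdgeExcl G b a y x :=
  ⟨h.1.symm, h.2.symm⟩

theorem Excl.swap {p q : V ⊕ V} (h : Excl G a b p q) : Excl G b a p.swap q.swap := by
  rcases h with ⟨rfl, rfl⟩ | ⟨rfl, rfl⟩ | ⟨x, y, h, h'⟩ | h | h
  · exact Or.inr (Or.inl ⟨rfl, rfl⟩)
  · exact Or.inl ⟨rfl, rfl⟩
  · refine Or.inr (Or.inr (Or.inl ⟨y, x, h.swap, ?_⟩))
    rcases h' with ⟨rfl, rfl⟩ | ⟨rfl, rfl⟩ <;> simp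
  · exact Or.inr (Or.inr (Or.inr (Or.inr (by simpa using h))))
  · exact Or.inr (Or.inr (Or.inr (Or.inl h)))

/-- The implication graph is skew-symmetric because clauses are unordered pairs. -/
theorem Imp.contrapose {p q : V ⊕ V} (h : Imp G a b p q) : Imp G a b q.swap p.swap := by
  unfold Imp
  rw [Sum.swap_swap]
  exact Excl.symm h

theorem Imp.swap {p q : V ⊕ V} (h : Imp G a b p q) : Imp G b a p.swap q.swap :=
  Excl.swap h

/-- The crossing edge `ab` makes `a` and `b` boundary vertices, so the ends of any other crossing
edge must be equal or adjacent to them. -/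
theorem not_edgeExcl_of_mem (hG : G.Connected) (hab : G.Adj a b) {H : Set V}
    (hH : H ∈ halfspaces G a b) {x y : V} (hx : x ∈ H) (hy : y ∉ H) : ¬ EdgeExcl G a b x y := by
  obtain ⟨ha, hb, h1, h2⟩ := (mem_halfspaces_iff hG).1 hH
  rintro ⟨hxy, h | h⟩
  · rcases h1 x y a b hx ha hy hb hxy hab with h' | h'
    · exact h.1 h'
    · exact h.2 h'
  · rcases h2 y x b a hy hb (by simpa) (by simpa) hxy.symm hab.symm with h' | h'
    · exact h.1 h'
    · exact h.2 h'

theorem not_boundaryExcl_of_mem (hG : G.Connected) (hab : G.Adj a b) {H : Set V}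
    (hH : H ∈ halfspaces G a b) {p q : V ⊕ V} (hp : Holds H p) (hq : Holds H q) :
    ¬ BoundaryExcl G a b p q := by
  obtain ⟨ha, hb, h1, h2⟩ := (mem_halfspaces_iff hG).1 hH
  -- A true gate literal makes `x` a boundary vertex. If `x` is not adjacent to `b`, then `x ∈ H` is
  -- automatic, since the edge `ax` must not cross.
  have gate : ∀ x p, Gate G a b x p → Holds H p → ∃ y, x ∈ H ∧ y ∉ H ∧ G.Adj x y := by
    rintro x p ⟨hxa, hxb, ⟨h, rfl⟩ | ⟨h, y, hxy, rfl⟩⟩ hp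
    · exact ⟨b, hp, hb, h⟩
    · refine ⟨y, ?_, hp, hxy⟩
      by_contra hx
      exact not_edgeExcl_of_mem hG hab hH ha hx ⟨hxa.symm, Or.inr ⟨hxb, h⟩⟩
  rintro ⟨x, x', hne, hadj, g, g'⟩
  obtain ⟨y, hx, hy, hxy⟩ := gate _ _ g hp
  obtain ⟨y', hx', hy', hxy'⟩ := gate _ _ g' hq
  exact (h1 x y x' y' hx hx' hy hy' hxy hxy').elim hne hadj

/-- Edge clauses put all boundary vertices into `N[a]`; those other than `a` have a true gate
literal, so the boundary clauses make them pairwise equal or adjacent. Stated for one side only, so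
that it also applies to `Hᶜ` with `a` and `b` exchanged. -/
theorem boundaryClique_of_not_excl {H : Set V} (hb : b ∉ H)
    (he : ∀ x y, x ∈ H → y ∉ H → ¬ EdgeExcl G a b x y)
    (hB : ∀ p q, Holds H p → Holds H q → ¬ BoundaryExcl G a b p q) : BoundaryClique G H := by
  have near : ∀ x y, x ∈ H → y ∉ H → G.Adj x y → x = a ∨ G.Adj x a := by
    intro x y hx hy hxy
    by_contra! h
    exact he x y hx hy ⟨hxy, Or.inl h⟩
  have gate : ∀ x y, x ∈ H → y ∉ H → G.Adj x y → G.Adj x a → ∃ p, Gate G a b x p ∧ Holds H p := by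
    intro x y hx hy hxy hxa
    have hxb : x ≠ b := fun h => hb (h ▸ hx)
    by_cases h : G.Adj x b
    · exact ⟨.inl x, ⟨hxa, hxb, Or.inl ⟨h, rfl⟩⟩, hx⟩
    · exact ⟨.inr y, ⟨hxa, hxb, Or.inr ⟨h, y, hxy, rfl⟩⟩, hy⟩
  intro x y x' y' hx hx' hy hy' hxy hxy'
  rcases near x y hx hy hxy with rfl | hxa
  · exact (near x' y' hx' hy' hxy').imp Eq.symm SimpleGraph.Adj.symm
  rcases near x' y' hx' hy' hxy' with rfl | hxa'
  · exact Or.inr hxa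
  obtain ⟨p, g, hp⟩ := gate x y hx hy hxy hxa
  obtain ⟨q, g', hq⟩ := gate x' y' hx' hy' hxy' hxa'
  by_contra! h
  exact hB p q hp hq ⟨x, x', h.1, h.2, g, g'⟩

theorem mem_halfspaces_iff_excl (hG : G.Connected) (hab : G.Adj a b) {H : Set V} :
    H ∈ halfspaces G a b ↔ ∀ p q, Excl G a b p q → Holds H p → ¬ Holds H q := by
  constructor
  · intro hH p q h hp hq
    rcases h with ⟨rfl, rfl⟩ | ⟨rfl, rfl⟩ | ⟨x, y, h, h'⟩ | h | h
    · exact hp hH.2.1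
    · exact hH.2.2 hp
    · rcases h' with ⟨rfl, rfl⟩ | ⟨rfl, rfl⟩
      · exact not_edgeExcl_of_mem hG hab hH hp hq h
      · exact not_edgeExcl_of_mem hG hab hH hq hp h
    · exact not_boundaryExcl_of_mem hG hab hH hp hq h
    · refine not_boundaryExcl_of_mem hG hab.symm (compl_mem_halfspaces hH) ?_ ?_ h <;>
        simpa [holds_compl]
  · intro h
    have ha : a ∈ H := by
      by_contra ha
      exact h (.inr a) (.inr a) (Or.inl ⟨rfl, rfl⟩) ha ha
    have hb : b ∉ H := fun hb => h (.inl b) (.inl b) (Or.inr (Or.inl ⟨rfl, rfl⟩)) hb hb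
    have he : ∀ x y, x ∈ H → y ∉ H → ¬ EdgeExcl G a b x y := fun x y hx hy hxy =>
      h (.inl x) (.inr y) (Or.inr (Or.inr (Or.inl ⟨x, y, hxy, Or.inl ⟨rfl, rfl⟩⟩))) hx hy
    refine (mem_halfspaces_iff hG).2 ⟨ha, hb, boundaryClique_of_not_excl hb he ?_,
      boundaryClique_of_not_excl (a := b) (b := a) (by simpa) ?_ ?_⟩
    · exact fun p q hp hq hpq => h p q (Or.inr (Or.inr (Or.inr (Or.inl hpq)))) hp hq
    · intro x y hx hy hxy
      exact he y x (by simpa using hy) hx hxy.swap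
    · intro p q hp hq hpq
      rw [holds_compl, ← holds_swap] at hp hq
      refine h p.swap q.swap (Or.inr (Or.inr (Or.inr (Or.inr ?_)))) hp hq
      simpa using hpq

theorem Imp.holds (hG : G.Connected) (hab : G.Adj a b) {H : Set V} (hH : H ∈ halfspaces G a b)
    {p q : V ⊕ V} (h : Imp G a b p q) (hp : Holds H p) : Holds H q := by
  have := (mem_halfspaces_iff_excl hG hab).1 hH p q.swap h hp
  simpa using this

/-- Derivability of one literal from another. -/
abbrev Derives (G : SimpleGraph V) (a b : V) : V ⊕ V → V ⊕ V → Prop :=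
  Relation.ReflTransGen (Imp G a b)

theorem Derives.contrapose {p q : V ⊕ V} (h : Derives G a b p q) :
    Derives G a b q.swap p.swap := by
  induction h with
  | refl => exact .refl
  | tail _ h ih => exact .head h.contrapose ih

theorem Derives.holds (hG : G.Connected) (hab : G.Adj a b) {H : Set V}
    (hH : H ∈ halfspaces G a b) {p q : V ⊕ V} (h : Derives G a b p q) (hp : Holds H p) :
    Holds H q := by
  induction h with
  | refl => exact hp
  | tail _ h ih => exact h.holds hG hab hH ih

/-- Two literals hold together in some halfspace unless a contradiction can be derived. -/
theorem exists_halfspace_of_not_derives (hG : G.Connected) (hab : G.Adj a b)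
    (hne : (halfspaces G a b).Nonempty) {p q : V ⊕ V} (hp : ¬ Derives G a b p p.swap)
    (hq : ¬ Derives G a b q q.swap) (hpq : ¬ Derives G a b p q.swap) :
    ∃ H ∈ halfspaces G a b, Holds H p ∧ Holds H q := by
  obtain ⟨H₀, hH₀⟩ := hne
  -- The usual 2-SAT argument: the consequences of `p` and `q` are consistent and closed under
  -- implication, so they may override the known solution `H₀`.
  let D : V ⊕ V → Prop := fun r => Derives G a b p r ∨ Derives G a b q r
  have hD : ∀ r, D r → ¬ D r.swap := by
    have aux : ∀ {x y r : V ⊕ V}, Derives G a b x r → Derives G a b y r.swap →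
        Derives G a b x y.swap := fun h h' => h.trans (by simpa using h'.contrapose)
    rintro r (h | h) (h' | h')
    · exact hp (aux h h')
    · exact hpq (aux h h')
    · exact hpq (aux h' (by simpa using h))
    · exact hq (aux h h')
  have step : ∀ r t, D r → Imp G a b r t → D t := fun r t h h' =>
    h.imp (fun h => h.tail h') (fun h => h.tail h')
  let H : Set V := {v | D (.inl v) ∨ (v ∈ H₀ ∧ ¬ D (.inr v))}
  -- By consistency of `D`, the description of `H` takes the same form for negative literals.
  have hH : ∀ r, Holds H r ↔ D r ∨ (Holds H₀ r ∧ ¬ D r.swap) := by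
    rintro (v | v)
    · rfl
    · have := hD (.inl v)
      have := hD (.inr v)
      simp only [Sum.swap_inl, Sum.swap_inr] at *
      simp only [holds_inr, H, Set.mem_ofPred_eq]
      tauto
  refine ⟨H, (mem_halfspaces_iff_excl hG hab).2 ?_, (hH p).2 (Or.inl (Or.inl .refl)),
    (hH q).2 (Or.inl (Or.inr .refl))⟩
  intro r t hrt hr ht
  have h1 : D r → D t.swap := fun h => step r _ h (by simpa [Imp] using hrt)
  have h2 : D t → D r.swap := fun h => step t _ h (by simpa [Imp] using hrt.symm)
  have h3 := (mem_halfspaces_iff_excl hG hab).1 hH₀ r t hrt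
  rcases (hH r).1 hr with hr | hr
  · rcases (hH t).1 ht with ht | ht
    · exact hD t ht (h1 hr)
    · exact ht.2 (h1 hr)
  · rcases (hH t).1 ht with ht | ht
    · exact hr.2 (h2 ht)
    · exact h3 hr.1 ht.1

end Literals

/-! ### Entailment between nontrivial vertices -/

section Entailment

variable {V : Type*} {G : SimpleGraph V} {a b : V}

/-- Every member of `H_m(ab)` that satisfies `p` satisfies `q`. -/
def Entails (G : SimpleGraph V) (a b : V) (p q : V ⊕ V) : Prop :=
  ∀ H ∈ halfspaces G a b, Holds H p → Holds H q

/-- Some but not all members of `H_m(ab)` satisfy `p`. -/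
def Undecided (G : SimpleGraph V) (a b : V) (p : V ⊕ V) : Prop :=
  (∃ H ∈ halfspaces G a b, Holds H p) ∧ (∃ H ∈ halfspaces G a b, ¬ Holds H p)

theorem undecided_inl {v : V} : Undecided G a b (.inl v) ↔ Nontriv G a b v := Iff.rfl

theorem Undecided.swap {p : V ⊕ V} (h : Undecided G a b p) : Undecided G a b p.swap := by
  obtain ⟨⟨H, h1, h2⟩, H', h3, h4⟩ := h
  exact ⟨⟨H', h3, by simpa using h4⟩, H, h1, by simpa using h2⟩

theorem undecided_inr {v : V} : Undecided G a b (.inr v) ↔ Nontriv G a b v :=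
  ⟨fun h => h.swap, fun h => Undecided.swap (p := .inl v) h⟩

theorem Nontriv.symm {v : V} (h : Nontriv G a b v) : Nontriv G b a v := by
  obtain ⟨⟨H, h1, h2⟩, H', h3, h4⟩ := h
  exact ⟨⟨H'ᶜ, compl_mem_halfspaces h3, h4⟩, Hᶜ, compl_mem_halfspaces h1, fun h => h h2⟩

theorem Undecided.symm {p : V ⊕ V} (h : Undecided G a b p) : Undecided G b a p.swap := by
  rcases p with v | v
  · exact undecided_inr.2 (Nontriv.symm h)
  · exact undecided_inl.2 (Nontriv.symm (undecided_inr.1 h))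

theorem Nontriv.ne_left {v : V} (h : Nontriv G a b v) : v ≠ a := by
  obtain ⟨-, H, h1, h2⟩ := h
  rintro rfl
  exact h2 h1.2.1

theorem Nontriv.ne_right {v : V} (h : Nontriv G a b v) : v ≠ b := h.symm.ne_left

theorem mem_of_adj_left (hG : G.Connected) (hab : G.Adj a b) {x : V} (hxa : G.Adj x a)
    (hxb : x ≠ b) (hxb' : ¬ G.Adj x b) {H : Set V} (hH : H ∈ halfspaces G a b) : x ∈ H := by
  by_contra hx
  exact not_edgeExcl_of_mem hG hab hH hH.2.1 hx ⟨hxa.symm, Or.inr ⟨hxb, hxb'⟩⟩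

/-- A neighbour of `a` (other than `b`) that misses `b` lies in every halfspace, hence is trivial.
-/
theorem Nontriv.adj_right (hG : G.Connected) (hab : G.Adj a b) {x : V} (h : Nontriv G a b x)
    (hxa : G.Adj x a) : G.Adj x b := by
  by_contra hxb
  obtain ⟨-, H, h1, h2⟩ := id h
  exact h2 (mem_of_adj_left hG hab hxa h.ne_right hxb h1)

theorem Nontriv.adj_left (hG : G.Connected) (hab : G.Adj a b) {x : V} (h : Nontriv G a b x)
    (hxb : G.Adj x b) : G.Adj x a :=
  h.symm.adj_right hG hab.symm hxb

/-- Nontrivial common neighbours of `a` and `b`. -/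
def Central (G : SimpleGraph V) (a b v : V) : Prop :=
  Nontriv G a b v ∧ G.Adj v a ∧ G.Adj v b

theorem Central.symm {v : V} (h : Central G a b v) : Central G b a v := ⟨h.1.symm, h.2.2, h.2.1⟩

/-- Every central vertex outside `U` entails every central vertex in `U`. -/
def IsCut (G : SimpleGraph V) (a b : V) (U : Set V) : Prop :=
  ∀ s t, s ∉ U → t ∈ U → Central G a b s → Central G a b t → Entails G a b (.inl s) (.inl t)

theorem IsCut.symm {U : Set V} (h : IsCut G a b U) : IsCut G b a Uᶜ := by
  intro s t hs ht hs' ht' H hH hsH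
  by_contra htH
  exact h t s ht (by simpa using hs) ht'.symm hs'.symm Hᶜ (compl_mem_halfspaces hH) htH hsH

/-- Implications between central vertices across a cut. -/
def CutStep (G : SimpleGraph V) (a b : V) (p q : V ⊕ V) : Prop :=
  ∃ U s t, IsCut G a b U ∧ s ∉ U ∧ t ∈ U ∧ Central G a b s ∧ Central G a b t ∧
    ((p = .inl s ∧ q = .inl t) ∨ (p = .inr t ∧ q = .inr s))

theorem CutStep.contrapose {p q : V ⊕ V} (h : CutStep G a b p q) :
    CutStep G a b q.swap p.swap := by
  obtain ⟨U, s, t, h1, h2, h3, h4, h5, ⟨rfl, rfl⟩ | ⟨rfl, rfl⟩⟩ := h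
  · exact ⟨U, s, t, h1, h2, h3, h4, h5, Or.inr ⟨rfl, rfl⟩⟩
  · exact ⟨U, s, t, h1, h2, h3, h4, h5, Or.inl ⟨rfl, rfl⟩⟩

theorem CutStep.symm {p q : V ⊕ V} (h : CutStep G a b p q) :
    CutStep G b a p.swap q.swap := by
  obtain ⟨U, s, t, h1, h2, h3, h4, h5, ⟨rfl, rfl⟩ | ⟨rfl, rfl⟩⟩ := h
  · exact ⟨Uᶜ, t, s, h1.symm, by simpa, h2, h5.symm, h4.symm, Or.inr ⟨rfl, rfl⟩⟩
  · exact ⟨Uᶜ, t, s, h1.symm, by simpa, h2, h5.symm, h4.symm, Or.inl ⟨rfl, rfl⟩⟩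

theorem Central.gate {x : V} (h : Central G a b x) : Gate G a b x (.inl x) :=
  ⟨h.2.1, h.1.ne_right, Or.inl ⟨h.2.2, rfl⟩⟩

/-- Here `x` lies in every halfspace. If `t ∈ N(x)` were outside `H` and `s ∉ N(x)` inside, then `x`
and `s` would be nonadjacent boundary vertices, with outside neighbours `t` and `b`. -/
theorem isCut_neighborSet (hG : G.Connected) (hab : G.Adj a b) {x : V} (hxa : G.Adj x a)
    (hxb : x ≠ b) (hxb' : ¬ G.Adj x b) : IsCut G a b (G.neighborSet x) := by
  intro s t hs ht hs' ht' H hH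
  refine Imp.holds hG hab hH (Or.inr (Or.inr (Or.inr (Or.inl
    ⟨s, x, ?_, fun h => hs h.symm, hs'.gate, hxa, hxb, Or.inr ⟨hxb', t, ht, rfl⟩⟩))))
  rintro rfl
  exact hxb' hs'.2.2

theorem Nontriv.central_of_adj (hG : G.Connected) (hab : G.Adj a b) {x y : V}
    (hy : Nontriv G a b y) (hxa : G.Adj x a) (hxb : x ≠ b) (hxb' : ¬ G.Adj x b)
    (hxy : G.Adj x y) : Central G a b y := by
  have hyb : G.Adj y b := by
    by_contra hyb
    obtain ⟨-, H, h1, h2⟩ := id hy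
    exact not_edgeExcl_of_mem hG hab h1 (mem_of_adj_left hG hab hxa hxb hxb' h1) h2
      ⟨hxy, Or.inr ⟨hy.ne_right, hyb⟩⟩
  exact ⟨hy, hy.adj_left hG hab hyb, hyb⟩

/-- Split by the two gates. For two nonadjacent central vertices, the clauses for `H` and for `Hᶜ`
together say that they lie on opposite sides, so the implication is reversible. One central vertex
and one forced vertex give a cut. Two forced vertices cannot occur with undecided literals. -/
theorem BoundaryExcl.reversible_or_cutStep (hG : G.Connected) (hab : G.Adj a b) {p q : V ⊕ V}
    (h : BoundaryExcl G a b p q.swap) (hp : Undecided G a b p) (hq : Undecided G a b q) :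
    Imp G a b q p ∨ CutStep G a b p q := by
  have mixed : ∀ {x x' y : V}, x ≠ x' → ¬ G.Adj x x' → Nontriv G a b x → Nontriv G a b y →
      G.Adj x a → G.Adj x b → G.Adj x' a → x' ≠ b → ¬ G.Adj x' b → G.Adj x' y →
      CutStep G a b (.inl x) (.inl y) := by
    intro x x' y hne hadj hx hy hxa hxb hxa' hxb' hxb'' hxy
    exact ⟨_, x, y, isCut_neighborSet hG hab hxa' hxb' hxb'', fun h => hadj h.symm, hxy,
      ⟨hx, hxa, hxb⟩, hy.central_of_adj hG hab hxa' hxb' hxb'' hxy, Or.inl ⟨rfl, rfl⟩⟩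
  obtain ⟨x, x', hne, hadj, ⟨hxa, hxb, ⟨h, rfl⟩ | ⟨h, y, hxy, rfl⟩⟩,
    ⟨hxa', hxb', ⟨h', hq'⟩ | ⟨h', y', hxy', hq'⟩⟩⟩ := h
  · obtain rfl : q = .inr x' := by simpa using congrArg Sum.swap hq'
    refine Or.inl (Or.inr (Or.inr (Or.inr (Or.inr
      ⟨x', x, hne.symm, fun h => hadj h.symm, ?_, ?_⟩))))
    · exact Central.gate ⟨(undecided_inr.1 hq).symm, h', hxa'⟩
    · exact Central.gate ⟨(undecided_inl.1 hp).symm, h, hxa⟩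
  · obtain rfl : q = .inl y' := by simpa using congrArg Sum.swap hq'
    exact Or.inr (mixed hne hadj hp hq hxa h hxa' hxb' h' hxy')
  · obtain rfl : q = .inr x' := by simpa using congrArg Sum.swap hq'
    exact Or.inr (mixed hne.symm (fun h => hadj h.symm) (undecided_inr.1 hq) (undecided_inr.1 hp)
      hxa' h' hxa hxb h hxy).contrapose
  · obtain rfl : q = .inl y' := by simpa using congrArg Sum.swap hq'
    exfalso
    have hy := (undecided_inr.1 hp).central_of_adj hG hab hxa hxb h hxy
    have hy' := (undecided_inl.1 hq).central_of_adj hG hab hxa' hxb' h' hxy'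
    -- Every neighbour of `x` or every neighbour of `x'` lies in `H`. A common neighbour would
    -- therefore be trivial; so `y'` is outside `N(x)`, and the cut at `N(x)` gives `y' → y`.
    -- Together with `¬y → y'` this forces `y`.
    have excl : ∀ u u', G.Adj x u → G.Adj x' u' → ∀ H ∈ halfspaces G a b, u ∉ H → u' ∈ H := by
      intro u u' hu hu' H hH
      exact Imp.holds hG hab hH (p := .inr u) (q := .inl u') (Or.inr (Or.inr (Or.inr (Or.inl
        ⟨x, x', hne, hadj, ⟨hxa, hxb, Or.inr ⟨h, u, hu, rfl⟩⟩,
          ⟨hxa', hxb', Or.inr ⟨h', u', hu', rfl⟩⟩⟩))))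
    have n1 : ¬ G.Adj x y' := by
      intro n
      obtain ⟨-, H, k1, k2⟩ := hy'.1
      exact k2 (excl y' y' n hxy' H k1 k2)
    have n2 : ¬ G.Adj x' y := by
      intro n
      obtain ⟨-, H, k1, k2⟩ := hy.1
      exact k2 (excl y y hxy n H k1 k2)
    obtain ⟨-, H, k1, k2⟩ := hy.1
    exact k2 (isCut_neighborSet hG hab hxa hxb h y' y n1 hxy hy' hy H k1
      (excl y y' hxy hxy' H k1 k2))

theorem Imp.reversible_or_cutStep (hG : G.Connected) (hab : G.Adj a b) {p q : V ⊕ V}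
    (h : Imp G a b p q) (hp : Undecided G a b p) (hq : Undecided G a b q) :
    Imp G a b q p ∨ CutStep G a b p q := by
  -- A nontrivial vertex is adjacent to both or neither of `a` and `b`, so an edge clause also holds
  -- with its two ends exchanged.
  have edge : ∀ {x y}, EdgeExcl G a b x y → Nontriv G a b x → Nontriv G a b y →
      EdgeExcl G a b y x := by
    rintro x y ⟨h, h'⟩ hx hy
    refine ⟨h.symm, ?_⟩
    rcases h' with h' | h'
    · exact Or.inr ⟨hx.ne_right, fun k => h'.2 (hx.adj_left hG hab k)⟩
    · exact Or.inl ⟨hy.ne_left, fun k => h'.2 (hy.adj_right hG hab k)⟩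
  rcases h with ⟨rfl, -⟩ | ⟨rfl, -⟩ | ⟨x, y, h, ⟨rfl, hq'⟩ | ⟨rfl, hq'⟩⟩ | h | h
  · exact absurd rfl (undecided_inr.1 hp).ne_left
  · exact absurd rfl (undecided_inl.1 hp).ne_right
  · obtain rfl : q = .inl y := by simpa using congrArg Sum.swap hq'
    exact Or.inl (Or.inr (Or.inr (Or.inl ⟨y, x, edge h hp hq, Or.inl ⟨rfl, rfl⟩⟩)))
  · obtain rfl : q = .inr x := by simpa using congrArg Sum.swap hq'
    exact Or.inl (Or.inr (Or.inr (Or.inl ⟨y, x, edge h (undecided_inr.1 hq)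
      (undecided_inr.1 hp), Or.inr ⟨rfl, rfl⟩⟩)))
  · exact h.reversible_or_cutStep hG hab hp hq
  · refine (h.reversible_or_cutStep hG hab.symm hp.symm hq.symm).imp ?_ ?_
    · intro k
      simpa using k.swap
    · intro k
      simpa using k.symm

theorem Derives.entails (hG : G.Connected) (hab : G.Adj a b) {p q : V ⊕ V}
    (h : Derives G a b p q) : Entails G a b p q := fun _ hH => h.holds hG hab hH

/-- If `q` were not derivable, 2-SAT would provide a halfspace with `p` and `¬q`; undecidedness
rules out that either of these alone is contradictory. -/
theorem Entails.derives (hG : G.Connected) (hab : G.Adj a b) {p q : V ⊕ V}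
    (h : Entails G a b p q) (hp : Undecided G a b p) (hq : Undecided G a b q) :
    Derives G a b p q := by
  by_contra hpq
  obtain ⟨⟨H, h1, h2⟩, -⟩ := hp
  obtain ⟨-, H', h3, h4⟩ := hq
  obtain ⟨K, hK, hKp, hKq⟩ := exists_halfspace_of_not_derives hG hab ⟨H, h1⟩ (p := p) (q := q.swap)
    (fun k => by simpa [h2] using k.holds hG hab h1 h2)
    (fun k => h4 (by simpa using k.holds hG hab h3 (by simpa using h4)))
    (by simpa using hpq)
  exact (holds_swap.1 hKq) (h K hK hKp)

theorem Derives.reversible_or_cutStep (hG : G.Connected) (hab : G.Adj a b) {p q : V ⊕ V}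
    (h : Derives G a b p q) (hp : Undecided G a b p) (hq : Undecided G a b q) :
    Derives G a b q p ∨
      ∃ m m', Derives G a b p m ∧ CutStep G a b m m' ∧ Derives G a b m' q := by
  induction h with
  | refl => exact Or.inl .refl
  | @tail m q h h' ih =>
    -- Literals between two undecided ones are undecided: `m` holds where `p` does and fails where
    -- `q` does. So the one-step dichotomy applies along the whole chain.
    have hm : Undecided G a b m := by
      obtain ⟨⟨H, h1, h2⟩, -⟩ := hp
      obtain ⟨-, H', h3, h4⟩ := hq
      exact ⟨⟨H, h1, Derives.holds hG hab h1 h h2⟩, H', h3, fun k => h4 (h'.holds hG hab h3 k)⟩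
    rcases ih hm with k | ⟨r, r', k1, k2, k3⟩
    · rcases h'.reversible_or_cutStep hG hab hm hq with l | l
      · exact Or.inl (.head l k)
      · exact Or.inr ⟨m, q, h, l, .refl⟩
    · exact Or.inr ⟨r, r', k1, k2, k3.tail h'⟩

/-- Walk towards `a`. A nontrivial vertex not adjacent to `a` is not adjacent to `b` either, so no
edge at it can cross; the next vertex is on the same side and again nontrivial. -/
theorem Nontriv.exists_central (hG : G.Connected) (hab : G.Adj a b) {x : V}
    (hx : Nontriv G a b x) :
    ∃ w, Central G a b w ∧ ∀ H ∈ halfspaces G a b, (x ∈ H ↔ w ∈ H) := by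
  obtain ⟨p⟩ := hG.preconnected x a
  have key : ∀ c, c = a → ∀ x, G.Walk x c → Nontriv G a b x →
      ∃ w, Central G a b w ∧ ∀ H ∈ halfspaces G a b, (x ∈ H ↔ w ∈ H) := by
    rintro c hc x p
    induction p with
    | nil => exact fun hx => absurd hc hx.ne_left
    | @cons x y c h p ih =>
      intro hx
      by_cases hxa : G.Adj x a
      · exact ⟨x, ⟨hx, hxa, hx.adj_right hG hab hxa⟩, fun _ _ => Iff.rfl⟩
      · have hxb : ¬ G.Adj x b := fun k => hxa (hx.adj_left hG hab k)
        have hxy : ∀ H ∈ halfspaces G a b, (x ∈ H ↔ y ∈ H) := by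
          intro H hH
          constructor
          · intro k
            by_contra k'
            exact not_edgeExcl_of_mem hG hab hH k k' ⟨h, Or.inl ⟨hx.ne_left, hxa⟩⟩
          · intro k
            by_contra k'
            exact not_edgeExcl_of_mem hG hab hH k k' ⟨h.symm, Or.inr ⟨hx.ne_right, hxb⟩⟩
        have hy : Nontriv G a b y := by
          obtain ⟨⟨H, h1, h2⟩, H', h3, h4⟩ := hx
          exact ⟨⟨H, h1, (hxy H h1).1 h2⟩, H', h3, fun k => h4 ((hxy H' h3).2 k)⟩
        obtain ⟨w, hw, hw'⟩ := ih hc hy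
        exact ⟨w, hw, fun H hH => (hxy H hH).trans (hw' H hH)⟩
  exact key a rfl x p hx

/-- A proper entailment crosses a cut. -/
theorem Entails.exists_cut (hG : G.Connected) (hab : G.Adj a b) {p q : V ⊕ V}
    (h : Entails G a b p q) (h' : ¬ Entails G a b q p) (hp : Undecided G a b p)
    (hq : Undecided G a b q) :
    ∃ s t, Central G a b s ∧ Entails G a b (.inl s) (.inl t) ∧
      (∀ x, Nontriv G a b x → Entails G a b (.inl s) (.inl x) ∨ Entails G a b (.inl x) (.inl t)) ∧
      ((Entails G a b p (.inl s) ∧ Entails G a b (.inl t) q) ∨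
        (Entails G a b p (.inr t) ∧ Entails G a b (.inr s) q)) := by
  obtain ⟨m, m', h1, ⟨U, s, t, hU, hs, ht, hs', ht', hm⟩, h2⟩ :=
    ((h.derives hG hab hp hq).reversible_or_cutStep hG hab hp hq).resolve_left
      -- Properness excludes a derivation consisting of reversible steps only.
      (fun k => h' (k.entails hG hab))
  refine ⟨s, t, hs', hU s t hs ht hs' ht', ?_, ?_⟩
  · intro x hx
    obtain ⟨w, hw, hw'⟩ := hx.exists_central hG hab
    by_cases k : w ∈ U
    · exact Or.inl fun H hH l => (hw' H hH).2 (hU s w hs k hs' hw H hH l)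
    · exact Or.inr fun H hH l => hU w t k ht hw ht' H hH ((hw' H hH).1 l)
  · rcases hm with ⟨rfl, rfl⟩ | ⟨rfl, rfl⟩
    · exact Or.inl ⟨h1.entails hG hab, h2.entails hG hab⟩
    · exact Or.inr ⟨h1.entails hG hab, h2.entails hG hab⟩

/-- A proper entailment is between literals of the same sign. -/
theorem Entails.same_sign (hG : G.Connected) (hab : G.Adj a b) {p q : V ⊕ V}
    (h : Entails G a b p q) (h' : ¬ Entails G a b q p) (hp : Undecided G a b p)
    (hq : Undecided G a b q) :
    ∃ x y, (p = .inl x ∧ q = .inl y) ∨ (p = .inr x ∧ q = .inr y) := by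
  -- For opposite signs, placing both vertices relative to `s → t` always makes some undecided
  -- literal contradictory. For instance, `x → s → t → ¬y` with `s → y` refutes `x`, and with `y →
  -- t` it refutes `y`.
  obtain ⟨s, t, -, hst, cut, hm⟩ := h.exists_cut hG hab h' hp hq
  obtain ⟨⟨H₁, f1, h1⟩, H₂, f2, h2⟩ := hp
  obtain ⟨⟨H₃, f3, h3⟩, H₄, f4, h4⟩ := hq
  rcases p with x | x <;> rcases q with y | y
  · exact ⟨x, y, Or.inl ⟨rfl, rfl⟩⟩
  · exfalso
    have hx : Nontriv G a b x := ⟨⟨H₁, f1, h1⟩, H₂, f2, h2⟩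
    have hy : Nontriv G a b y := ⟨⟨H₄, f4, by simpa using h4⟩, H₃, f3, h3⟩
    have cx := cut x hx
    have cy := cut y hy
    simp only [Entails, holds_inl, holds_inr] at *
    grind
  · exfalso
    have hx : Nontriv G a b x := ⟨⟨H₂, f2, by simpa using h2⟩, H₁, f1, h1⟩
    have hy : Nontriv G a b y := ⟨⟨H₃, f3, h3⟩, H₄, f4, h4⟩
    have cx := cut x hx
    have cy := cut y hy
    simp only [Entails, holds_inl, holds_inr] at *
    grind
  · exact ⟨x, y, Or.inr ⟨rfl, rfl⟩⟩

/-- Proper entailment between nontrivial vertices is negatively transitive. -/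
theorem Entails.interpolate (hG : G.Connected) (hab : G.Adj a b) {x y z : V}
    (h : Entails G a b (.inl x) (.inl y)) (h' : ¬ Entails G a b (.inl y) (.inl x))
    (hx : Nontriv G a b x) (hy : Nontriv G a b y) (hz : Nontriv G a b z) :
    Entails G a b (.inl x) (.inl z) ∨ Entails G a b (.inl z) (.inl y) := by
  -- Along `x → s → t → y`, the position of `z` gives the claim. The contraposed passage `x → ¬t` is
  -- impossible: `x → t` would refute `x`, and `s → x` would refute `s`.
  obtain ⟨s, t, hs, hst, cut, hm⟩ := h.exists_cut hG hab h' hx hy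
  have cx := cut x hx
  have cz := cut z hz
  obtain ⟨⟨H₁, f1, h1⟩, -⟩ := hx
  obtain ⟨⟨H₂, f2, h2⟩, -⟩ := hs.1
  simp only [Entails, holds_inl, holds_inr] at *
  grind

end Entailment

/-! ### The cell decomposition -/

section Decomposition

variable {V : Type*} {G : SimpleGraph V} {a b : V}

/-- Nontrivial vertices on the same side of all halfspaces. -/
def SameCell (G : SimpleGraph V) (a b x y : V) : Prop :=
  Nontriv G a b x ∧ Nontriv G a b y ∧ ∀ H ∈ halfspaces G a b, (x ∈ H ↔ y ∈ H)

/-- Nontrivial vertices on opposite sides of all halfspaces. -/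
def TwinCell (G : SimpleGraph V) (a b x y : V) : Prop :=
  Nontriv G a b x ∧ Nontriv G a b y ∧ ∀ H ∈ halfspaces G a b, (x ∈ H ↔ y ∉ H)

/-- Proper entailment between vertices. -/
def Precedes (G : SimpleGraph V) (a b x y : V) : Prop :=
  Entails G a b (.inl x) (.inl y) ∧ ¬ Entails G a b (.inl y) (.inl x)

theorem SameCell.symm {x y : V} (h : SameCell G a b x y) : SameCell G a b y x :=
  ⟨h.2.1, h.1, fun H hH => (h.2.2 H hH).symm⟩

theorem TwinCell.symm {x y : V} (h : TwinCell G a b x y) : TwinCell G a b y x :=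
  ⟨h.2.1, h.1, fun H hH => by have := h.2.2 H hH; tauto⟩

theorem SameCell.trans {x y z : V} (h : SameCell G a b x y) (h' : SameCell G a b y z) :
    SameCell G a b x z :=
  ⟨h.1, h'.2.1, fun H hH => (h.2.2 H hH).trans (h'.2.2 H hH)⟩

theorem SameCell.trans_twin {x y z : V} (h : SameCell G a b x y) (h' : TwinCell G a b y z) :
    TwinCell G a b x z :=
  ⟨h.1, h'.2.1, fun H hH => (h.2.2 H hH).trans (h'.2.2 H hH)⟩

theorem TwinCell.trans_same {x y z : V} (h : TwinCell G a b x y) (h' : SameCell G a b y z) :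
    TwinCell G a b x z :=
  (h'.symm.trans_twin h.symm).symm

theorem TwinCell.trans {x y z : V} (h : TwinCell G a b x y) (h' : TwinCell G a b y z) :
    SameCell G a b x z :=
  ⟨h.1, h'.2.1, fun H hH => by have := h.2.2 H hH; have := h'.2.2 H hH; tauto⟩

theorem SameCell.not_twinCell {x y : V} (h : SameCell G a b x y) : ¬ TwinCell G a b x y := by
  intro h'
  obtain ⟨⟨H, hH, -⟩, -⟩ := h.1
  have := h.2.2 H hH
  have := h'.2.2 H hH
  tauto

theorem Precedes.trans {x y z : V} (h : Precedes G a b x y) (h' : Precedes G a b y z) :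
    Precedes G a b x z :=
  ⟨fun H hH k => h'.1 H hH (h.1 H hH k), fun k => h.2 fun H hH l => k H hH (h'.1 H hH l)⟩

theorem Precedes.asymm {x y : V} (h : Precedes G a b x y) : ¬ Precedes G a b y x :=
  fun h' => h.2 h'.1

/-- Interpolation with strictness restored: if neither alternative were proper, the implications
would compose to `y → x`. -/
theorem Precedes.or {x y z : V} (hG : G.Connected) (hab : G.Adj a b) (h : Precedes G a b x y)
    (hx : Nontriv G a b x) (hy : Nontriv G a b y) (hz : Nontriv G a b z) :
    Precedes G a b x z ∨ Precedes G a b z y := by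
  have h1 := h.1.interpolate hG hab h.2 hx hy hz
  by_contra! k
  simp only [Precedes, not_and, not_not] at k
  rcases h1 with h1 | h1
  · have h2 := k.1 h1
    exact h.2 fun H hH l => h2 H hH (k.2 (fun H hH m => h.1 H hH (h2 H hH m)) H hH l)
  · have h2 := k.2 h1
    exact h.2 fun H hH l => k.1 (fun H hH m => h2 H hH (h.1 H hH m)) H hH (h2 H hH l)

/-- The vertices that lie in all halfspaces. -/
def base (G : SimpleGraph V) (a b : V) : Set V := {x | ∀ H ∈ halfspaces G a b, x ∈ H}

/-! ### Halfspaces as upward closed choices of cells -/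

section Representatives

variable {ι : Type*} (r : ι → V)

/-- The set that contains the same half as `r i` for `i ∈ T`, and the twin half otherwise. -/
def assemble (G : SimpleGraph V) (a b : V) (T : Set ι) : Set V :=
  base G a b ∪ (⋃ i ∈ T, {v | SameCell G a b (r i) v}) ∪ (⋃ i ∈ Tᶜ, {v | TwinCell G a b (r i) v})

theorem mem_assemble {T : Set ι} {v : V} : v ∈ assemble r G a b T ↔ v ∈ base G a b ∨
    (∃ i ∈ T, SameCell G a b (r i) v) ∨ (∃ i, i ∉ T ∧ TwinCell G a b (r i) v) := by
  simp [assemble, or_assoc]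

variable {r}

/-- A halfspace is determined by the representatives it contains, since every nontrivial vertex is
tied to one of them. -/
theorem eq_assemble (hr : ∀ v, Nontriv G a b v → ∃ i, SameCell G a b (r i) v ∨
    TwinCell G a b (r i) v) {H : Set V} (hH : H ∈ halfspaces G a b) :
    H = assemble r G a b {i | r i ∈ H} := by
  ext v
  rw [mem_assemble]
  constructor
  · intro hv
    by_cases hb : v ∈ base G a b
    · exact Or.inl hb
    · have hn : Nontriv G a b v := by
        simp only [base, Set.mem_ofPred_eq, not_forall] at hb
        obtain ⟨H', h1, h2⟩ := hb
        exact ⟨⟨H, hH, hv⟩, H', h1, h2⟩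
      obtain ⟨i, h | h⟩ := hr v hn
      · exact Or.inr (Or.inl ⟨i, (h.2.2 H hH).2 hv, h⟩)
      · exact Or.inr (Or.inr ⟨i, fun k => (h.2.2 H hH).1 k hv, h⟩)
  · rintro (h | ⟨i, hi, h⟩ | ⟨i, hi, h⟩)
    · exact h H hH
    · exact (h.2.2 H hH).1 hi
    · by_contra k
      exact hi ((h.2.2 H hH).2 k)

variable (hr : ∀ v, Nontriv G a b v → ∃ i, SameCell G a b (r i) v ∨ TwinCell G a b (r i) v)
  (hr' : ∀ i j, SameCell G a b (r i) (r j) ∨ TwinCell G a b (r i) (r j) → i = j)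
  (hn : ∀ i, Nontriv G a b (r i))

include hr hr'

/-- Reduces undecided literals to literals on representatives, with the same truth value in the
assembled set and in all halfspaces. -/
theorem exists_representative_literal {T : Set ι} {p : V ⊕ V} (hp : Undecided G a b p)
    (h : Holds (assemble r G a b T) p) :
    ∃ i p', (∀ H ∈ halfspaces G a b, (Holds H p ↔ Holds H p')) ∧
      ((p' = .inl (r i) ∧ i ∈ T) ∨ (p' = .inr (r i) ∧ i ∉ T)) := by
  have same : ∀ i v, SameCell G a b (r i) v → (v ∈ assemble r G a b T ↔ i ∈ T) := by
    intro i v hv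
    rw [mem_assemble]
    constructor
    · rintro (k | ⟨j, hj, k⟩ | ⟨j, hj, k⟩)
      · obtain ⟨-, H, h1, h2⟩ := hv.2.1
        exact absurd (k H h1) h2
      · rwa [hr' i j (Or.inl (hv.trans k.symm))]
      · obtain rfl := hr' i j (Or.inr (hv.trans_twin k.symm))
        exact absurd k hv.not_twinCell
    · exact fun k => Or.inr (Or.inl ⟨i, k, hv⟩)
  have twin : ∀ i v, TwinCell G a b (r i) v → (v ∈ assemble r G a b T ↔ i ∉ T) := by
    intro i v hv
    rw [mem_assemble]
    constructor
    · rintro (k | ⟨j, hj, k⟩ | ⟨j, hj, k⟩)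
      · obtain ⟨-, H, h1, h2⟩ := hv.2.1
        exact absurd (k H h1) h2
      · obtain rfl := hr' i j (Or.inr (hv.trans_same k.symm))
        exact absurd hv k.not_twinCell
      · rwa [hr' i j (Or.inl (hv.trans k.symm))]
    · exact fun k => Or.inr (Or.inr ⟨i, k, hv⟩)
  rcases p with v | v
  · obtain ⟨i, k | k⟩ := hr v (undecided_inl.1 hp)
    · exact ⟨i, .inl (r i), fun H hH => (k.2.2 H hH).symm, Or.inl ⟨rfl, (same i v k).1 h⟩⟩
    · exact ⟨i, .inr (r i), fun H hH => k.symm.2.2 H hH, Or.inr ⟨rfl, (twin i v k).1 h⟩⟩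
  · obtain ⟨i, k | k⟩ := hr v (undecided_inr.1 hp)
    · exact ⟨i, .inr (r i), fun H hH => not_congr (k.2.2 H hH).symm,
        Or.inr ⟨rfl, fun l => h ((same i v k).2 l)⟩⟩
    · refine ⟨i, .inl (r i), fun H hH => (k.2.2 H hH).symm, Or.inl ⟨rfl, ?_⟩⟩
      by_contra l
      exact h ((twin i v k).2 l)

include hn

/-- If two true literals excluded each other, one would entail the negation of the other. On
representatives this entailment is proper and hence joins equal signs, so it is an instance of
`Precedes` that contradicts the upward closure of `T`. -/
theorem exists_halfspace_of_assemble (hG : G.Connected) (hab : G.Adj a b)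
    (hne : (halfspaces G a b).Nonempty) {T : Set ι}
    (hT : ∀ i j, Precedes G a b (r i) (r j) → i ∈ T → j ∈ T) {p q : V ⊕ V}
    (hp : Holds (assemble r G a b T) p) (hq : Holds (assemble r G a b T) q) :
    ∃ H ∈ halfspaces G a b, Holds H p ∧ Holds H q := by
  have decided : ∀ p, Holds (assemble r G a b T) p →
      (∀ H ∈ halfspaces G a b, Holds H p) ∨ Undecided G a b p := by
    rintro (v | v) h
    · rcases (mem_assemble r).1 h with h | ⟨i, -, h⟩ | ⟨i, -, h⟩
      · exact Or.inl h
      · exact Or.inr (undecided_inl.2 h.2.1)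
      · exact Or.inr (undecided_inl.2 h.2.1)
    · by_contra! k
      obtain ⟨⟨H, h1, h2⟩, k⟩ := k
      apply k
      refine undecided_inr.2 ⟨⟨H, h1, by simpa using h2⟩, ?_⟩
      by_contra! l
      exact h ((mem_assemble r).2 (Or.inl l))
  rcases decided p hp with kp | kp
  · rcases decided q hq with kq | kq
    · obtain ⟨H, hH⟩ := hne
      exact ⟨H, hH, kp H hH, kq H hH⟩
    · obtain ⟨⟨H, hH, h⟩, -⟩ := kq
      exact ⟨H, hH, kp H hH, h⟩
  rcases decided q hq with kq | kq
  · obtain ⟨⟨H, hH, h⟩, -⟩ := kp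
    exact ⟨H, hH, h, kq H hH⟩
  obtain ⟨i, p', hpp, hp'⟩ := exists_representative_literal hr hr' kp hp
  obtain ⟨j, q', hqq, hq'⟩ := exists_representative_literal hr hr' kq hq
  by_contra! hno
  have ent : Entails G a b p' q'.swap := by
    intro H hH h
    rw [holds_swap, ← hqq H hH]
    exact hno H hH ((hpp H hH).2 h)
  have up : Undecided G a b p' := by
    rcases hp' with ⟨rfl, -⟩ | ⟨rfl, -⟩
    · exact undecided_inl.2 (hn i)
    · exact undecided_inr.2 (hn i)
  have uq : Undecided G a b q'.swap := by
    rcases hq' with ⟨rfl, -⟩ | ⟨rfl, -⟩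
    · exact undecided_inr.2 (hn j)
    · exact undecided_inl.2 (hn j)
  have hij : i ≠ j := by
    rintro rfl
    have : p' = q' := by
      rcases hp' with ⟨rfl, h⟩ | ⟨rfl, h⟩ <;> rcases hq' with ⟨rfl, h'⟩ | ⟨rfl, h'⟩ <;> tauto
    subst this
    obtain ⟨⟨H, hH, h⟩, -⟩ := up
    exact holds_swap.1 (ent H hH h) h
  -- A reversible entailment would put the two distinct representatives into the same or twin cells.
  have rev : ¬ Entails G a b q'.swap p' := by
    intro k
    apply hij
    apply hr'
    have iff : ∀ H ∈ halfspaces G a b, (Holds H p' ↔ Holds H q'.swap) :=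
      fun H hH => ⟨ent H hH, k H hH⟩
    rcases hp' with ⟨rfl, h⟩ | ⟨rfl, h⟩ <;> rcases hq' with ⟨rfl, h'⟩ | ⟨rfl, h'⟩
    · exact Or.inr ⟨hn i, hn j, iff⟩
    · exact Or.inl ⟨hn i, hn j, iff⟩
    · exact Or.inl ⟨hn i, hn j, fun H hH => not_iff_not.1 (iff H hH)⟩
    · refine Or.inr ⟨hn i, hn j, fun H hH => ?_⟩
      have : r i ∉ H ↔ r j ∈ H := iff H hH
      tauto
  have contra : ∀ {x y}, Entails G a b (.inr x) (.inr y) → Entails G a b (.inl y) (.inl x) :=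
    fun h H hH hy => by
      by_contra k
      exact h H hH k hy
  obtain ⟨x, y, ⟨hx, hy⟩ | ⟨hx, hy⟩⟩ := ent.same_sign hG hab rev up uq
  · rcases hp' with ⟨rfl, h⟩ | ⟨rfl, h⟩ <;> rcases hq' with ⟨rfl, h'⟩ | ⟨rfl, h'⟩ <;>
      simp only [Sum.swap_inl, Sum.swap_inr, reduceCtorEq, Sum.inl.injEq] at hx hy
    exact h' (hT i j ⟨ent, rev⟩ h)
  · rcases hp' with ⟨rfl, h⟩ | ⟨rfl, h⟩ <;> rcases hq' with ⟨rfl, h'⟩ | ⟨rfl, h'⟩ <;>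
      simp only [Sum.swap_inl, Sum.swap_inr, reduceCtorEq, Sum.inr.injEq] at hx hy
    refine h (hT j i ⟨contra ent, fun k => rev ?_⟩ h')
    intro H hH l m
    exact l (k H hH m)

/-- A violated clause consists of two true literals, but these hold together in a genuine halfspace.
It is essential that clauses are binary. -/
theorem assemble_mem_halfspaces (hG : G.Connected) (hab : G.Adj a b)
    (hne : (halfspaces G a b).Nonempty) {T : Set ι}
    (hT : ∀ i j, Precedes G a b (r i) (r j) → i ∈ T → j ∈ T) :
    assemble r G a b T ∈ halfspaces G a b := by
  refine (mem_halfspaces_iff_excl hG hab).2 fun p q hpq hp hq => ?_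
  obtain ⟨H, hH, h1, h2⟩ := exists_halfspace_of_assemble hr hr' hn hG hab hne hT hp hq
  exact (mem_halfspaces_iff_excl hG hab).1 hH p q hpq h1 h2

end Representatives

/-! ### Ranks -/

theorem ncard_lt_of_mem [Finite V] {S T : Set V} (h : S ⊆ T) {x : V} (hx : x ∈ T) (hx' : x ∉ S) :
    S.ncard < T.ncard :=
  Set.ncard_lt_ncard ((Set.ssubset_iff_of_subset h).2 ⟨x, hx, hx'⟩)

theorem ncard_lt_of_trans [Finite V] {P : Set V} {lt : V → V → Prop}
    (trans : ∀ x y z, lt x y → lt y z → lt x z) (irrefl : ∀ x, ¬ lt x x) {x y : V} (hx : x ∈ P)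
    (h : lt x y) : {z | z ∈ P ∧ lt z x}.ncard < {z | z ∈ P ∧ lt z y}.ncard := by
  exact ncard_lt_of_mem (fun z hz => ⟨hz.1, trans _ _ _ hz.2 h⟩) (x := x) ⟨hx, h⟩
    (fun k => irrefl x k.2)

/-- In a finite strict total order, the rank is an injection into an initial segment of the same
size. It is applied to the representatives in the order of `e`, and to the block representatives
under reversed precedence. -/
theorem exists_ncard_eq [Finite V] {P : Set V} {lt : V → V → Prop}
    (trans : ∀ x y z, lt x y → lt y z → lt x z) (irrefl : ∀ x, ¬ lt x x)
    (total : ∀ x ∈ P, ∀ y ∈ P, x = y ∨ lt x y ∨ lt y x) {i : ℕ} (hi : i < P.ncard) :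
    ∃ x ∈ P, {z | z ∈ P ∧ lt z x}.ncard = i := by
  let f : V → ℕ := fun x => {z | z ∈ P ∧ lt z x}.ncard
  have hinj : Set.InjOn f P := by
    intro x hx y hy h
    rcases total x hx y hy with h' | h' | h'
    · exact h'
    · exact absurd h (ncard_lt_of_trans trans irrefl hx h').ne
    · exact absurd h (ncard_lt_of_trans trans irrefl hy h').ne'
  have hsub : f '' P ⊆ Set.Iio P.ncard := by
    rintro _ ⟨x, hx, rfl⟩
    exact ncard_lt_of_mem (fun z hz => hz.1) (x := x) hx (fun k => irrefl x k.2)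
  have heq : f '' P = Set.Iio P.ncard := by
    apply Set.eq_of_subset_of_ncard_le hsub
    rw [hinj.ncard_image]
    simp
  have : i ∈ f '' P := by rw [heq]; exact hi
  exact this

/-! ### Representatives chosen by an enumeration -/

variable {n : ℕ} (e : V ≃ Fin n) (G a b)

/-- `x` is the first vertex of its cell. -/
def IsRep (x : V) : Prop :=
  Nontriv G a b x ∧ ∀ y, e y < e x → ¬ SameCell G a b x y ∧ ¬ TwinCell G a b x y

/-- `x` is the first representative in its block. -/
def IsBlockRep (x : V) : Prop :=
  IsRep G a b e x ∧ ∀ y, e y < e x → IsRep G a b e y → Precedes G a b x y ∨ Precedes G a b y x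

/-- The index of the cell of a representative. -/
noncomputable def cellIndex (x : V) : ℕ := {y | IsRep G a b e y ∧ e y < e x}.ncard

/-- The index of the block of a representative. -/
noncomputable def blockIndex (x : V) : ℕ := {y | IsBlockRep G a b e y ∧ Precedes G a b x y}.ncard

variable {e G a b}

theorem exists_min_index {P : V → Prop} {v : V} (hv : P v) :
    ∃ x, P x ∧ ∀ y, e y < e x → ¬ P y := by
  induction h : e v using WellFoundedLT.induction generalizing v with
  | ind k ih =>
    by_cases hk : ∃ y, e y < e v ∧ P y
    · obtain ⟨y, h1, h2⟩ := hk
      exact ih (e y) (h ▸ h1) h2 rfl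
    · push Not at hk
      exact ⟨v, hv, hk⟩

theorem exists_isRep {v : V} (hv : Nontriv G a b v) :
    ∃ x, IsRep G a b e x ∧ (SameCell G a b x v ∨ TwinCell G a b x v) := by
  obtain ⟨x, hx, hmin⟩ := exists_min_index (e := e)
    (P := fun x => SameCell G a b x v ∨ TwinCell G a b x v) (v := v)
    (Or.inl ⟨hv, hv, fun _ _ => Iff.rfl⟩)
  have hxn : Nontriv G a b x := hx.elim (·.1) (·.1)
  refine ⟨x, ⟨hxn, fun y hy => ⟨fun k => hmin y hy ?_, fun k => hmin y hy ?_⟩⟩, hx⟩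
  · exact hx.imp k.symm.trans k.symm.trans_twin
  · exact hx.symm.imp k.symm.trans k.symm.trans_same

theorem IsRep.eq {x y : V} (hx : IsRep G a b e x) (hy : IsRep G a b e y)
    (h : SameCell G a b x y ∨ TwinCell G a b x y) : x = y := by
  rcases lt_trichotomy (e x) (e y) with k | k | k
  · have := hy.2 x k
    exact absurd (h.imp SameCell.symm TwinCell.symm) (by tauto)
  · exact e.injective k
  · have := hx.2 y k
    tauto

theorem IsRep.eq_of_cellIndex_eq [Finite V] {x y : V} (hx : IsRep G a b e x)
    (hy : IsRep G a b e y) (h : cellIndex G a b e x = cellIndex G a b e y) : x = y := by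
  have mono : ∀ x y, IsRep G a b e x → e x < e y →
      cellIndex G a b e x < cellIndex G a b e y := fun x y hx h =>
    ncard_lt_of_trans (P := {x | IsRep G a b e x}) (lt := fun x y => e x < e y)
      (fun _ _ _ => lt_trans) (fun _ => lt_irrefl _) hx h
  rcases lt_trichotomy (e x) (e y) with h' | h' | h'
  · exact absurd h (mono x y hx h').ne
  · exact e.injective h'
  · exact absurd h (mono y x hy h').ne'

variable (hG : G.Connected) (hab : G.Adj a b)

include hG hab

/-- Incomparability is a congruence for a strict weak order. -/
theorem precedes_congr_right {x y z : V} (hx : Nontriv G a b x) (hy : Nontriv G a b y)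
    (hz : Nontriv G a b z) (h : ¬ Precedes G a b x y) (h' : ¬ Precedes G a b y x) :
    Precedes G a b z x ↔ Precedes G a b z y :=
  ⟨fun k => (k.or hG hab hz hx hy).resolve_right h',
    fun k => (k.or hG hab hz hy hx).resolve_right h⟩

theorem precedes_congr_left {x y z : V} (hx : Nontriv G a b x) (hy : Nontriv G a b y)
    (hz : Nontriv G a b z) (h : ¬ Precedes G a b x y) (h' : ¬ Precedes G a b y x) :
    Precedes G a b x z ↔ Precedes G a b y z :=
  ⟨fun k => (k.or hG hab hx hz hy).resolve_left h,
    fun k => (k.or hG hab hy hz hx).resolve_left h'⟩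

/-- Take the first representative `z` incomparable to `x`. Earlier representatives are comparable to
`x`, hence to `z`. -/
theorem exists_isBlockRep {x : V} (hx : IsRep G a b e x) :
    ∃ z, IsBlockRep G a b e z ∧ ¬ Precedes G a b x z ∧ ¬ Precedes G a b z x := by
  obtain ⟨z, ⟨hz, h1, h2⟩, hmin⟩ := exists_min_index (e := e)
    (P := fun z => IsRep G a b e z ∧ ¬ Precedes G a b x z ∧ ¬ Precedes G a b z x) (v := x)
    ⟨hx, fun h => h.asymm h, fun h => h.asymm h⟩
  refine ⟨z, ⟨hz, fun y hy hyr => ?_⟩, h1, h2⟩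
  have k := hmin y hy
  have e1 := precedes_congr_left hG hab hx.1 hz.1 hyr.1 h1 h2
  have e2 := precedes_congr_right hG hab hx.1 hz.1 hyr.1 h1 h2
  tauto

theorem blockIndex_lt [Finite V] {x y : V} (hx : IsRep G a b e x) (hy : IsRep G a b e y)
    (h : Precedes G a b x y) : blockIndex G a b e y < blockIndex G a b e x := by
  obtain ⟨z, hz, h1, h2⟩ := exists_isBlockRep hG hab hy
  -- The block representative of `y` lies above `x` but not above `y`, which makes the inclusion
  -- strict.
  exact ncard_lt_of_mem (fun z hz => ⟨hz.1, h.trans hz.2⟩) (x := z)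
    ⟨hz, (precedes_congr_right hG hab hy.1 hz.1.1 hx.1 h1 h2).1 h⟩ (fun k => h1 k.2)

theorem blockIndex_lt_iff [Finite V] {x y : V} (hx : IsRep G a b e x) (hy : IsRep G a b e y) :
    blockIndex G a b e y < blockIndex G a b e x ↔ Precedes G a b x y := by
  refine ⟨fun h => ?_, blockIndex_lt hG hab hx hy⟩
  by_contra k
  by_cases k' : Precedes G a b y x
  · exact (blockIndex_lt hG hab hy hx k').asymm h
  -- Incomparable representatives lie below the same block representatives.
  · refine h.ne' (congrArg Set.ncard (Set.ext fun z => and_congr_right fun hz => ?_))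
    exact precedes_congr_left hG hab hx.1 hy.1 hz.1.1 k k'

theorem blockIndex_lt_ncard [Finite V] {x : V} (hx : IsRep G a b e x) :
    blockIndex G a b e x < {z | IsBlockRep G a b e z}.ncard := by
  obtain ⟨z, hz, h1, -⟩ := exists_isBlockRep hG hab hx
  exact ncard_lt_of_mem (fun z hz => hz.1) (x := z) hz (fun k => h1 k.2)

omit hG hab in
/-- Upward closed sets of cells, in terms of the blocks. -/
theorem exists_before_union_iff (D : CellDecomposition V) {T : Set (Fin D.k)} :
    (∀ i j, D.blockOf j < D.blockOf i → i ∈ T → j ∈ T) ↔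
      ∃ l S, S ⊆ D.block l ∧ T = D.before l ∪ S := by
  constructor
  · intro hT
    rcases T.eq_empty_or_nonempty with rfl | hne
    -- Nothing lies before the first block, so the empty choice is represented there.
    · refine ⟨⟨0, D.p_pos⟩, ∅, Set.empty_subset _, ?_⟩
      ext i
      simp [CellDecomposition.before, Fin.lt_def]
    -- The last block that meets `T` is the only one that can be met partially.
    · obtain ⟨i, hi, hmax⟩ := Set.exists_max_image T D.blockOf (Set.toFinite _) hne
      refine ⟨D.blockOf i, T ∩ D.block (D.blockOf i), Set.inter_subset_right, ?_⟩
      ext j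
      simp only [Set.mem_union, Set.mem_inter_iff]
      constructor
      · intro hj
        rcases (hmax j hj).lt_or_eq with h | h
        · exact Or.inl h
        · exact Or.inr ⟨hj, h⟩
      · rintro (h | h)
        · exact hT i j h hi
        · exact h.1
  · rintro ⟨l, S, hS, rfl⟩ i j hij hi
    refine Or.inl (lt_of_lt_of_le hij ?_)
    rcases hi with hi | hi
    · exact le_of_lt hi
    · exact (show D.blockOf i = l from hS hi).le

omit hG hab in
theorem compl_before_union (D : CellDecomposition V) {l : Fin D.p} {S : Set (Fin D.k)}
    (hS : S ⊆ D.block l) : (D.before l ∪ S)ᶜ = (D.block l \ S) ∪ D.after l := by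
  ext i
  have h1 : i ∈ S → D.blockOf i = l := fun h => hS h
  simp only [CellDecomposition.before, CellDecomposition.block, CellDecomposition.after,
    Set.mem_compl_iff, Set.mem_union, Set.mem_ofPred_eq, Set.mem_sdiff]
  rcases lt_trichotomy (D.blockOf i) l with h | h | h
  · simp [h, h.ne, h.not_gt]
  · simp [h]
  · have : i ∉ S := fun k => h.ne' (h1 k)
    simp [h, h.ne', h.not_gt, this]

/-- The cell decomposition, with cells and blocks numbered by their representatives. -/
theorem exists_cellDecomposition (hne : (halfspaces G a b).Nonempty) (e : V ≃ Fin n) :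
    ∃ D : CellDecomposition V, IsCellDecompositionOf G a b (base G a b) D ∧
      (∀ H : Set V, H ∈ halfspaces G a b ↔
        ∃ (l : Fin D.p) (S : Set (Fin D.k)), S ⊆ D.block l ∧
          H = base G a b ∪ (⋃ i ∈ D.before l ∪ S, D.fst i) ∪
            (⋃ i ∈ (D.block l \ S) ∪ D.after l, D.snd i)) ∧
      D.k = {x | IsRep G a b e x}.ncard ∧ D.p = max 1 {x | IsBlockRep G a b e x}.ncard ∧
      ∀ i : Fin D.k, ∃ x, IsRep G a b e x ∧ cellIndex G a b e x = i ∧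
        D.fst i = {v | SameCell G a b x v} ∧ D.snd i = {v | TwinCell G a b x v} ∧
        (D.blockOf i : ℕ) = blockIndex G a b e x := by
  have : Finite V := Finite.of_equiv _ e.symm
  let k := {x | IsRep G a b e x}.ncard
  have hex : ∀ i : Fin k, ∃ x, IsRep G a b e x ∧ cellIndex G a b e x = i := by
    intro i
    exact exists_ncard_eq (P := {x | IsRep G a b e x}) (lt := fun x y => e x < e y)
      (fun _ _ _ => lt_trans) (fun _ => lt_irrefl _)
      (fun x _ y _ => by
        rcases lt_trichotomy (e x) (e y) with h | h | h
        · exact Or.inr (Or.inl h)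
        · exact Or.inl (e.injective h)
        · exact Or.inr (Or.inr h)) i.2
  choose r hrep hidx using hex
  have hlt : ∀ x, IsRep G a b e x → cellIndex G a b e x < k := by
    intro x hx
    exact ncard_lt_of_mem (fun z hz => hz.1) (x := x) hx (fun h => lt_irrefl _ h.2)
  have hsurj : ∀ x, IsRep G a b e x → ∃ i, r i = x := fun x hx =>
    ⟨⟨_, hlt x hx⟩, (hrep _).eq_of_cellIndex_eq hx (hidx _)⟩
  have hr : ∀ v, Nontriv G a b v → ∃ i, SameCell G a b (r i) v ∨ TwinCell G a b (r i) v := by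
    intro v hv
    obtain ⟨x, hx, h⟩ := exists_isRep (e := e) hv
    obtain ⟨i, rfl⟩ := hsurj x hx
    exact ⟨i, h⟩
  have hr' : ∀ i j, SameCell G a b (r i) (r j) ∨ TwinCell G a b (r i) (r j) → i = j := by
    intro i j h
    have := (hrep i).eq (hrep j) h
    rw [Fin.ext_iff, ← hidx, ← hidx, this]
  have hn : ∀ i, Nontriv G a b (r i) := fun i => (hrep i).1
  have hrefl : ∀ i, SameCell G a b (r i) (r i) := fun i => ⟨hn i, hn i, fun _ _ => Iff.rfl⟩
  let D : CellDecomposition V :=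
    { k := k
      -- The maximum accounts for the convention of one empty block when there are no cells.
      p := max 1 {x | IsBlockRep G a b e x}.ncard
      fst := fun i => {v | SameCell G a b (r i) v}
      snd := fun i => {v | TwinCell G a b (r i) v}
      blockOf := fun i => ⟨blockIndex G a b e (r i),
        lt_max_of_lt_right (blockIndex_lt_ncard hG hab (hrep i))⟩
      cell_nonempty := fun i => ⟨r i, Or.inl (hrefl i)⟩
      cell_disjoint := by
        intro i j hij
        rw [Set.disjoint_left]
        rintro v (h | h) (h' | h')
        · exact hij (hr' i j (Or.inl (h.trans (SameCell.symm h'))))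
        · exact hij (hr' i j (Or.inr (SameCell.trans_twin h (TwinCell.symm h'))))
        · exact hij (hr' i j (Or.inr (TwinCell.trans_same h (SameCell.symm h'))))
        · exact hij (hr' i j (Or.inl (TwinCell.trans h (TwinCell.symm h'))))
      twin_disjoint := by
        intro i
        rw [Set.disjoint_left]
        exact fun v h h' => SameCell.not_twinCell h h'
      p_pos := by omega
      block_nonempty := by
        rintro hk ⟨l, hl⟩
        have hpos : 0 < {x | IsBlockRep G a b e x}.ncard :=
          (Nat.zero_le _).trans_lt (blockIndex_lt_ncard hG hab (hrep ⟨0, hk⟩))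
        -- Two block representatives are always comparable, so their ranks under reversed precedence
        -- fill all block indices.
        obtain ⟨x, hx, h⟩ := exists_ncard_eq (P := {x | IsBlockRep G a b e x})
          (lt := fun x y => Precedes G a b y x) (fun _ _ _ h h' => h'.trans h)
          (fun _ h => h.asymm h)
          (fun x hx y hy => by
            rcases lt_trichotomy (e x) (e y) with h | h | h
            · exact Or.inr (hy.2 x h hx.1)
            · exact Or.inl (e.injective h)
            · exact Or.inr (hx.2 y h hy.1).symm) (i := l) (by omega)
        obtain ⟨i, rfl⟩ := hsurj x hx.1
        exact ⟨i, Fin.ext h⟩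
      p_eq_one := by
        intro hk
        have : {x | IsBlockRep G a b e x}.ncard = 0 := by
          rw [Set.ncard_eq_zero]
          rw [Set.ncard_eq_zero] at hk
          exact Set.eq_empty_of_subset_empty fun x hx => hk ▸ hx.1
        omega }
  -- A block comes earlier when its vertices are entailed, so initial segments of blocks are upward
  -- closed.
  have hD : ∀ i j, D.blockOf j < D.blockOf i ↔ Precedes G a b (r i) (r j) := fun i j =>
    blockIndex_lt_iff hG hab (hrep i) (hrep j)
  have form : ∀ l S, S ⊆ D.block l →
      base G a b ∪ (⋃ i ∈ D.before l ∪ S, D.fst i) ∪ (⋃ i ∈ (D.block l \ S) ∪ D.after l, D.snd i)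
        = assemble r G a b (D.before l ∪ S) := by
    intro l S hS
    rw [← compl_before_union D hS]
    rfl
  refine ⟨D, ⟨?_, ?_, ?_⟩, ?_, rfl, rfl,
    fun i => ⟨r i, hrep i, hidx i, rfl, rfl, rfl⟩⟩
  · intro i
    rw [Set.disjoint_left]
    rintro v hv (h | h)
    · obtain ⟨-, H, h1, h2⟩ := h.2.1
      exact h2 (hv H h1)
    · obtain ⟨-, H, h1, h2⟩ := h.2.1
      exact h2 (hv H h1)
  · intro x y
    change _ ↔ SameCell G a b x y
    constructor
    · rintro ⟨i, ⟨h, h'⟩ | ⟨h, h'⟩⟩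
      · exact (SameCell.symm h).trans h'
      · exact (TwinCell.symm h).trans h'
    · intro h
      obtain ⟨i, h' | h'⟩ := hr x h.1
      · exact ⟨i, Or.inl ⟨h', h'.trans h⟩⟩
      · exact ⟨i, Or.inr ⟨h', h'.trans_same h⟩⟩
  · intro x y
    change _ ↔ TwinCell G a b x y
    constructor
    · rintro ⟨i, ⟨h, h'⟩ | ⟨h, h'⟩⟩
      · exact (SameCell.symm h).trans_twin h'
      · exact (TwinCell.symm h).trans_same h'
    · intro h
      obtain ⟨i, h' | h'⟩ := hr x h.1
      · exact ⟨i, Or.inl ⟨h', h'.trans_twin h⟩⟩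
      · exact ⟨i, Or.inr ⟨h', h'.trans h⟩⟩
  · intro H
    constructor
    · intro hH
      obtain ⟨l, S, hS, hT⟩ := (exists_before_union_iff D (T := {i | r i ∈ H})).1
        (fun i j hij hi => ((hD i j).1 hij).1 H hH hi)
      exact ⟨l, S, hS, by rw [form l S hS, ← hT]; exact eq_assemble hr hH⟩
    · rintro ⟨l, S, hS, rfl⟩
      rw [form l S hS]
      exact assemble_mem_halfspaces hr hr' hn hG hab hne fun i j hij =>
        (exists_before_union_iff D).2 ⟨l, S, hS, rfl⟩ i j ((hD i j).2 hij)

end Decomposition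

/-! ### Running programs in bounded time -/

/-- Started in `s`, the program `c` halts after at most `T` steps in a memory that satisfies `Q`. -/
def Runs (c : Prog) (T : ℕ) (s : Memory) (Q : Memory → Prop) : Prop :=
  ∃ s' t, Exec c s s' t ∧ t ≤ T ∧ Q s'

namespace Runs

variable {c d : Prog} {s : Memory} {T T' : ℕ} {Q Q' : Memory → Prop}

theorem mono (h : Runs c T s Q) (hT : T ≤ T') (hQ : ∀ s', Q s' → Q' s') : Runs c T' s Q' := by
  obtain ⟨s', t, h1, h2, h3⟩ := h
  exact ⟨s', t, h1, h2.trans hT, hQ s' h3⟩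

theorem seq (h : Runs c T s Q) (h' : ∀ s', Q s' → Runs d T' s' Q') :
    Runs (.seq c d) (T + T') s Q' := by
  obtain ⟨s', t, h1, h2, h3⟩ := h
  obtain ⟨s'', t', h4, h5, h6⟩ := h' s' h3
  exact ⟨s'', t + t', h1.seq h4, by omega, h6⟩

theorem assign (x : ℕ) (e : Expr) (h : Q (s.setVar x (e.eval s))) :
    Runs (.assign x e) (e.cost + 1) s Q :=
  ⟨_, _, .assign s x e, le_rfl, h⟩

theorem store (m : ℕ) (i j e : Expr) (h : Q (s.setArr m (i.eval s) (j.eval s) (e.eval s))) :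
    Runs (.store m i j e) (i.cost + j.cost + e.cost + 1) s Q :=
  ⟨_, _, .store s m i j e, le_rfl, h⟩

theorem ite {e : Expr} (h : e.eval s ≠ 0 → Runs c T s Q) (h' : e.eval s = 0 → Runs d T' s Q) :
    Runs (.ite e c d) (e.cost + 1 + (T + T')) s Q := by
  by_cases he : e.eval s = 0
  · obtain ⟨s', t, h1, h2, h3⟩ := h' he
    exact ⟨s', _, .ite_false he h1, by omega, h3⟩
  · obtain ⟨s', t, h1, h2, h3⟩ := h he
    exact ⟨s', _, .ite_true he h1, by omega, h3⟩

end Runs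

@[simp] theorem Memory.setVar_arr (s : Memory) (x v : ℕ) : (s.setVar x v).arr = s.arr := rfl

theorem Memory.setVar_var (s : Memory) (x v y : ℕ) :
    (s.setVar x v).var y = if y = x then v else s.var y := rfl

@[simp] theorem Memory.setVar_var_self (s : Memory) (x v : ℕ) : (s.setVar x v).var x = v := by
  simp [Memory.setVar_var]

theorem Memory.setVar_var_of_ne (s : Memory) {x y : ℕ} (v : ℕ) (h : y ≠ x) :
    (s.setVar x v).var y = s.var y := by
  simp [Memory.setVar_var, h]

/-- The loop `for x < x_3 do c`. -/
def Prog.loop (x : ℕ) (c : Prog) : Prog :=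
  .seq (.assign x (.const 0))
    (.while (.sub (.var 3) (.var x)) (.seq c (.assign x (.add (.var x) (.const 1)))))

/-- Loop rule with an invariant `I`. An iteration costs `T` for the body, 4 for the test and 4 for
the increment; the final test and the initialisation account for the remaining 6. -/
theorem Runs.loop {x N T : ℕ} {c : Prog} {s : Memory} (I : ℕ → Memory → Prop)
    (hN : ∀ k s, I k s → s.var 3 = N) (hx : ∀ k s, I k s → s.var x = k)
    (h0 : I 0 (s.setVar x 0))
    (hstep : ∀ k < N, ∀ s, I k s →
      Runs c T s fun s' => s'.var x = k ∧ I (k + 1) (s'.setVar x (k + 1))) :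
    Runs (.loop x c) (N * (T + 8) + 6) s (I N) := by
  have key : ∀ m k s, m + k = N → I k s →
      Runs (.while (.sub (.var 3) (.var x)) (.seq c (.assign x (.add (.var x) (.const 1)))))
        (m * (T + 8) + 4) s (I N) := by
    intro m
    induction m with
    | zero =>
      intro k s hk hI
      refine ⟨s, _, .while_false ?_, by simp [Expr.cost], by simpa [← hk] using hI⟩
      have := hN k s hI
      have := hx k s hI
      simp only [Expr.eval]
      omega
    | succ m ih =>
      intro k s hk hI
      obtain ⟨s', t, h1, h2, h3, h4⟩ := hstep k (by omega) s hI
      obtain ⟨s'', t', h5, h6, h7⟩ := ih (k + 1) _ (by omega) h4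
      refine ⟨s'', _, .while_true (t' := t') ?_ (.seq h1 (.assign _ _ _)) ?_, ?_, h7⟩
      · have := hN k s hI
        have := hx k s hI
        simp only [Expr.eval]
        omega
      · simpa [Expr.eval, h3] using h5
      · simp only [Expr.cost]
        nlinarith
  refine (Runs.seq (Q := I 0) (.assign x (.const 0) h0)
    (fun s' h' => key N 0 s' (by simp) h')).mono ?_ fun _ h => h
  simp only [Expr.cost]
  omega

/-! ### Terms with bounded sums -/

/-- Terms over the variables and arrays of the machine, with sums over all indices `i < x_3`.  The
bound variable of a sum is the variable whose number is the current level. -/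
inductive Tm : Type
  | const (c : ℕ)
  | var (x : ℕ)
  | get (m : ℕ) (i j : Tm)
  | add (t u : Tm)
  | sub (t u : Tm)
  | ite (r t u : Tm)
  | sum (t : Tm)

namespace Tm

/-- The value of a term at the level `l`. -/
def eval : Tm → ℕ → Memory → ℕ
  | const c, _, _ => c
  | var x, _, s => s.var x
  | get m i j, l, s => s.arr m (i.eval l s) (j.eval l s)
  | add t u, l, s => t.eval l s + u.eval l s
  | sub t u, l, s => t.eval l s - u.eval l s
  | ite r t u, l, s => if r.eval l s ≠ 0 then t.eval l s else u.eval l s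
  | sum t, l, s => ∑ i ∈ Finset.range (s.var 3), t.eval (l + 1) (s.setVar l i)

/-- At the level `l`, the term reads only variables below the level and arrays below `100`, and all
levels stay below `50`. -/
def Ok : Tm → ℕ → Prop
  | const _, _ => True
  | var x, l => x < l
  | get m i j, l => m < 100 ∧ i.Ok l ∧ j.Ok l
  | add t u, l => t.Ok l ∧ u.Ok l
  | sub t u, l => t.Ok l ∧ u.Ok l
  | ite r t u, l => r.Ok l ∧ t.Ok l ∧ u.Ok l
  | sum t, l => l < 50 ∧ t.Ok (l + 1)

/-- A program that stores the value of a term in the variable `d`, with the variables after `d`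
as scratch space. -/
def code : Tm → ℕ → ℕ → Prog
  | const c, _, d => .assign d (.const c)
  | var x, _, d => .assign d (.var x)
  | get m i j, l, d =>
    .seq (i.code l d) (.seq (j.code l (d + 1)) (.assign d (.get m (.var d) (.var (d + 1)))))
  | add t u, l, d =>
    .seq (t.code l d) (.seq (u.code l (d + 1)) (.assign d (.add (.var d) (.var (d + 1)))))
  | sub t u, l, d =>
    .seq (t.code l d) (.seq (u.code l (d + 1)) (.assign d (.sub (.var d) (.var (d + 1)))))
  | ite r t u, l, d => .seq (r.code l d) (.ite (.var d) (t.code l d) (u.code l d))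
  | sum t, l, d => .seq (.assign d (.const 0))
      (.loop l (.seq (t.code (l + 1) (d + 1)) (.assign d (.add (.var d) (.var (d + 1))))))

/-- A bound for the running time of the program, as a polynomial in `x_3`. -/
noncomputable def time : Tm → Polynomial ℕ
  | const _ => 2
  | var _ => 2
  | get _ i j => i.time + (j.time + 4)
  | add t u => t.time + (u.time + 4)
  | sub t u => t.time + (u.time + 4)
  | ite r t u => r.time + (2 + (t.time + u.time))
  | sum t => 2 + (Polynomial.X * (t.time + 4 + 8) + 6)

/-- The assumption `3 < l` keeps the common summation bound `x_3` away from the bound variables. -/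
theorem eval_congr {t : Tm} {l : ℕ} {s s' : Memory} (ht : t.Ok l) (h3 : 3 < l)
    (hv : ∀ x < l, s'.var x = s.var x) (ha : ∀ m < 100, s'.arr m = s.arr m) :
    t.eval l s' = t.eval l s := by
  induction t generalizing l s s' with
  | const => rfl
  | var x => exact hv x ht
  | get m i j hi hj =>
    simp only [eval]
    rw [hi ht.2.1 h3 hv ha, hj ht.2.2 h3 hv ha, ha m ht.1]
  | add t u h h' =>
    simp only [eval]
    rw [h ht.1 h3 hv ha, h' ht.2 h3 hv ha]
  | sub t u h h' =>
    simp only [eval]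
    rw [h ht.1 h3 hv ha, h' ht.2 h3 hv ha]
  | ite r t u h h' h'' =>
    simp only [eval]
    rw [h ht.1 h3 hv ha, h' ht.2.1 h3 hv ha, h'' ht.2.2 h3 hv ha]
  | sum t h =>
    simp only [eval]
    rw [hv 3 h3]
    refine Finset.sum_congr rfl fun i _ => h ht.2 (by omega) (fun x hx => ?_) ha
    simp only [Memory.setVar_var]
    split
    · rfl
    · exact hv x (by omega)

/-- The variables below `l`, the variables from `50` to `d`, and all arrays agree. -/
def Agree (l d : ℕ) (s s' : Memory) : Prop :=
  s'.arr = s.arr ∧ ∀ x, x < l ∨ (50 ≤ x ∧ x < d) → s'.var x = s.var x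

theorem Agree.trans {l d : ℕ} {s s' s'' : Memory} (h : Agree l d s s') (h' : Agree l d s' s'') :
    Agree l d s s'' :=
  ⟨h'.1.trans h.1, fun x hx => (h'.2 x hx).trans (h.2 x hx)⟩

theorem Agree.mono {l d l' d' : ℕ} {s s' : Memory} (h : Agree l d s s') (hl : l' ≤ l)
    (hd : d' ≤ d) : Agree l' d' s s' :=
  ⟨h.1, fun x hx => h.2 x (by omega)⟩

theorem Agree.setVar {l d : ℕ} {s : Memory} {x : ℕ} (v : ℕ) (hx : l ≤ x) (hd : x < 50 ∨ d ≤ x) :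
    Agree l d s (s.setVar x v) :=
  ⟨rfl, fun y hy => s.setVar_var_of_ne v (by omega)⟩

theorem Agree.eval {t : Tm} {l d : ℕ} {s s' : Memory} (h : Agree l d s s') (ht : t.Ok l)
    (h3 : 3 < l) : t.eval l s' = t.eval l s :=
  eval_congr ht h3 (fun x hx => h.2 x (Or.inl hx)) fun m _ => congrFun h.1 m

/-- Common to array access, addition and subtraction: the first value waits in `x_d` while the
second is computed with scratch space from `d + 1` on. The memory `s''` is the one in which the
final expression is evaluated. -/
theorem runs_binary {t u : Tm} {l d T T' : ℕ} {s : Memory} (h3 : 3 < l) (hl : l ≤ 50) (hd : 50 ≤ d)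
    (hu : u.Ok l) (e : Expr) (he : e.cost = 3)
    (h : Runs (t.code l d) T s fun s' => s'.var d = t.eval l s ∧ Agree l d s s')
    (h' : ∀ s₁, s₁.var 3 = s.var 3 → Runs (u.code l (d + 1)) T' s₁ fun s' =>
      s'.var (d + 1) = u.eval l s₁ ∧ Agree l (d + 1) s₁ s') :
    Runs (.seq (t.code l d) (.seq (u.code l (d + 1)) (.assign d e))) (T + (T' + 4)) s
      fun s' => (∃ s'', s''.arr = s.arr ∧ s''.var d = t.eval l s ∧ s''.var (d + 1) = u.eval l s ∧
        s'.var d = e.eval s'') ∧ Agree l d s s' := by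
  refine h.seq fun s₁ h₁ => ?_
  have e3 := h₁.2.2 3 (Or.inl h3)
  refine Runs.seq (h' s₁ e3) fun s₂ h₂ => ?_
  refine (Runs.assign d e (Q := fun s' => (∃ s'', s''.arr = s.arr ∧ s''.var d = t.eval l s ∧
    s''.var (d + 1) = u.eval l s ∧ s'.var d = e.eval s'') ∧ Agree l d s s') ?_).mono
      (by rw [he]) fun _ h => h
  refine ⟨⟨s₂, h₂.2.1.trans h₁.2.1, (h₂.2.2 d (by omega)).trans h₁.1,
    h₂.1.trans (h₁.2.eval hu h3), by simp⟩, ?_⟩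
  exact (h₁.2.trans (h₂.2.mono le_rfl (by omega))).trans (.setVar _ (by omega) (by omega))

/-- Loop counters occupy the variables from the level `l` up to 49, scratch values those from `d`
on; `Agree` records that everything else is preserved, as the recursive calls require. -/
theorem runs_code {t : Tm} {l d : ℕ} {s : Memory} (ht : t.Ok l) (h3 : 3 < l) (hl : l ≤ 50)
    (hd : 50 ≤ d) :
    Runs (t.code l d) (t.time.eval (s.var 3)) s fun s' =>
      s'.var d = t.eval l s ∧ Agree l d s s' := by
  induction t generalizing l d s with
  | const c =>
    exact (Runs.assign d _ ⟨by simp [Expr.eval, eval], .setVar _ (by omega) (by omega)⟩).mono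
      (by simp [time, Expr.cost]) fun _ h => h
  | var x =>
    exact (Runs.assign d _ ⟨by simp [Expr.eval, eval], .setVar _ (by omega) (by omega)⟩).mono
      (by simp [time, Expr.cost]) fun _ h => h
  | get m i j hi hj =>
    refine (runs_binary (T' := j.time.eval (s.var 3)) h3 hl hd ht.2.2 _ rfl
      (hi ht.2.1 h3 hl hd) (fun s₁ h => h ▸ hj ht.2.2 h3 hl (by omega))).mono
      (by simp [time]) ?_
    rintro s' ⟨⟨s'', h1, h2, h3, h4⟩, h⟩
    exact ⟨by simp [h4, Expr.eval, eval, h1, h2, h3], h⟩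
  | add t u h h' =>
    refine (runs_binary (T' := u.time.eval (s.var 3)) h3 hl hd ht.2 _ rfl
      (h ht.1 h3 hl hd) (fun s₁ h => h ▸ h' ht.2 h3 hl (by omega))).mono
      (by simp [time]) ?_
    rintro s' ⟨⟨s'', h1, h2, h3, h4⟩, h⟩
    exact ⟨by simp [h4, Expr.eval, eval, h2, h3], h⟩
  | sub t u h h' =>
    refine (runs_binary (T' := u.time.eval (s.var 3)) h3 hl hd ht.2 _ rfl
      (h ht.1 h3 hl hd) (fun s₁ h => h ▸ h' ht.2 h3 hl (by omega))).mono
      (by simp [time]) ?_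
    rintro s' ⟨⟨s'', h1, h2, h3, h4⟩, h⟩
    exact ⟨by simp [h4, Expr.eval, eval, h2, h3], h⟩
  | ite r t u h h' h'' =>
    refine ((h ht.1 h3 hl hd).seq fun s₁ h₁ => Runs.ite (T := t.time.eval (s.var 3))
      (T' := u.time.eval (s.var 3)) (fun k => ?_) fun k => ?_).mono
      (by simp [time, Expr.cost]) fun _ h => h
    · have k' : r.eval l s ≠ 0 := by rw [← h₁.1]; exact k
      refine (h' ht.2.1 h3 hl hd).mono (by rw [h₁.2.2 3 (Or.inl h3)]) fun s₂ h₂ => ?_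
      exact ⟨by simp [eval, k', h₂.1, h₁.2.eval ht.2.1 h3], h₁.2.trans h₂.2⟩
    · have k' : r.eval l s = 0 := by rw [← h₁.1]; exact k
      refine (h'' ht.2.2 h3 hl hd).mono (by rw [h₁.2.2 3 (Or.inl h3)]) fun s₂ h₂ => ?_
      exact ⟨by simp [eval, k', h₂.1, h₁.2.eval ht.2.2 h3], h₁.2.trans h₂.2⟩
  | sum t h =>
    -- After `k` rounds, `x_d` holds the partial sum of the first `k` values taken in the initial
    -- memory.
    let I : ℕ → Memory → Prop := fun k s' => s'.var l = k ∧
      s'.var d = ∑ i ∈ Finset.range k, t.eval (l + 1) (s.setVar l i) ∧ Agree l d s s'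
    have hl' : l < 50 := ht.1
    refine (Runs.seq (Q := fun s' => s'.var d = 0 ∧ Agree l d s s')
      (.assign d (.const 0) ⟨by simp [Expr.eval], .setVar _ (by omega) (by omega)⟩)
      fun s₁ h₁ => Runs.loop (T := t.time.eval (s.var 3) + 4) I
        (fun k s' hI => hI.2.2.2 3 (Or.inl h3)) (fun k s' hI => hI.1) ?_ ?_).mono
      ?_ ?_
    · refine ⟨by simp, ?_, h₁.2.trans (.setVar _ le_rfl (Or.inl hl'))⟩
      rw [Memory.setVar_var_of_ne _ _ (by omega), h₁.1]
      simp
    · rintro k hk s₂ ⟨k1, k2, k3⟩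
      refine (Runs.seq ((h (d := d + 1) ht.2 (by omega) (by omega) (by omega)).mono
        (by rw [k3.2 3 (Or.inl h3)]) fun _ h => h) fun s₃ h₃ => Runs.assign d _ ?_).mono
        (by simp [Expr.cost]) fun _ h => h
      have e1 : t.eval (l + 1) s₂ = t.eval (l + 1) (s.setVar l k) := by
        refine eval_congr ht.2 (by omega) (fun x hx => ?_) fun m _ => congrFun k3.1 m
        rw [Memory.setVar_var]
        split
        · subst x; exact k1
        · exact k3.2 x (by omega)
      refine ⟨?_, by simp, ?_, ?_⟩
      · rw [Memory.setVar_var_of_ne _ _ (by omega), h₃.2.2 l (by omega), k1]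
      · rw [Memory.setVar_var_of_ne _ _ (by omega), Finset.sum_range_succ, Memory.setVar_var_self]
        simp only [Expr.eval]
        rw [h₃.1, h₃.2.2 d (by omega), k2, e1]
      · exact ((k3.trans (h₃.2.mono (by omega) (by omega))).trans
          (.setVar _ (by omega) (by omega))).trans (.setVar _ le_rfl (Or.inl hl'))
    · simp [time, Expr.cost]
    · rintro s' ⟨-, h1, h2⟩
      exact ⟨h1, h2⟩

end Tm

/-! ### Filling an array -/

/-- Frame rule for a double loop: if the body writes only the current entry of `M_m` and preserves
the variables below 12, all entries receive their prescribed values. -/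
theorem runs_scan {m N T : ℕ} {c : Prog} {s : Memory} (f : ℕ → ℕ → ℕ) (hN : s.var 3 = N)
    (hc : ∀ i < N, ∀ j < N, ∀ s', (∀ m' ≠ m, s'.arr m' = s.arr m') →
      (∀ x < 10, s'.var x = s.var x) → s'.var 10 = i → s'.var 11 = j →
      Runs c T s' fun s'' => s''.arr = (s'.setArr m i j (f i j)).arr ∧
        ∀ x < 12, s''.var x = s'.var x) :
    Runs (.loop 10 (.loop 11 c)) (N * (N * (T + 8) + 6 + 8) + 6) s fun s' =>
      (∀ x < 10, s'.var x = s.var x) ∧ (∀ m' ≠ m, s'.arr m' = s.arr m') ∧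
      ∀ i < N, ∀ j < N, s'.arr m i j = f i j := by
  let B : Memory → Prop := fun s' =>
    (∀ x < 10, s'.var x = s.var x) ∧ (∀ m' ≠ m, s'.arr m' = s.arr m')
  have hB : ∀ s' x v, 10 ≤ x → B s' → B (s'.setVar x v) := fun s' x v hx h =>
    ⟨fun y hy => (s'.setVar_var_of_ne v (by omega)).trans (h.1 y hy), h.2⟩
  let I : ℕ → Memory → Prop := fun k s' => s'.var 10 = k ∧ B s' ∧
    ∀ i < k, ∀ j < N, s'.arr m i j = f i j
  refine (Runs.loop I (fun k s' h => (h.2.1.1 3 (by omega)).trans hN) (fun k s' h => h.1)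
    ⟨by simp, hB _ _ _ le_rfl ⟨fun _ _ => rfl, fun _ _ => rfl⟩, by simp⟩
    fun k hk s₁ h₁ => ?_).mono le_rfl fun s' h => ⟨h.2.1.1, h.2.1.2, h.2.2⟩
  let J : ℕ → Memory → Prop := fun k' s' => s'.var 11 = k' ∧ s'.var 10 = k ∧ B s' ∧
    (∀ i < k, ∀ j < N, s'.arr m i j = f i j) ∧ ∀ j < k', s'.arr m k j = f k j
  refine (Runs.loop J (fun k s' h => (h.2.2.1.1 3 (by omega)).trans hN) (fun k s' h => h.1)
    ⟨by simp, by rw [Memory.setVar_var_of_ne _ _ (by omega)]; exact h₁.1,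
      hB _ _ _ (by omega) h₁.2.1, h₁.2.2, by simp⟩
    fun k' hk' s₂ h₂ => ?_).mono le_rfl fun s' h => ?_
  · refine (hc k hk k' hk' s₂ h₂.2.2.1.2 h₂.2.2.1.1 h₂.2.1 h₂.1).mono le_rfl ?_
    rintro s₃ ⟨h1, h2⟩
    refine ⟨(h2 11 (by omega)).trans h₂.1, by simp, ?_, hB _ _ _ (by omega) ⟨?_, ?_⟩, ?_, ?_⟩
    · rw [Memory.setVar_var_of_ne _ _ (by omega), h2 10 (by omega), h₂.2.1]
    · exact fun x hx => (h2 x (by omega)).trans (h₂.2.2.1.1 x hx)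
    · intro m' hm'
      rw [h1, ← h₂.2.2.1.2 m' hm']
      funext i j
      simp [Memory.setArr, hm']
    · intro i hi j hj
      rw [Memory.setVar_arr, h1, ← h₂.2.2.2.1 i hi j hj]
      simp [Memory.setArr, hi.ne]
    · intro j hj
      rw [Memory.setVar_arr, h1]
      rcases Nat.lt_succ_iff_lt_or_eq.1 hj with hj | rfl
      · rw [← h₂.2.2.2.2 j hj]
        simp [Memory.setArr, hj.ne]
      · simp [Memory.setArr]
  · refine ⟨h.2.1, by simp, hB _ _ _ le_rfl h.2.2.1, fun i hi j hj => ?_⟩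
    rcases Nat.lt_succ_iff_lt_or_eq.1 hi with hi | rfl
    · exact h.2.2.2.1 i hi j hj
    · exact h.2.2.2.2 j hj

/-- Set all entries `M_m[x_10, x_11]` with indices below `x_3` to the value of the term `t`. -/
def Prog.fill (m : ℕ) (t : Tm) : Prog :=
  .seq (.loop 10 (.loop 11 (.seq (t.code 12 50) (.store 100 (.var 10) (.var 11) (.var 50)))))
    (.loop 10 (.loop 11 (.store m (.var 10) (.var 11) (.get 100 (.var 10) (.var 11)))))

/-- A bound for the running time of `Prog.fill`. -/
noncomputable def fillTime (t : Tm) : Polynomial ℕ :=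
  (Polynomial.X * (Polynomial.X * (t.time + 4 + 8) + 6 + 8) + 6) +
    (Polynomial.X * (Polynomial.X * (6 + 8) + 6 + 8) + 6)

/-- The memory `s'` arises from `s` by `Prog.fill`. -/
structure Filled (m : ℕ) (t : Tm) (s s' : Memory) : Prop where
  var_eq : ∀ x < 10, s'.var x = s.var x
  arr_eq : ∀ m' < 100, m' ≠ m → s'.arr m' = s.arr m'
  get_eq : ∀ i < s.var 3, ∀ j < s.var 3,
    s'.arr m i j = t.eval 12 ((s.setVar 10 i).setVar 11 j)

/-- The term may read the array that is being filled, as `Tm.closure` does. All values are therefore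
collected in the buffer `M_100`, out of reach of `Ok` terms, and copied afterwards. -/
theorem runs_fill {m : ℕ} {t : Tm} (hm : m < 100) (ht : t.Ok 12) (s : Memory) :
    Runs (.fill m t) ((fillTime t).eval (s.var 3)) s (Filled m t s) := by
  have scan₁ := runs_scan (m := 100) (T := t.time.eval (s.var 3) + 4) (s := s)
    (c := .seq (t.code 12 50) (.store 100 (.var 10) (.var 11) (.var 50)))
    (fun i j => t.eval 12 ((s.setVar 10 i).setVar 11 j)) rfl (by
    intro i hi j hj s' h1 h2 h3 h4
    refine (Runs.seq (Tm.runs_code ht (by omega) (by omega) le_rfl) fun s₂ h => ?_).mono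
      (T := t.time.eval (s'.var 3) + 4) (by rw [h2 3 (by omega)]) fun _ h => h
    refine (Runs.store 100 _ _ _ ?_).mono (by simp [Expr.cost]) fun _ h => h
    have e1 : t.eval 12 s' = t.eval 12 ((s.setVar 10 i).setVar 11 j) := by
      refine Tm.eval_congr ht (by omega) (fun x hx => ?_) fun m' hm' => h1 m' (by omega)
      simp only [Memory.setVar_var]
      split
      · subst x; exact h4
      split
      · subst x; exact h3
      · exact h2 x (by omega)
    refine ⟨?_, fun x hx => h.2.2 x (Or.inl hx)⟩
    simp only [Memory.setArr, Expr.eval, h.2.1, h.1, e1, h.2.2 10 (by omega),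
      h.2.2 11 (by omega), h3, h4])
  have scan₂ := fun (s₁ : Memory) (h₁ : s₁.var 3 = s.var 3) => runs_scan (m := m) (N := s.var 3)
    (T := 6) (s := s₁) (c := .store m (.var 10) (.var 11) (.get 100 (.var 10) (.var 11)))
    (fun i j => s₁.arr 100 i j) h₁ (by
    intro i hi j hj s' h1 h2 h3 h4
    refine (Runs.store m _ _ _ ?_).mono (by simp [Expr.cost]) fun _ h => h
    refine ⟨?_, fun x hx => rfl⟩
    simp only [Memory.setArr, Expr.eval, h3, h4, h1 100 (by omega)])
  refine (scan₁.seq fun s₁ h₁ => (scan₂ s₁ (h₁.1 3 (by omega))).mono le_rfl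
    (Q' := Filled m t s) fun s₂ h₂ => ⟨?_, ?_, ?_⟩).mono (by simp [fillTime]) fun _ h => h
  · exact fun x hx => (h₂.1 x hx).trans (h₁.1 x hx)
  · exact fun m' hm' hne => (h₂.2.1 m' hne).trans (h₁.2.1 m' (by omega))
  · exact fun i hi j hj => (h₂.2.2 i hi j hj).trans (h₁.2.2 i hi j hj)

/-! ### Boolean terms -/

namespace Tm

/-- Truth of a term: its value is not `0`. -/
def IsTrue (t : Tm) (l : ℕ) (s : Memory) : Prop := t.eval l s ≠ 0

/-- Negation. -/
def not (t : Tm) : Tm := ite t (const 0) (const 1)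

/-- Conjunction. -/
def and (t u : Tm) : Tm := ite t u (const 0)

/-- Disjunction. -/
def or (t u : Tm) : Tm := ite t (const 1) u

/-- The comparison `t < u`. -/
def lt (t u : Tm) : Tm := sub u t

/-- The comparison `t = u`. -/
def eq (t u : Tm) : Tm := not (add (sub t u) (sub u t))

/-- The truth value of a term as `0` or `1`. -/
def bool (t : Tm) : Tm := ite t (const 1) (const 0)

variable {t u : Tm} {l : ℕ} {s : Memory}

@[simp] theorem isTrue_not : (not t).IsTrue l s ↔ ¬ t.IsTrue l s := by
  simp only [IsTrue, not, eval]
  split <;> simp_all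

@[simp] theorem isTrue_and : (and t u).IsTrue l s ↔ t.IsTrue l s ∧ u.IsTrue l s := by
  simp only [IsTrue, and, eval]
  split <;> simp_all

@[simp] theorem isTrue_or : (or t u).IsTrue l s ↔ t.IsTrue l s ∨ u.IsTrue l s := by
  simp only [IsTrue, or, eval]
  split <;> simp_all

@[simp] theorem isTrue_lt : (lt t u).IsTrue l s ↔ t.eval l s < u.eval l s := by
  simp only [IsTrue, lt, eval]
  omega

@[simp] theorem isTrue_eq : (eq t u).IsTrue l s ↔ t.eval l s = u.eval l s := by
  rw [eq, isTrue_not]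
  simp only [IsTrue, eval]
  omega

@[simp] theorem isTrue_sum :
    (sum t).IsTrue l s ↔ ∃ i < s.var 3, t.IsTrue (l + 1) (s.setVar l i) := by
  simp only [IsTrue, eval, ne_eq, Finset.sum_eq_zero_iff, Finset.mem_range]
  push Not
  rfl

@[simp] theorem isTrue_get {m : ℕ} :
    (get m t u).IsTrue l s ↔ s.arr m (t.eval l s) (u.eval l s) ≠ 0 := Iff.rfl

@[simp] theorem isTrue_bool : (bool t).IsTrue l s ↔ t.IsTrue l s := by
  simp only [IsTrue, bool, eval]
  split <;> simp_all

open Classical in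
theorem eval_bool : (bool t).eval l s = if t.IsTrue l s then 1 else 0 := by
  simp only [IsTrue, bool, eval]
  congr

end Tm

/-! ### The terms of the algorithm -/

namespace Tm

/-- The index of the negated literal. -/
def neg (p : Tm) : Tm := ite (lt p (var 0)) (add (var 0) p) (sub p (var 0))

/-- `Gate`, for variables of the machine. -/
def gate (l a b x p : ℕ) : Tm :=
  and (get 0 (var x) (var a)) (and (not (eq (var x) (var b)))
    (or (and (get 0 (var x) (var b)) (eq (var p) (var x)))
      (and (not (get 0 (var x) (var b)))
        (sum (and (get 0 (var x) (var l)) (eq (var p) (add (var 0) (var l))))))))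

/-- `BoundaryExcl` for the literals `x_10` and `x_11`. -/
def boundaryExcl (a b : ℕ) : Tm :=
  sum (sum (and (not (eq (var 12) (var 13))) (and (not (get 0 (var 12) (var 13)))
    (and (gate 14 a b 12 10) (gate 14 a b 13 11)))))

/-- `EdgeExcl` for the vertices `x_12` and `x_13`. -/
def edgeExcl : Tm :=
  and (get 0 (var 12) (var 13))
    (or (and (not (eq (var 12) (var 1))) (not (get 0 (var 12) (var 1))))
      (and (not (eq (var 13) (var 2))) (not (get 0 (var 13) (var 2)))))

/-- The reflexive closure of `Imp` for the literals `x_10` and `x_11`. -/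
def imp : Tm :=
  or (eq (var 10) (var 11))
    (or (and (eq (var 10) (add (var 0) (var 1))) (eq (var 11) (var 1)))
      (or (and (eq (var 10) (var 2)) (eq (var 11) (add (var 0) (var 2))))
        (or (sum (sum (and edgeExcl
            (or (and (eq (var 10) (var 12)) (eq (var 11) (var 13)))
              (and (eq (var 10) (add (var 0) (var 13))) (eq (var 11) (add (var 0) (var 12))))))))
          (or (get 12 (var 10) (neg (var 11))) (get 13 (neg (var 10)) (var 11))))))

/-- One step of the computation of the transitive closure, through the literal `x_4`. -/
def closure : Tm :=
  or (get 4 (var 10) (var 11)) (and (get 4 (var 10) (var 4)) (get 4 (var 4) (var 11)))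

/-- `Nontriv` for the vertex `x_10`. -/
def nontriv : Tm :=
  and (lt (var 10) (var 0)) (and (not (get 4 (var 10) (add (var 0) (var 10))))
    (not (get 4 (add (var 0) (var 10)) (var 10))))

/-- `SameCell` for the vertices `x_10` and `x_11`. -/
def sameCell : Tm :=
  and (and (get 5 (var 10) (const 0)) (get 5 (var 11) (const 0)))
    (and (get 4 (var 10) (var 11)) (get 4 (var 11) (var 10)))

/-- `TwinCell` for the vertices `x_10` and `x_11`. -/
def twinCell : Tm :=
  and (and (get 5 (var 10) (const 0)) (get 5 (var 11) (const 0)))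
    (and (get 4 (var 10) (add (var 0) (var 11))) (get 4 (add (var 0) (var 11)) (var 10)))

/-- `IsRep` for the vertex `x_10`. -/
def isRep : Tm :=
  bool (and (get 5 (var 10) (const 0)) (not (sum (and (lt (var 12) (var 10))
    (or (get 6 (var 10) (var 12)) (get 7 (var 10) (var 12)))))))

/-- `cellIndex` for the vertex `x_10`. -/
def cellIndex : Tm :=
  sum (bool (and (get 8 (var 12) (const 0)) (lt (var 12) (var 10))))

/-- `Precedes` for the vertices `x_x` and `x_y`. -/
def precedes (x y : ℕ) : Tm :=
  and (get 4 (var x) (var y)) (not (get 4 (var y) (var x)))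

/-- `IsBlockRep` for the vertex `x_10`. -/
def isBlockRep : Tm :=
  bool (and (get 8 (var 10) (const 0)) (not (sum (and (lt (var 12) (var 10))
    (and (get 8 (var 12) (const 0)) (and (not (precedes 10 12)) (not (precedes 12 10))))))))

/-- `blockIndex` for the vertex `x_10`. -/
def blockIndex : Tm :=
  sum (bool (and (get 10 (var 12) (const 0)) (precedes 10 12)))

/-- The indicator function of `base` for the vertex `x_10`. -/
def base : Tm := bool (get 4 (add (var 0) (var 10)) (var 10))

/-- The indicator function of a half of the cell `x_10` for the vertex `x_11`, where `M_m` holds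
the relation between the vertices of that half and the representative. -/
def half (m : ℕ) : Tm :=
  bool (sum (and (get 8 (var 12) (const 0))
    (and (eq (get 9 (var 12) (const 0)) (var 10)) (get m (var 12) (var 11)))))

/-- The block of the cell `x_10`. -/
def block : Tm :=
  sum (ite (and (get 8 (var 12) (const 0)) (eq (get 9 (var 12) (const 0)) (var 10)))
    (get 11 (var 12) (const 0)) (const 0))

/-- The number of cells. -/
def numCells : Tm := sum (get 8 (var 12) (const 0))

/-- The number of blocks. -/
def numBlocks : Tm :=
  add (sum (get 10 (var 12) (const 0))) (sub (const 1) (sum (get 10 (var 12) (const 0))))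

end Tm

/-! ### Correctness of the terms -/

section Correctness

variable {V : Type*} {n : ℕ} (e : V ≃ Fin n) (G : SimpleGraph V) (a b : V)

/-- The index of a literal. -/
def lit : V ⊕ V → ℕ
  | .inl v => e v
  | .inr v => n + e v

/-- The values of the first variables during the computation. -/
structure Vars (s : Memory) : Prop where
  var_zero : s.var 0 = n
  var_one : s.var 1 = e a
  var_two : s.var 2 = e b
  var_three : s.var 3 = n + n

/-- The array `M` is the adjacency matrix. -/
def IsAdjacency (M : ℕ → ℕ → ℕ) : Prop :=
  ∀ i j, M i j ≠ 0 ↔ ∃ u v, (e u : ℕ) = i ∧ (e v : ℕ) = j ∧ G.Adj u v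

/-- The array `M` represents a relation between literals. -/
def LitRel (M : ℕ → ℕ → ℕ) (R : V ⊕ V → V ⊕ V → Prop) : Prop :=
  ∀ p q, M (lit e p) (lit e q) ≠ 0 ↔ R p q

/-- The array `M` represents a relation between vertices. -/
def VertexRel (M : ℕ → ℕ → ℕ) (R : V → V → Prop) : Prop :=
  ∀ x y, M (e x) (e y) ≠ 0 ↔ R x y

/-- The first column of the array `M` represents a set of vertices. -/
def VertexSet (M : ℕ → ℕ → ℕ) (P : V → Prop) : Prop :=
  ∀ i < n + n, M i 0 ≠ 0 ↔ ∃ v, (e v : ℕ) = i ∧ P v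

/-- The meaning of the arrays after they have been filled. -/
def Fact : ℕ → (ℕ → ℕ → ℕ) → Prop
  | 0, M => ∀ v, M (e v) 0 = (base G a b).indicator 1 v
  | 1, M => ∀ x v, IsRep G a b e x →
      M (cellIndex G a b e x) (e v) = {v | SameCell G a b x v}.indicator 1 v
  | 2, M => ∀ x v, IsRep G a b e x →
      M (cellIndex G a b e x) (e v) = {v | TwinCell G a b x v}.indicator 1 v
  | 3, M => ∀ x, IsRep G a b e x → M (cellIndex G a b e x) 0 = blockIndex G a b e x
  | 4, M => LitRel e M (Derives G a b)
  | 5, M => VertexSet e M (Nontriv G a b)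
  | 6, M => VertexRel e M (SameCell G a b)
  | 7, M => VertexRel e M (TwinCell G a b)
  | 8, M => VertexSet e M (IsRep G a b e) ∧ ∀ i < n + n, M i 0 ≤ 1
  | 9, M => ∀ x, M (e x) 0 = cellIndex G a b e x
  | 10, M => VertexSet e M (IsBlockRep G a b e) ∧ ∀ i < n + n, M i 0 ≤ 1
  | 11, M => ∀ x, IsRep G a b e x → M (e x) 0 = blockIndex G a b e x
  | _, _ => True

variable {e G a b}

theorem lit_lt (p : V ⊕ V) : lit e p < n + n := by
  rcases p with v | v <;> simp only [lit] <;> omega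

theorem exists_lit {i : ℕ} (hi : i < n + n) : ∃ p, lit e p = i := by
  by_cases h : i < n
  · exact ⟨.inl (e.symm ⟨i, h⟩), by simp [lit]⟩
  · exact ⟨.inr (e.symm ⟨i - n, by omega⟩), by simp only [lit, Equiv.apply_symm_apply]; omega⟩

theorem lit_injective : Function.Injective (lit e) := by
  rintro (v | v) (w | w) h <;> simp only [lit] at h
  · rw [e.injective (Fin.ext h)]
  · omega
  · omega
  · rw [e.injective (Fin.ext (Nat.add_left_cancel h))]

theorem lit_eq_val {p : V ⊕ V} {v : V} : lit e p = e v ↔ p = .inl v :=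
  lit_injective.eq_iff (a := p) (b := .inl v)

theorem lit_eq_add_val {p : V ⊕ V} {v : V} : lit e p = n + e v ↔ p = .inr v :=
  lit_injective.eq_iff (a := p) (b := .inr v)

theorem lit_swap (p : V ⊕ V) :
    lit e p.swap = if lit e p < n then n + lit e p else lit e p - n := by
  rcases p with v | v <;> simp [lit]

theorem val_eq_val {x y : V} : (e x : ℕ) = e y ↔ x = y :=
  ⟨fun h => e.injective (Fin.ext h), fun h => h ▸ rfl⟩

theorem val_lt (v : V) : (e v : ℕ) < n + n := by omega

theorem exists_lt_iff {f : ℕ → Prop} {P : V → Prop}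
    (h : ∀ i < n + n, f i ↔ ∃ v, (e v : ℕ) = i ∧ P v) : (∃ i < n + n, f i) ↔ ∃ v, P v := by
  constructor
  · rintro ⟨i, hi, hf⟩
    obtain ⟨v, -, hv⟩ := (h i hi).1 hf
    exact ⟨v, hv⟩
  · rintro ⟨v, hv⟩
    exact ⟨e v, val_lt v, (h _ (val_lt v)).2 ⟨v, rfl, hv⟩⟩

/-- Sums run over all literal indices below `2n`; a guard such as an adjacency test confines the
index to the vertices. -/
theorem exists_lt_iff_of_guard {f : ℕ → Prop} (h : ∀ i, f i → i < n) :
    (∃ i < n + n, f i) ↔ ∃ v, f (e v) := by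
  refine exists_lt_iff (e := e) (P := fun v => f (e v)) fun i _ =>
    ⟨fun hf => ⟨e.symm ⟨i, h i hf⟩, by simp, by simpa using hf⟩, ?_⟩
  rintro ⟨v, rfl, hv⟩
  exact hv

open Classical in
-- Indices from `n` on are not numbers of vertices and contribute 0.
theorem sum_eq_ncard {f : ℕ → ℕ} {P : V → Prop}
    (h : ∀ i < n + n, f i = if ∃ v, (e v : ℕ) = i ∧ P v then 1 else 0) :
    ∑ i ∈ Finset.range (n + n), f i = {v | P v}.ncard := by
  rw [Finset.sum_congr rfl fun i hi => h i (Finset.mem_range.1 hi), ← Finset.card_filter,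
    ← Set.ncard_coe_finset]
  have : ((Finset.range (n + n)).filter fun i => ∃ v, (e v : ℕ) = i ∧ P v : Set ℕ) =
      (fun v => (e v : ℕ)) '' {v | P v} := by
    ext i
    simp only [Finset.coe_filter, Finset.mem_range, Set.mem_ofPred_eq, Set.mem_image]
    constructor
    · rintro ⟨-, v, h1, h2⟩
      exact ⟨v, h2, h1⟩
    · rintro ⟨v, h1, rfl⟩
      exact ⟨val_lt v, v, rfl, h1⟩
  rw [this, Set.ncard_image_of_injective]
  exact fun x y h => val_eq_val.1 h

namespace IsAdjacency

variable {M : ℕ → ℕ → ℕ} (h : IsAdjacency e G M)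

include h

theorem ne_zero_iff {u v : V} : M (e u) (e v) ≠ 0 ↔ G.Adj u v := by
  rw [h]
  constructor
  · rintro ⟨u', v', h1, h2, h3⟩
    rwa [← val_eq_val.1 h1, ← val_eq_val.1 h2]
  · exact fun h => ⟨u, v, rfl, rfl, h⟩

theorem lt_left {i j : ℕ} (hij : M i j ≠ 0) : i < n := by
  obtain ⟨u, v, rfl, -, -⟩ := (h i j).1 hij
  omega

theorem lt_right {i j : ℕ} (hij : M i j ≠ 0) : j < n := by
  obtain ⟨u, v, -, rfl, -⟩ := (h i j).1 hij
  omega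

end IsAdjacency

/-- Moves the negations to where `Tm.imp` reads them: on the second argument for `M_12`, on the
first for `M_13`. -/
theorem imp_iff {p q : V ⊕ V} : Imp G a b p q ↔
    (p = .inr a ∧ q = .inl a) ∨ (p = .inl b ∧ q = .inr b) ∨
    (∃ x y, EdgeExcl G a b x y ∧ ((p = .inl x ∧ q = .inl y) ∨ (p = .inr y ∧ q = .inr x))) ∨
    BoundaryExcl G a b p q.swap ∨ BoundaryExcl G b a p.swap q := by
  have swap_inl : ∀ v : V, q.swap = .inl v ↔ q = .inr v := by cases q <;> simp
  have swap_inr : ∀ v : V, q.swap = .inr v ↔ q = .inl v := by cases q <;> simp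
  simp only [Imp, Excl, swap_inl, swap_inr, Sum.swap_swap]

/-! ### Terms for the clauses -/

section Clauses

variable {s : Memory}

theorem isTrue_gate {l x p A B : ℕ} {v a b : V} {P : V ⊕ V} (hs0 : s.var 0 = n)
    (hs3 : s.var 3 = n + n) (hM : IsAdjacency e G (s.arr 0)) (hx : s.var x = e v)
    (hp : s.var p = lit e P) (hA : s.var A = e a) (hB : s.var B = e b) (hl0 : 0 < l) (hlx : x < l)
    (hlp : p < l) : (Tm.gate l A B x p).IsTrue l s ↔ Gate G a b v P := by
  have e1 : (∃ i < n + n, s.arr 0 (e v) i ≠ 0 ∧ lit e P = n + i) ↔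
      ∃ y, G.Adj v y ∧ P = .inr y := by
    rw [exists_lt_iff_of_guard (e := e) fun i hi => hM.lt_right hi.1]
    simp only [hM.ne_zero_iff, lit_eq_add_val]
  simp only [Tm.gate, Tm.isTrue_and, Tm.isTrue_or, Tm.isTrue_not, Tm.isTrue_eq, Tm.isTrue_get,
    Tm.isTrue_sum, Tm.eval, Memory.setVar_var, Memory.setVar_arr, hs0, hs3, hx, hA, hB, hp,
    hlx.ne, hlp.ne, hl0.ne, if_false, if_true, hM.ne_zero_iff, val_eq_val, lit_eq_val, e1, Gate,
    ne_eq]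

theorem isTrue_boundaryExcl {A B : ℕ} {a b : V} {p q : V ⊕ V} (hs0 : s.var 0 = n)
    (hs3 : s.var 3 = n + n) (hM : IsAdjacency e G (s.arr 0)) (hA : s.var A = e a)
    (hB : s.var B = e b) (hA' : A < 10) (hB' : B < 10) (hp : s.var 10 = lit e p)
    (hq : s.var 11 = lit e q) :
    (Tm.boundaryExcl A B).IsTrue 12 s ↔ BoundaryExcl G a b p q := by
  have gate : ∀ x x' z P Z, (z = 12 ∧ P = 10) ∨ (z = 13 ∧ P = 11) →
      ∀ v : V, (if z = 12 then x else x') = (e v : ℕ) → lit e Z = s.var P →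
      ((Tm.gate 14 A B z P).IsTrue 14 ((s.setVar 12 x).setVar 13 x') ↔ Gate G a b v Z) := by
    intro x x' z P Z hz v hv hZ
    have hA12 : A ≠ 12 := by omega
    have hA13 : A ≠ 13 := by omega
    have hB12 : B ≠ 12 := by omega
    have hB13 : B ≠ 13 := by omega
    refine isTrue_gate (by simpa [Memory.setVar_var]) (by simpa [Memory.setVar_var]) hM ?_ ?_ ?_ ?_
      (by omega) (by omega) (by omega)
    · rcases hz with ⟨rfl, rfl⟩ | ⟨rfl, rfl⟩ <;> simpa [Memory.setVar_var] using hv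
    · rcases hz with ⟨rfl, rfl⟩ | ⟨rfl, rfl⟩ <;> simp [Memory.setVar_var, hZ]
    · simp [Memory.setVar_var, hA, hA12, hA13]
    · simp [Memory.setVar_var, hB, hB12, hB13]
  -- The first conjunct of the gate is an adjacency, so an index that passes it is the number of a
  -- vertex.
  have guard : ∀ x x' z P, (z = 12 ∧ P = 10) ∨ (z = 13 ∧ P = 11) →
      (Tm.gate 14 A B z P).IsTrue 14 ((s.setVar 12 x).setVar 13 x') →
      (if z = 12 then x else x') < n := by
    intro x x' z P hz h
    have hlt := hM.lt_left (Tm.isTrue_and.1 h).1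
    rcases hz with ⟨rfl, rfl⟩ | ⟨rfl, rfl⟩ <;> simpa [Tm.eval, Memory.setVar_var] using hlt
  simp only [Tm.boundaryExcl, Tm.isTrue_sum, Tm.isTrue_and, Tm.isTrue_not, Tm.isTrue_eq,
    Tm.isTrue_get, Tm.eval, Memory.setVar_arr]
  have h3 : ∀ i, (s.setVar 12 i).var 3 = n + n := fun i => by simpa [Memory.setVar_var]
  simp only [hs3, h3]
  rw [exists_lt_iff_of_guard (e := e)]
  · unfold BoundaryExcl
    refine exists_congr fun v => ?_
    rw [exists_lt_iff_of_guard (e := e)]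
    · refine exists_congr fun v' => ?_
      rw [gate _ _ 12 10 p (Or.inl ⟨rfl, rfl⟩) v rfl hp.symm,
        gate _ _ 13 11 q (Or.inr ⟨rfl, rfl⟩) v' rfl hq.symm]
      simp [Memory.setVar_var, hM.ne_zero_iff, val_eq_val, ← ne_eq]
    · rintro i ⟨-, -, -, h⟩
      exact guard _ _ 13 11 (Or.inr ⟨rfl, rfl⟩) h
  · rintro i ⟨j, -, -, -, h, -⟩
    exact guard _ _ 12 10 (Or.inl ⟨rfl, rfl⟩) h

theorem isTrue_imp {p q : V ⊕ V} (hs : Vars e a b s) (hM : IsAdjacency e G (s.arr 0))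
    (h12 : LitRel e (s.arr 12) (BoundaryExcl G a b))
    (h13 : LitRel e (s.arr 13) (BoundaryExcl G b a))
    (hp : s.var 10 = lit e p) (hq : s.var 11 = lit e q) :
    Tm.imp.IsTrue 12 s ↔ p = q ∨ Imp G a b p q := by
  have neg : ∀ {x : ℕ} {r : V ⊕ V}, s.var x = lit e r →
      (Tm.neg (.var x)).eval 12 s = lit e r.swap := by
    intro x r hx
    rw [lit_swap]
    simp only [Tm.neg, Tm.lt, Tm.eval, hx, hs.var_zero]
    split <;> split <;> omega
  have edge : (∃ x < n + n, ∃ y < n + n, (s.arr 0 x y ≠ 0 ∧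
      ((¬ x = e a ∧ ¬ s.arr 0 x (e a) ≠ 0) ∨ (¬ y = e b ∧ ¬ s.arr 0 y (e b) ≠ 0))) ∧
      ((lit e p = x ∧ lit e q = y) ∨ (lit e p = n + y ∧ lit e q = n + x))) ↔
      ∃ x y, EdgeExcl G a b x y ∧
        ((p = .inl x ∧ q = .inl y) ∨ (p = .inr y ∧ q = .inr x)) := by
    rw [exists_lt_iff_of_guard (e := e)]
    · refine exists_congr fun x => ?_
      rw [exists_lt_iff_of_guard (e := e) fun i hi => hM.lt_right hi.1.1]
      simp only [hM.ne_zero_iff, val_eq_val, lit_eq_val, lit_eq_add_val, EdgeExcl, ne_eq]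
    · rintro i ⟨j, -, ⟨h, -⟩, -⟩
      exact hM.lt_left h
  rw [imp_iff]
  simp only [Tm.imp, Tm.edgeExcl, Tm.isTrue_sum, Tm.isTrue_and, Tm.isTrue_or, Tm.isTrue_not,
    Tm.isTrue_eq, Tm.isTrue_get, neg hp, neg hq]
  simp only [Tm.eval, Memory.setVar_var, Memory.setVar_arr, Nat.reduceEqDiff, if_false, if_true,
    hs.var_zero, hs.var_one, hs.var_two, hs.var_three, hp, hq, h12 _ _, h13 _ _, edge, lit_eq_val,
    lit_eq_add_val, lit_injective.eq_iff]

end Clauses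

end Correctness

/-! ### Semantic notions in terms of derivability -/

section Facts

variable {V : Type*} {n : ℕ} {e : V ≃ Fin n} {G : SimpleGraph V} {a b : V} {s : Memory}

/-- The 2-SAT lemma with both literals equal: a literal that does not derive its negation holds in
some halfspace. -/
theorem derives_swap_iff (hG : G.Connected) (hab : G.Adj a b) (hne : (halfspaces G a b).Nonempty)
    {p : V ⊕ V} : Derives G a b p p.swap ↔ ∀ H ∈ halfspaces G a b, ¬ Holds H p := by
  constructor
  · intro h H hH hp
    exact holds_swap.1 (h.holds hG hab hH hp) hp
  · intro h
    by_contra k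
    obtain ⟨H, hH, hp, -⟩ := exists_halfspace_of_not_derives hG hab hne k k k
    exact h H hH hp

/-- With `derives_swap_iff`, both sides of `v` occur exactly when neither literal of `v` refutes
itself. -/
theorem nontriv_iff (hG : G.Connected) (hab : G.Adj a b) (hne : (halfspaces G a b).Nonempty)
    {v : V} : Nontriv G a b v ↔
      ¬ Derives G a b (.inl v) (.inr v) ∧ ¬ Derives G a b (.inr v) (.inl v) := by
  have h1 := derives_swap_iff hG hab hne (p := .inl v)
  have h2 := derives_swap_iff hG hab hne (p := .inr v)
  simp only [Sum.swap_inl, Sum.swap_inr, holds_inl, holds_inr, not_not] at h1 h2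
  rw [h1, h2, Nontriv]
  push Not
  rfl

theorem mem_base_iff (hG : G.Connected) (hab : G.Adj a b) (hne : (halfspaces G a b).Nonempty)
    {v : V} : v ∈ base G a b ↔ Derives G a b (.inr v) (.inl v) := by
  have h2 := derives_swap_iff hG hab hne (p := .inr v)
  simp only [Sum.swap_inr, holds_inr, not_not] at h2
  exact h2.symm

theorem derives_iff_entails (hG : G.Connected) (hab : G.Adj a b) {p q : V ⊕ V}
    (hp : Undecided G a b p) (hq : Undecided G a b q) :
    Derives G a b p q ↔ Entails G a b p q :=
  ⟨fun h => h.entails hG hab, fun h => h.derives hG hab hp hq⟩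

theorem precedes_iff (hG : G.Connected) (hab : G.Adj a b) {x y : V} (hx : Nontriv G a b x)
    (hy : Nontriv G a b y) : Precedes G a b x y ↔
      Derives G a b (.inl x) (.inl y) ∧ ¬ Derives G a b (.inl y) (.inl x) := by
  rw [derives_iff_entails hG hab (undecided_inl.2 hx) (undecided_inl.2 hy),
    derives_iff_entails hG hab (undecided_inl.2 hy) (undecided_inl.2 hx), Precedes]

theorem sameCell_iff (hG : G.Connected) (hab : G.Adj a b) {x y : V} : SameCell G a b x y ↔
    (Nontriv G a b x ∧ Nontriv G a b y) ∧
      Derives G a b (.inl x) (.inl y) ∧ Derives G a b (.inl y) (.inl x) := by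
  rw [SameCell, ← and_assoc]
  refine and_congr_right fun ⟨hx, hy⟩ => ?_
  rw [derives_iff_entails hG hab (undecided_inl.2 hx) (undecided_inl.2 hy),
    derives_iff_entails hG hab (undecided_inl.2 hy) (undecided_inl.2 hx)]
  exact ⟨fun h => ⟨fun H hH => (h H hH).1, fun H hH => (h H hH).2⟩,
    fun h H hH => ⟨h.1 H hH, h.2 H hH⟩⟩

theorem twinCell_iff (hG : G.Connected) (hab : G.Adj a b) {x y : V} : TwinCell G a b x y ↔
    (Nontriv G a b x ∧ Nontriv G a b y) ∧
      Derives G a b (.inl x) (.inr y) ∧ Derives G a b (.inr y) (.inl x) := by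
  rw [TwinCell, ← and_assoc]
  refine and_congr_right fun ⟨hx, hy⟩ => ?_
  rw [derives_iff_entails hG hab (undecided_inl.2 hx) (undecided_inr.2 hy),
    derives_iff_entails hG hab (undecided_inr.2 hy) (undecided_inl.2 hx)]
  exact ⟨fun h => ⟨fun H hH => (h H hH).1, fun H hH => (h H hH).2⟩,
    fun h H hH => ⟨h.1 H hH, h.2 H hH⟩⟩

theorem Vars.setVar (hs : Vars e a b s) {x v : ℕ} (hx : 3 < x) : Vars e a b (s.setVar x v) :=
  ⟨(s.setVar_var_of_ne v (by omega)).trans hs.1, (s.setVar_var_of_ne v (by omega)).trans hs.2,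
    (s.setVar_var_of_ne v (by omega)).trans hs.3, (s.setVar_var_of_ne v (by omega)).trans hs.4⟩

theorem VertexSet.ne_zero_iff {M : ℕ → ℕ → ℕ} {P : V → Prop} (h : VertexSet e M P) {v : V} :
    M (e v) 0 ≠ 0 ↔ P v := by
  rw [h _ (val_lt v)]
  constructor
  · rintro ⟨w, hw, hP⟩
    rwa [← val_eq_val.1 hw]
  · exact fun h => ⟨v, rfl, h⟩

open Classical in
theorem VertexSet.eq_ite {M : ℕ → ℕ → ℕ} {P : V → Prop} (h : VertexSet e M P)
    (h1 : ∀ i < n + n, M i 0 ≤ 1) {i : ℕ} (hi : i < n + n) :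
    M i 0 = if ∃ v, (e v : ℕ) = i ∧ P v then 1 else 0 := by
  have := h i hi
  have := h1 i hi
  split <;> rename_i h <;> simp only [h, iff_true, iff_false] at * <;> omega

/-- Rewriting a bounded existential quantifier whose body is guarded by a set of vertices. -/
theorem exists_lt_iff_and {M : ℕ → ℕ → ℕ} {P Q : V → Prop} {f : ℕ → Prop} (h : VertexSet e M P)
    (hf : ∀ v, P v → (f (e v) ↔ Q v)) :
    (∃ i < n + n, M i 0 ≠ 0 ∧ f i) ↔ ∃ v, P v ∧ Q v := by
  refine exists_lt_iff (e := e) fun i hi => ?_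
  rw [h i hi]
  constructor
  · rintro ⟨⟨v, rfl, hv⟩, hfv⟩
    exact ⟨v, rfl, hv, (hf v hv).1 hfv⟩
  · rintro ⟨v, rfl, hv, hQ⟩
    exact ⟨⟨v, rfl, hv⟩, (hf v hv).2 hQ⟩

theorem sum_and_eq_ncard {M : ℕ → ℕ → ℕ} {P Q : V → Prop} {t u : Tm} (hs : Vars e a b s)
    (h : VertexSet e M P)
    (ht : ∀ i < n + n, t.IsTrue 13 (s.setVar 12 i) ↔ M i 0 ≠ 0)
    (hu : ∀ v, P v → (u.IsTrue 13 (s.setVar 12 (e v)) ↔ Q v)) :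
    (Tm.sum (.bool (.and t u))).eval 12 s = {v | P v ∧ Q v}.ncard := by
  classical
  rw [Tm.eval, hs.var_three]
  refine sum_eq_ncard (e := e) fun i hi => ?_
  rw [Tm.eval_bool]
  refine if_congr (Tm.isTrue_and.trans ?_) rfl rfl
  rw [ht i hi, h i hi]
  constructor
  · rintro ⟨⟨v, rfl, hv⟩, hfv⟩
    exact ⟨v, rfl, hv, (hu v hv).1 hfv⟩
  · rintro ⟨v, rfl, hv, hQ⟩
    exact ⟨⟨v, rfl, hv⟩, (hu v hv).2 hQ⟩

/-! ### Values of the terms -/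

variable (hs : Vars e a b s)

include hs

theorem isTrue_nontriv (hG : G.Connected) (hab : G.Adj a b) (hne : (halfspaces G a b).Nonempty)
    (h4 : LitRel e (s.arr 4) (Derives G a b)) :
    Tm.nontriv.IsTrue 12 s ↔ ∃ v, (e v : ℕ) = s.var 10 ∧ Nontriv G a b v := by
  simp only [Tm.nontriv, Tm.isTrue_and, Tm.isTrue_lt, Tm.isTrue_not, Tm.isTrue_get, Tm.eval,
    hs.var_zero]
  have key : ∀ v : V, (¬ s.arr 4 (e v) (n + e v) ≠ 0 ∧ ¬ s.arr 4 (n + e v) (e v) ≠ 0) ↔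
      Nontriv G a b v := by
    intro v
    rw [nontriv_iff hG hab hne]
    exact and_congr (not_congr (h4 (.inl v) (.inr v))) (not_congr (h4 (.inr v) (.inl v)))
  constructor
  · rintro ⟨h, h'⟩
    obtain ⟨v, hv⟩ : ∃ v, (e v : ℕ) = s.var 10 := ⟨e.symm ⟨_, h⟩, by simp⟩
    rw [← hv] at h'
    exact ⟨v, hv, (key v).1 h'⟩
  · rintro ⟨v, hv, h⟩
    rw [← hv]
    exact ⟨(e v).2, (key v).2 h⟩

omit hs in
theorem isTrue_sameCell (hG : G.Connected) (hab : G.Adj a b)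
    (h4 : LitRel e (s.arr 4) (Derives G a b)) (h5 : VertexSet e (s.arr 5) (Nontriv G a b)) {x y : V}
    (hx : s.var 10 = e x) (hy : s.var 11 = e y) :
    Tm.sameCell.IsTrue 12 s ↔ SameCell G a b x y := by
  simp only [Tm.sameCell, Tm.isTrue_and, Tm.isTrue_get, Tm.eval, hx, hy, h5.ne_zero_iff,
    sameCell_iff hG hab]
  exact and_congr_right fun _ => and_congr (h4 (.inl x) (.inl y)) (h4 (.inl y) (.inl x))

theorem isTrue_twinCell (hG : G.Connected) (hab : G.Adj a b)
    (h4 : LitRel e (s.arr 4) (Derives G a b)) (h5 : VertexSet e (s.arr 5) (Nontriv G a b)) {x y : V}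
    (hx : s.var 10 = e x) (hy : s.var 11 = e y) :
    Tm.twinCell.IsTrue 12 s ↔ TwinCell G a b x y := by
  simp only [Tm.twinCell, Tm.isTrue_and, Tm.isTrue_get, Tm.eval, hx, hy, hs.var_zero,
    h5.ne_zero_iff, twinCell_iff hG hab]
  exact and_congr_right fun _ => and_congr (h4 (.inl x) (.inr y)) (h4 (.inr y) (.inl x))

theorem isTrue_isRep (h5 : VertexSet e (s.arr 5) (Nontriv G a b))
    (h6 : VertexRel e (s.arr 6) (SameCell G a b)) (h7 : VertexRel e (s.arr 7) (TwinCell G a b))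
    (h10 : s.var 10 < n + n) :
    Tm.isRep.IsTrue 12 s ↔ ∃ v, (e v : ℕ) = s.var 10 ∧ IsRep G a b e v := by
  have h12 : ∀ i, (s.setVar 12 i).var 10 = s.var 10 := fun i => s.setVar_var_of_ne i (by omega)
  simp only [Tm.isRep, Tm.isTrue_bool, Tm.isTrue_and, Tm.isTrue_or, Tm.isTrue_not, Tm.isTrue_sum,
    Tm.isTrue_lt, Tm.isTrue_get, Tm.eval, hs.var_three, Memory.setVar_arr, Memory.setVar_var_self,
    h12]
  rw [h5 _ h10]
  have key : ∀ v : V, s.var 10 = e v → ((¬ ∃ i < n + n, i < s.var 10 ∧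
      (s.arr 6 (s.var 10) i ≠ 0 ∨ s.arr 7 (s.var 10) i ≠ 0)) ↔
        ∀ y, e y < e v → ¬ SameCell G a b v y ∧ ¬ TwinCell G a b v y) := by
    intro v hv
    rw [exists_lt_iff_of_guard (e := e) fun i hi => hi.1.trans (hv ▸ (e v).2), hv]
    push Not
    refine forall_congr' fun y => ?_
    have k6 := h6 v y
    have k7 := h7 v y
    rw [Fin.lt_def]
    tauto
  constructor
  · rintro ⟨⟨v, hv, h⟩, h'⟩
    exact ⟨v, hv, h, (key v hv.symm).1 h'⟩
  · rintro ⟨v, hv, h, h'⟩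
    exact ⟨⟨v, hv, h⟩, (key v hv.symm).2 h'⟩

theorem eval_cellIndex (h8 : VertexSet e (s.arr 8) (IsRep G a b e)) {x : V}
    (hx : s.var 10 = e x) : Tm.cellIndex.eval 12 s = cellIndex G a b e x := by
  refine sum_and_eq_ncard hs h8 (fun i hi => ?_) fun v hv => ?_
  · simp [Tm.eval]
  · simp [Tm.eval, Memory.setVar_var, hx]

omit hs in
theorem isTrue_precedes (hG : G.Connected) (hab : G.Adj a b)
    (h4 : LitRel e (s.arr 4) (Derives G a b)) {i j l : ℕ} {x y : V} (hi : s.var i = e x)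
    (hj : s.var j = e y) (hx : Nontriv G a b x) (hy : Nontriv G a b y) :
    (Tm.precedes i j).IsTrue l s ↔ Precedes G a b x y := by
  simp only [Tm.precedes, Tm.isTrue_and, Tm.isTrue_get, Tm.isTrue_not, Tm.eval, hi, hj]
  rw [precedes_iff hG hab hx hy]
  exact and_congr (h4 (.inl x) (.inl y)) (not_congr (h4 (.inl y) (.inl x)))

theorem isTrue_isBlockRep (hG : G.Connected) (hab : G.Adj a b)
    (h4 : LitRel e (s.arr 4) (Derives G a b)) (h8 : VertexSet e (s.arr 8) (IsRep G a b e))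
    (h10 : s.var 10 < n + n) :
    Tm.isBlockRep.IsTrue 12 s ↔ ∃ v, (e v : ℕ) = s.var 10 ∧ IsBlockRep G a b e v := by
  have h12 : ∀ i, (s.setVar 12 i).var 10 = s.var 10 := fun i => s.setVar_var_of_ne i (by omega)
  simp only [Tm.isBlockRep, Tm.isTrue_bool, Tm.isTrue_and, Tm.isTrue_not, Tm.isTrue_sum,
    Tm.isTrue_lt, Tm.isTrue_get, Tm.eval, hs.var_three, Memory.setVar_arr, Memory.setVar_var_self,
    h12]
  rw [h8 _ h10]
  have key : ∀ v : V, s.var 10 = e v → IsRep G a b e v → ((¬ ∃ i < n + n, i < s.var 10 ∧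
      s.arr 8 i 0 ≠ 0 ∧ ¬ (Tm.precedes 10 12).IsTrue 13 (s.setVar 12 i) ∧
        ¬ (Tm.precedes 12 10).IsTrue 13 (s.setVar 12 i)) ↔
        ∀ y, e y < e v → IsRep G a b e y → Precedes G a b v y ∨ Precedes G a b y v) := by
    intro v hv hr
    rw [exists_lt_iff_of_guard (e := e) fun i hi => hi.1.trans (hv ▸ (e v).2), not_exists]
    refine forall_congr' fun y => ?_
    rw [h8.ne_zero_iff, hv, ← Fin.lt_def]
    by_cases hy : IsRep G a b e y
    · rw [isTrue_precedes (s := s.setVar 12 (e y)) hG hab h4 (x := v) (y := y)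
        ((h12 _).trans hv) (by simp) hr.1 hy.1,
        isTrue_precedes (s := s.setVar 12 (e y)) hG hab h4 (x := y) (y := v) (by simp)
        ((h12 _).trans hv) hy.1 hr.1]
      tauto
    · tauto
  constructor
  · rintro ⟨⟨v, hv, h⟩, h'⟩
    exact ⟨v, hv, h, (key v hv.symm h).1 h'⟩
  · rintro ⟨v, hv, h, h'⟩
    exact ⟨⟨v, hv, h⟩, (key v hv.symm h).2 h'⟩

theorem eval_blockIndex (hG : G.Connected) (hab : G.Adj a b)
    (h4 : LitRel e (s.arr 4) (Derives G a b)) (h10 : VertexSet e (s.arr 10) (IsBlockRep G a b e))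
    {x : V} (hx : s.var 10 = e x) (hr : IsRep G a b e x) :
    Tm.blockIndex.eval 12 s = blockIndex G a b e x := by
  refine sum_and_eq_ncard hs h10 (fun i hi => ?_) fun v hv => ?_
  · simp [Tm.eval]
  · exact isTrue_precedes (s := s.setVar 12 (e v)) hG hab h4
      ((s.setVar_var_of_ne _ (by omega)).trans hx) (by simp) hr.1 hv.1.1

open Classical in
theorem eval_base (hG : G.Connected) (hab : G.Adj a b) (hne : (halfspaces G a b).Nonempty)
    (h4 : LitRel e (s.arr 4) (Derives G a b)) {x : V} (hx : s.var 10 = e x) :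
    Tm.base.eval 12 s = (base G a b).indicator 1 x := by
  rw [Tm.base, Tm.eval_bool, Set.indicator_apply]
  refine if_congr ?_ rfl rfl
  rw [mem_base_iff hG hab hne]
  simp only [Tm.isTrue_get, Tm.eval, hx, hs.var_zero]
  exact h4 (.inr x) (.inl x)

open Classical in
-- Since `cellIndex` is injective on representatives, the only one that passes the index test is
-- `x`.
theorem eval_half [Finite V] {m : ℕ} {R : V → V → Prop} (h8 : VertexSet e (s.arr 8) (IsRep G a b e))
    (h9 : ∀ x, s.arr 9 (e x) 0 = cellIndex G a b e x) (hm : VertexRel e (s.arr m) R) {x v : V}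
    (hr : IsRep G a b e x) (hx : s.var 10 = cellIndex G a b e x) (hv : s.var 11 = e v) :
    (Tm.half m).eval 12 s = {v | R x v}.indicator 1 v := by
  rw [Tm.half, Tm.eval_bool, Set.indicator_apply]
  refine if_congr ?_ rfl rfl
  have h12 : ∀ i, (s.setVar 12 i).var 10 = s.var 10 := fun i => s.setVar_var_of_ne i (by omega)
  have h12' : ∀ i, (s.setVar 12 i).var 11 = s.var 11 := fun i => s.setVar_var_of_ne i (by omega)
  simp only [Tm.isTrue_sum, Tm.isTrue_and, Tm.isTrue_eq, Tm.isTrue_get, Tm.eval, hs.var_three,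
    Memory.setVar_arr, Memory.setVar_var_self, h12, h12', hx, hv, Set.mem_ofPred_eq]
  rw [exists_lt_iff_and (Q := fun y => y = x ∧ R x v) h8]
  · exact ⟨fun ⟨y, _, _, h⟩ => h, fun h => ⟨x, hr, rfl, h⟩⟩
  · intro y hy
    rw [h9, hm y v]
    constructor
    · rintro ⟨h, h'⟩
      obtain rfl := hy.eq_of_cellIndex_eq hr h
      exact ⟨rfl, h'⟩
    · rintro ⟨rfl, h⟩
      exact ⟨rfl, h⟩

theorem eval_block [Finite V] (h8 : VertexSet e (s.arr 8) (IsRep G a b e))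
    (h9 : ∀ x, s.arr 9 (e x) 0 = cellIndex G a b e x)
    (h11 : ∀ x, IsRep G a b e x → s.arr 11 (e x) 0 = blockIndex G a b e x) {x : V}
    (hr : IsRep G a b e x) (hx : s.var 10 = cellIndex G a b e x) :
    Tm.block.eval 12 s = blockIndex G a b e x := by
  have h12 : ∀ i, (s.setVar 12 i).var 10 = s.var 10 := fun i => s.setVar_var_of_ne i (by omega)
  -- Only the representative with the given cell index contributes to the sum.
  rw [Tm.block, Tm.eval, hs.var_three, Finset.sum_eq_single (e x : ℕ)]
  · have : (Tm.and (.get 8 (.var 12) (.const 0)) (.eq (.get 9 (.var 12) (.const 0))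
        (.var 10))).IsTrue 13 (s.setVar 12 (e x)) := by
      simp only [Tm.isTrue_and, Tm.isTrue_get, Tm.isTrue_eq, Tm.eval, Memory.setVar_arr,
        Memory.setVar_var_self, h8.ne_zero_iff, h9, h12, hx]
      exact ⟨hr, trivial⟩
    rw [Tm.eval]
    refine (if_pos this).trans ?_
    simp [Tm.eval, h11 x hr]
  · intro i hi hne
    rw [Finset.mem_range] at hi
    rw [Tm.eval]
    refine (if_neg fun h => ?_).trans rfl
    obtain ⟨h1, h2⟩ := Tm.isTrue_and.1 h
    simp only [Tm.isTrue_get, Tm.isTrue_eq, Tm.eval, Memory.setVar_arr,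
      Memory.setVar_var_self, h12, hx] at h1 h2
    obtain ⟨v, rfl, hv⟩ := (h8 i hi).1 h1
    rw [h9] at h2
    exact hne (val_eq_val.2 (hv.eq_of_cellIndex_eq hr h2))
  · intro h
    exact absurd (Finset.mem_range.2 (val_lt x)) h

theorem eval_numCells (h8 : VertexSet e (s.arr 8) (IsRep G a b e))
    (h8' : ∀ i < n + n, s.arr 8 i 0 ≤ 1) :
    Tm.numCells.eval 12 s = {x | IsRep G a b e x}.ncard := by
  rw [Tm.numCells, Tm.eval, hs.var_three]
  refine sum_eq_ncard (e := e) fun i hi => ?_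
  simp only [Tm.eval, Memory.setVar_arr, Memory.setVar_var_self]
  exact h8.eq_ite h8' hi

theorem eval_numBlocks (h10 : VertexSet e (s.arr 10) (IsBlockRep G a b e))
    (h10' : ∀ i < n + n, s.arr 10 i 0 ≤ 1) :
    Tm.numBlocks.eval 12 s = max 1 {x | IsBlockRep G a b e x}.ncard := by
  have key : (Tm.sum (.get 10 (.var 12) (.const 0))).eval 12 s =
      {x | IsBlockRep G a b e x}.ncard := by
    rw [Tm.eval, hs.var_three]
    refine sum_eq_ncard (e := e) fun i hi => ?_
    simp only [Tm.eval, Memory.setVar_arr, Memory.setVar_var_self]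
    exact h10.eq_ite h10' hi
  have : Tm.numBlocks.eval 12 s = (Tm.sum (.get 10 (.var 12) (.const 0))).eval 12 s +
      (1 - (Tm.sum (.get 10 (.var 12) (.const 0))).eval 12 s) := rfl
  rw [this, key]
  omega

end Facts

/-! ### The program -/

/-- The program that computes the derivable implications between literals. -/
def derivesProgram : Prog :=
  .seq (.assign 3 (.add (.var 0) (.var 0))) <|
  .seq (.fill 12 (.boundaryExcl 1 2)) <|
  .seq (.fill 13 (.boundaryExcl 2 1)) <|
  .seq (.fill 4 .imp) (.loop 4 (.fill 4 .closure))

/-- The program that computes the cells and blocks from the derivable implications. -/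
def cellProgram : Prog :=
  .seq (.fill 5 .nontriv) <|
  .seq (.fill 6 .sameCell) <|
  .seq (.fill 7 .twinCell) <|
  .seq (.fill 8 .isRep) <|
  .seq (.fill 9 .cellIndex) <|
  .seq (.fill 10 .isBlockRep) (.fill 11 .blockIndex)

/-- The program that writes the output. -/
def outputProgram : Prog :=
  .seq (.fill 0 .base) <|
  .seq (.fill 1 (.half 6)) <|
  .seq (.fill 2 (.half 7)) <|
  .seq (.fill 3 .block) <|
  .seq (Tm.numCells.code 12 50) <|
  .seq (Tm.numBlocks.code 12 51) <|
  .seq (.assign 0 (.var 50)) (.assign 1 (.var 51))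

/-- A bound for the running time of `derivesProgram`, as a polynomial in `2 * n`. -/
noncomputable def derivesTime : Polynomial ℕ :=
  4 + (fillTime (.boundaryExcl 1 2) + (fillTime (.boundaryExcl 2 1) + (fillTime .imp +
    (Polynomial.X * (fillTime .closure + 8) + 6))))

/-- A bound for the running time of `cellProgram`, as a polynomial in `2 * n`. -/
noncomputable def cellTime : Polynomial ℕ :=
  fillTime .nontriv + (fillTime .sameCell + (fillTime .twinCell + (fillTime .isRep +
    (fillTime .cellIndex + (fillTime .isBlockRep + fillTime .blockIndex)))))

/-- A bound for the running time of `outputProgram`, as a polynomial in `2 * n`. -/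
noncomputable def outputTime : Polynomial ℕ :=
  fillTime .base + (fillTime (.half 6) + (fillTime (.half 7) + (fillTime .block +
    (Tm.numCells.time + (Tm.numBlocks.time + (2 + 2))))))

/-! ### Correctness and running time of the program -/

section Run

variable {V : Type*} {n : ℕ} {e : V ≃ Fin n} {G : SimpleGraph V} {a b : V} {s s' : Memory}

/-- The arrays with indices in `K` have been filled. -/
def Known (e : V ≃ Fin n) (G : SimpleGraph V) (a b : V) (K : List ℕ) (s : Memory) : Prop :=
  Vars e a b s ∧ ∀ m ∈ K, Fact e G a b m (s.arr m)

/-- Turns a statement about the value of a term into one about the filled entry; `C` is the property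
to be transferred. -/
theorem Filled.spec {m : ℕ} {t : Tm} (h : Filled m t s s') (hs : Vars e a b s) {C : ℕ → Prop}
    {i j : ℕ} (hi : i < n + n) (hj : j < n + n)
    (hC : ∀ r, Vars e a b r → r.arr = s.arr → r.var 10 = i → r.var 11 = j → C (t.eval 12 r)) :
    C (s'.arr m i j) := by
  rw [h.get_eq i (hs.var_three ▸ hi) j (hs.var_three ▸ hj)]
  exact hC _ ((hs.setVar (by omega)).setVar (by omega)) rfl
    (by simp [Memory.setVar_var]) (by simp)

theorem Filled.vars {m : ℕ} {t : Tm} (h : Filled m t s s') (hs : Vars e a b s) : Vars e a b s' :=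
  ⟨(h.var_eq 0 (by omega)).trans hs.1, (h.var_eq 1 (by omega)).trans hs.2,
    (h.var_eq 2 (by omega)).trans hs.3, (h.var_eq 3 (by omega)).trans hs.4⟩

/-- Lets the fills be chained: each adds one fact and preserves those about the other arrays. -/
theorem Known.fill {K : List ℕ} (h : Known e G a b K s) (hK : ∀ m ∈ K, m < 100) {m : ℕ} {t : Tm}
    (hm : m < 100) (ht : t.Ok 12)
    (hf : ∀ s', Filled m t s s' → Fact e G a b m (s'.arr m)) :
    Runs (.fill m t) ((fillTime t).eval (n + n)) s (Known e G a b (m :: K)) := by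
  rw [← h.1.var_three]
  refine (runs_fill hm ht s).mono le_rfl fun s' h' => ⟨h'.vars h.1, fun k hk => ?_⟩
  by_cases hkm : k = m
  · rw [hkm]
    exact hf s' h'
  · have hk : k ∈ K := (List.mem_cons.1 hk).resolve_left hkm
    rw [h'.arr_eq k (hK k hk) hkm]
    exact h.2 k hk

theorem runs_boundaryExcl {m A B : ℕ} {a' b' : V} (hs : Vars e a b s)
    (hM : IsAdjacency e G (s.arr 0)) (hA : A = 1 ∧ B = 2 ∧ a' = a ∧ b' = b ∨
      A = 2 ∧ B = 1 ∧ a' = b ∧ b' = a) (hm : m < 100) :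
    Runs (.fill m (.boundaryExcl A B)) ((fillTime (.boundaryExcl A B)).eval (n + n)) s fun s' =>
      LitRel e (s'.arr m) (BoundaryExcl G a' b') ∧ Filled m (.boundaryExcl A B) s s' := by
  have ok : (Tm.boundaryExcl A B).Ok 12 := by
    rcases hA with ⟨rfl, rfl, -⟩ | ⟨rfl, rfl, -⟩ <;>
      simp [Tm.boundaryExcl, Tm.gate, Tm.Ok, Tm.and, Tm.or, Tm.not, Tm.eq]
  rw [← hs.var_three]
  refine (runs_fill hm ok s).mono le_rfl fun s' h => ⟨fun p q => ?_, h⟩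
  refine h.spec (C := fun v => v ≠ 0 ↔ _) hs (lit_lt p) (lit_lt q) fun r hr ha h1 h2 => ?_
  rcases hA with ⟨rfl, rfl, rfl, rfl⟩ | ⟨rfl, rfl, rfl, rfl⟩
  · exact isTrue_boundaryExcl hr.var_zero hr.var_three (ha ▸ hM) hr.var_one hr.var_two
      (by omega) (by omega) h1 h2
  · exact isTrue_boundaryExcl hr.var_zero hr.var_three (ha ▸ hM) hr.var_two hr.var_one
      (by omega) (by omega) h1 h2

theorem runs_imp (hs : Vars e a b s) (hM : IsAdjacency e G (s.arr 0))
    (h12 : LitRel e (s.arr 12) (BoundaryExcl G a b))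
    (h13 : LitRel e (s.arr 13) (BoundaryExcl G b a)) :
    Runs (.fill 4 .imp) ((fillTime .imp).eval (n + n)) s fun s' =>
      Vars e a b s' ∧ LitRel e (s'.arr 4) (fun p q => p = q ∨ Imp G a b p q) := by
  have ok : Tm.imp.Ok 12 := by
    simp [Tm.imp, Tm.edgeExcl, Tm.neg, Tm.lt, Tm.Ok, Tm.and, Tm.or, Tm.not, Tm.eq]
  rw [← hs.var_three]
  refine (runs_fill (by omega) ok s).mono le_rfl fun s' h => ⟨h.vars hs, fun p q => ?_⟩
  refine h.spec (C := fun v => v ≠ 0 ↔ _) hs (lit_lt p) (lit_lt q) fun r hr ha h1 h2 => ?_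
  exact isTrue_imp hr (ha ▸ hM) (ha ▸ h12) (ha ▸ h13) h1 h2

/-- Warshall's algorithm. -/
theorem runs_closure (hs : Vars e a b s)
    (h4 : LitRel e (s.arr 4) (fun p q => p = q ∨ Imp G a b p q)) :
    Runs (.loop 4 (.fill 4 .closure)) ((n + n) * ((fillTime .closure).eval (n + n) + 8) + 6) s
      (Known e G a b [4]) := by
  -- Warshall's invariant: the entries are sound, contain the one-step relation, and compose through
  -- every intermediate literal with index below `k`.
  let I : ℕ → Memory → Prop := fun k s => s.var 4 = k ∧ Vars e a b s ∧
    (∀ p q, s.arr 4 (lit e p) (lit e q) ≠ 0 → Derives G a b p q) ∧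
    (∀ p q, p = q ∨ Imp G a b p q → s.arr 4 (lit e p) (lit e q) ≠ 0) ∧
    ∀ p r q, lit e r < k → s.arr 4 (lit e p) (lit e r) ≠ 0 → s.arr 4 (lit e r) (lit e q) ≠ 0 →
      s.arr 4 (lit e p) (lit e q) ≠ 0
  have ok : Tm.closure.Ok 12 := by simp [Tm.closure, Tm.Ok, Tm.and, Tm.or]
  refine (Runs.loop I (fun k s h => h.2.1.var_three) (fun k s h => h.1) ?_ ?_).mono le_rfl ?_
  · refine ⟨by simp, hs.setVar (by omega), fun p q h => ?_, fun p q h => (h4 p q).2 h, by simp⟩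
    rcases (h4 p q).1 h with rfl | h
    · exact .refl
    · exact .single h
  · rintro k hk s₁ ⟨k0, k1, k2, k3, k4⟩
    obtain ⟨t, rfl⟩ := exists_lit (e := e) hk
    rw [← k1.var_three]
    refine (runs_fill (by omega) ok s₁).mono le_rfl fun s₂ h => ?_
    have v4 : s₂.var 4 = lit e t := (h.var_eq 4 (by omega)).trans k0
    have val : ∀ p q, s₂.arr 4 (lit e p) (lit e q) ≠ 0 ↔ s₁.arr 4 (lit e p) (lit e q) ≠ 0 ∨
        s₁.arr 4 (lit e p) (lit e t) ≠ 0 ∧ s₁.arr 4 (lit e t) (lit e q) ≠ 0 := by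
      intro p q
      rw [h.get_eq _ (k1.var_three ▸ lit_lt p) _ (k1.var_three ▸ lit_lt q)]
      refine (Tm.isTrue_or (l := 12)).trans ?_
      rw [Tm.isTrue_and]
      simp [Tm.eval, Memory.setVar_var, k0]
    refine ⟨v4, by simp, (h.vars k1).setVar (by omega), ?_, ?_, ?_⟩
    · intro p q hpq
      rcases (val p q).1 hpq with h' | ⟨h', h''⟩
      · exact k2 p q h'
      · exact (k2 p t h').trans (k2 t q h'')
    · exact fun p q hpq => (val p q).2 (Or.inl (k3 p q hpq))
    · intro p r q hr h1 h2
      rw [Memory.setVar_arr, val] at *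
      rcases Nat.lt_succ_iff_lt_or_eq.1 hr with hr | hr
      · have e1 := k4 p r q hr
        have e2 := k4 p r t hr
        have e3 := k4 t r q hr
        tauto
      · rw [hr] at h1 h2
        tauto
  · rintro s' ⟨-, h1, h2, h3, h4⟩
    refine ⟨h1, fun m hm => ?_⟩
    obtain rfl : m = 4 := by simpa using hm
    refine fun p q => ⟨h2 p q, fun h => ?_⟩
    -- After the last round composition works through all literals, so the relation contains every
    -- chain of implications.
    induction h with
    | refl => exact h3 p p (Or.inl rfl)
    | tail _ h ih => exact h4 _ _ _ (lit_lt _) ih (h3 _ _ (Or.inr h))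

theorem eval_bool_le {t : Tm} {l : ℕ} : (Tm.bool t).eval l s ≤ 1 := by
  classical
  rw [Tm.eval_bool]
  split <;> omega

/-- Makes cell indices admissible row numbers for `Prog.fill`. -/
theorem cellIndex_lt [Finite V] (x : V) : cellIndex G a b e x < n + n := by
  have h1 : cellIndex G a b e x ≤ (Set.univ : Set V).ncard := Set.ncard_le_ncard (Set.subset_univ _)
  rw [Set.ncard_univ, Nat.card_congr e, Nat.card_fin] at h1
  have := (e x).2
  omega

theorem isAdjacency_inputMemory : IsAdjacency e G ((inputMemory e G a b).arr 0) := by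
  intro i j
  simp [inputMemory]

theorem vars_inputMemory : Vars e a b ((inputMemory e G a b).setVar 3 (n + n)) :=
  ⟨by simp [Memory.setVar_var, inputMemory], by simp [Memory.setVar_var, inputMemory],
    by simp [Memory.setVar_var, inputMemory], by simp⟩

theorem runs_derivesProgram : Runs derivesProgram (derivesTime.eval (n + n))
    (inputMemory e G a b) (Known e G a b [4]) := by
  refine (Runs.seq (Runs.assign 3 _ (Q := fun s => Vars e a b s ∧ IsAdjacency e G (s.arr 0))
    ⟨?_, isAdjacency_inputMemory (a := a) (b := b)⟩) fun s₁ h₁ => ?_).mono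
      (T := 4 + ((fillTime (.boundaryExcl 1 2)).eval (n + n) +
        ((fillTime (.boundaryExcl 2 1)).eval (n + n) + ((fillTime .imp).eval (n + n) +
          ((n + n) * ((fillTime .closure).eval (n + n) + 8) + 6)))))
      (by simp [derivesTime]) fun _ h => h
  · simpa [Expr.eval, inputMemory] using vars_inputMemory (e := e) (G := G) (a := a) (b := b)
  refine Runs.seq (runs_boundaryExcl h₁.1 h₁.2 (Or.inl ⟨rfl, rfl, rfl, rfl⟩) (by omega))
    fun s₂ h₂ => ?_
  have v₂ := h₂.2.vars h₁.1
  have a₂ : IsAdjacency e G (s₂.arr 0) := h₂.2.arr_eq 0 (by omega) (by omega) ▸ h₁.2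
  refine Runs.seq (runs_boundaryExcl v₂ a₂ (Or.inr ⟨rfl, rfl, rfl, rfl⟩) (by omega))
    fun s₃ h₃ => ?_
  refine Runs.seq (runs_imp (h₃.2.vars v₂) (h₃.2.arr_eq 0 (by omega) (by omega) ▸ a₂)
    (h₃.2.arr_eq 12 (by omega) (by omega) ▸ h₂.1) h₃.1) fun s₄ h₄ => ?_
  exact runs_closure h₄.1 h₄.2

theorem runs_cellProgram (hG : G.Connected) (hab : G.Adj a b) (hne : (halfspaces G a b).Nonempty)
    (h : Known e G a b [4] s) : Runs cellProgram (cellTime.eval (n + n)) s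
      (Known e G a b [11, 10, 9, 8, 7, 6, 5, 4]) := by
  have : Finite V := Finite.of_equiv _ e.symm
  -- Sets and functions on vertices are stored in column 0, which must lie in the filled range; the
  -- vertex `a` ensures this.
  have h0 : 0 < n + n := (Nat.zero_le _).trans_lt (val_lt (e := e) a)
  refine (Runs.seq (h.fill (by simp) (by omega) ?_ fun s' h' => ?_) fun s h =>
    Runs.seq (h.fill (by simp) (by omega) ?_ fun s' h' => ?_) fun s h =>
    Runs.seq (h.fill (by simp) (by omega) ?_ fun s' h' => ?_) fun s h =>
    Runs.seq (h.fill (by simp) (by omega) ?_ fun s' h' => ?_) fun s h =>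
    Runs.seq (h.fill (by simp) (by omega) ?_ fun s' h' => ?_) fun s h =>
    Runs.seq (h.fill (by simp) (by omega) ?_ fun s' h' => ?_) fun s h =>
    h.fill (by simp) (by omega) ?_ fun s' h' => ?_).mono (by simp [cellTime]) fun _ h => h
  · simp [Tm.nontriv, Tm.Ok, Tm.and, Tm.not, Tm.lt]
  · have k4 : LitRel e (s.arr 4) (Derives G a b) := h.2 4 (by simp)
    intro i hi
    refine h'.spec (C := fun v => v ≠ 0 ↔ _) h.1 hi h0 fun r hr ha h1 _ => ?_
    exact h1 ▸ isTrue_nontriv hr hG hab hne (ha ▸ k4)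
  · simp [Tm.sameCell, Tm.Ok, Tm.and]
  · have k4 : LitRel e (s.arr 4) (Derives G a b) := h.2 4 (by simp)
    have k5 : VertexSet e (s.arr 5) (Nontriv G a b) := h.2 5 (by simp)
    intro x y
    refine h'.spec (C := fun v => v ≠ 0 ↔ _) h.1 (val_lt x) (val_lt y) fun r hr ha h1 h2 => ?_
    exact isTrue_sameCell hG hab (ha ▸ k4) (ha ▸ k5) h1 h2
  · simp [Tm.twinCell, Tm.Ok, Tm.and]
  · have k4 : LitRel e (s.arr 4) (Derives G a b) := h.2 4 (by simp)
    have k5 : VertexSet e (s.arr 5) (Nontriv G a b) := h.2 5 (by simp)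
    intro x y
    refine h'.spec (C := fun v => v ≠ 0 ↔ _) h.1 (val_lt x) (val_lt y) fun r hr ha h1 h2 => ?_
    exact isTrue_twinCell hr hG hab (ha ▸ k4) (ha ▸ k5) h1 h2
  · simp [Tm.isRep, Tm.Ok, Tm.and, Tm.or, Tm.not, Tm.lt, Tm.bool]
  · have k5 : VertexSet e (s.arr 5) (Nontriv G a b) := h.2 5 (by simp)
    have k6 : VertexRel e (s.arr 6) (SameCell G a b) := h.2 6 (by simp)
    have k7 : VertexRel e (s.arr 7) (TwinCell G a b) := h.2 7 (by simp)
    refine ⟨fun i hi => ?_, fun i hi => ?_⟩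
    · refine h'.spec (C := fun v => v ≠ 0 ↔ _) h.1 hi h0 fun r hr ha h1 _ => ?_
      have := isTrue_isRep hr (ha ▸ k5) (ha ▸ k6) (ha ▸ k7) (h1 ▸ hi)
      rwa [h1] at this
    · exact h'.spec (C := fun v => v ≤ 1) h.1 hi h0 fun r _ _ _ _ => eval_bool_le
  · simp [Tm.cellIndex, Tm.Ok, Tm.and, Tm.lt, Tm.bool]
  · have k8 : VertexSet e (s.arr 8) (IsRep G a b e) := (h.2 8 (by simp)).1
    intro x
    refine h'.spec (C := fun v => v = _) h.1 (val_lt x) h0 fun r hr ha h1 _ => ?_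
    exact eval_cellIndex hr (ha ▸ k8) h1
  · simp [Tm.isBlockRep, Tm.precedes, Tm.Ok, Tm.and, Tm.not, Tm.lt, Tm.bool]
  · have k4 : LitRel e (s.arr 4) (Derives G a b) := h.2 4 (by simp)
    have k8 : VertexSet e (s.arr 8) (IsRep G a b e) := (h.2 8 (by simp)).1
    refine ⟨fun i hi => ?_, fun i hi => ?_⟩
    · refine h'.spec (C := fun v => v ≠ 0 ↔ _) h.1 hi h0 fun r hr ha h1 _ => ?_
      have := isTrue_isBlockRep hr hG hab (ha ▸ k4) (ha ▸ k8) (h1 ▸ hi)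
      rwa [h1] at this
    · exact h'.spec (C := fun v => v ≤ 1) h.1 hi h0 fun r _ _ _ _ => eval_bool_le
  · simp [Tm.blockIndex, Tm.precedes, Tm.Ok, Tm.and, Tm.not, Tm.bool]
  · have k4 : LitRel e (s.arr 4) (Derives G a b) := h.2 4 (by simp)
    have k10 : VertexSet e (s.arr 10) (IsBlockRep G a b e) := (h.2 10 (by simp)).1
    intro x hx
    refine h'.spec (C := fun v => v = _) h.1 (val_lt x) h0 fun r hr ha h1 _ => ?_
    exact eval_blockIndex hr hG hab (ha ▸ k4) (ha ▸ k10) h1 hx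

theorem runs_outputProgram (hG : G.Connected) (hab : G.Adj a b)
    (hne : (halfspaces G a b).Nonempty) (h : Known e G a b [11, 10, 9, 8, 7, 6, 5, 4] s) :
    Runs outputProgram (outputTime.eval (n + n)) s fun s' =>
      s'.var 0 = {x | IsRep G a b e x}.ncard ∧
      s'.var 1 = max 1 {x | IsBlockRep G a b e x}.ncard ∧
      ∀ m ∈ [0, 1, 2, 3], Fact e G a b m (s'.arr m) := by
  have : Finite V := Finite.of_equiv _ e.symm
  have h0 : 0 < n + n := (Nat.zero_le _).trans_lt (val_lt (e := e) a)
  -- The adjacency matrix in `M_0` may be overwritten now, since no later term reads it. The number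
  -- of cells waits in `x_50` while the number of blocks is computed with scratch space from 51 on.
  refine (Runs.seq (h.fill (by simp) (by omega) ?_ fun s' h' => ?_) fun s h =>
    Runs.seq (h.fill (by simp) (by omega) ?_ fun s' h' => ?_) fun s h =>
    Runs.seq (h.fill (by simp) (by omega) ?_ fun s' h' => ?_) fun s h =>
    Runs.seq (h.fill (by simp) (by omega) ?_ fun s' h' => ?_) fun s h =>
    Runs.seq ((Tm.runs_code (t := Tm.numCells) ?_ (by omega) (by omega) le_rfl).mono
      (T' := Tm.numCells.time.eval (n + n)) (by rw [h.1.var_three]) fun _ h => h) fun s₁ h₁ =>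
    Runs.seq ((Tm.runs_code (t := Tm.numBlocks) ?_ (by omega) (by omega) (by omega)).mono
      (T' := Tm.numBlocks.time.eval (n + n)) ?_ fun _ h => h) fun s₂ h₂ =>
    Runs.seq (Runs.assign 0 (.var 50) (Q := fun s₃ => s₃.var 0 = {x | IsRep G a b e x}.ncard ∧
      s₃.var 51 = max 1 {x | IsBlockRep G a b e x}.ncard ∧ s₃.arr = s.arr) ?_) fun s₃ h₃ =>
      Runs.assign 1 (.var 51) ?_).mono (by simp [outputTime, Expr.cost]) fun _ h => h
  · simp [Tm.base, Tm.Ok, Tm.bool]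
  · have k4 : LitRel e (s.arr 4) (Derives G a b) := h.2 4 (by simp)
    intro x
    refine h'.spec (C := fun v => v = _) h.1 (val_lt x) h0 fun r hr ha h1 _ => ?_
    exact eval_base hr hG hab hne (ha ▸ k4) h1
  · simp [Tm.half, Tm.Ok, Tm.and, Tm.eq, Tm.not, Tm.bool]
  · have k6 : VertexRel e (s.arr 6) (SameCell G a b) := h.2 6 (by simp)
    have k8 : VertexSet e (s.arr 8) (IsRep G a b e) := (h.2 8 (by simp)).1
    have k9 : ∀ x, s.arr 9 (e x) 0 = cellIndex G a b e x := h.2 9 (by simp)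
    intro x v hx
    refine h'.spec (C := fun v => v = _) h.1 (cellIndex_lt x) (val_lt v) fun r hr ha h1 h2 => ?_
    exact eval_half hr (ha ▸ k8) (ha ▸ k9) (ha ▸ k6) hx h1 h2
  · simp [Tm.half, Tm.Ok, Tm.and, Tm.eq, Tm.not, Tm.bool]
  · have k7 : VertexRel e (s.arr 7) (TwinCell G a b) := h.2 7 (by simp)
    have k8 : VertexSet e (s.arr 8) (IsRep G a b e) := (h.2 8 (by simp)).1
    have k9 : ∀ x, s.arr 9 (e x) 0 = cellIndex G a b e x := h.2 9 (by simp)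
    intro x v hx
    refine h'.spec (C := fun v => v = _) h.1 (cellIndex_lt x) (val_lt v) fun r hr ha h1 h2 => ?_
    exact eval_half hr (ha ▸ k8) (ha ▸ k9) (ha ▸ k7) hx h1 h2
  · simp [Tm.block, Tm.Ok, Tm.and, Tm.eq, Tm.not]
  · have k8 : VertexSet e (s.arr 8) (IsRep G a b e) := (h.2 8 (by simp)).1
    have k9 : ∀ x, s.arr 9 (e x) 0 = cellIndex G a b e x := h.2 9 (by simp)
    have k11 : ∀ x, IsRep G a b e x → s.arr 11 (e x) 0 = blockIndex G a b e x :=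
      h.2 11 (by simp)
    intro x hx
    refine h'.spec (C := fun v => v = _) h.1 (cellIndex_lt x) h0 fun r hr ha h1 _ => ?_
    exact eval_block hr (ha ▸ k8) (ha ▸ k9) (ha ▸ k11) hx h1
  · simp [Tm.numCells, Tm.Ok]
  · simp [Tm.numBlocks, Tm.Ok]
  · rw [h₁.2.2 3 (Or.inl (by omega)), h.1.var_three]
  · have k8 := h.2 8 (by simp)
    have k10 := h.2 10 (by simp)
    have e1 := h₂.1
    rw [h₁.2.eval (by simp [Tm.numBlocks, Tm.Ok]) (by omega), eval_numBlocks h.1 k10.1 k10.2] at e1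
    refine ⟨?_, ?_, h₂.2.1.trans h₁.2.1⟩
    · rw [Memory.setVar_var_self, Expr.eval, h₂.2.2 50 (Or.inr (by omega)), h₁.1,
        eval_numCells h.1 k8.1 k8.2]
    · rw [Memory.setVar_var_of_ne _ _ (by omega), e1]
  · refine ⟨?_, ?_, fun m hm => ?_⟩
    · rw [Memory.setVar_var_of_ne _ _ (by omega), h₃.1]
    · rw [Memory.setVar_var_self, Expr.eval, h₃.2.1]
    · rw [Memory.setVar_arr, h₃.2.2]
      exact h.2 m (by simp at hm ⊢; omega)

end Run

end Monophonic

/-! ### The main theorem -/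

theorem mainTheorem1 :
    ∃ (P : Monophonic.Prog) (q : Polynomial ℕ),
      ∀ (V : Type*) (n : ℕ) (e : V ≃ Fin n) (G : SimpleGraph V) (a b : V),
        G.Connected → G.Adj a b → (Monophonic.halfspaces G a b).Nonempty →
        ∃ (A : Set V) (D : Monophonic.CellDecomposition V),
          Monophonic.IsCellDecompositionOf G a b A D ∧
          (∀ H : Set V, H ∈ Monophonic.halfspaces G a b ↔
            ∃ (l : Fin D.p) (S : Set (Fin D.k)), S ⊆ D.block l ∧
              H = A ∪ (⋃ i ∈ D.before l ∪ S, D.fst i) ∪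
                (⋃ i ∈ (D.block l \ S) ∪ D.after l, D.snd i)) ∧
          (∃ (s : Monophonic.Memory) (t : ℕ),
            Monophonic.Exec P (Monophonic.inputMemory e G a b) s t ∧
            t ≤ q.eval n ∧ Monophonic.HoldsOutput e s A D) := by
  refine ⟨.seq Monophonic.derivesProgram (.seq Monophonic.cellProgram Monophonic.outputProgram),
    -- The time bounds are polynomials in `x_3 = 2n`, hence the substitution of `X + X`.
    (Monophonic.derivesTime + (Monophonic.cellTime + Monophonic.outputTime)).comp
      (Polynomial.X + Polynomial.X), ?_⟩
  intro V n e G a b hG hab hne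
  obtain ⟨D, hD, hH, hk, hp, hcell⟩ := Monophonic.exists_cellDecomposition hG hab hne e
  obtain ⟨s, t, hrun, ht, h0, h1, hfact⟩ := Monophonic.runs_derivesProgram.seq fun s h =>
    (Monophonic.runs_cellProgram hG hab hne h).seq fun s h =>
      Monophonic.runs_outputProgram hG hab hne h
  refine ⟨Monophonic.base G a b, D, hD, hH, s, t, hrun, by simpa using ht, ?_⟩
  have f0 := hfact 0 (by simp)
  have f1 := hfact 1 (by simp)
  have f2 := hfact 2 (by simp)
  have f3 := hfact 3 (by simp)
  refine ⟨h0.trans hk.symm, h1.trans hp.symm, f0, fun i v => ?_, fun i v => ?_, fun i => ?_⟩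
  · obtain ⟨x, hx, hi, h, -, -⟩ := hcell i
    rw [h, ← hi]
    exact f1 x v hx
  · obtain ⟨x, hx, hi, -, h, -⟩ := hcell i
    rw [h, ← hi]
    exact f2 x v hx
  · obtain ⟨x, hx, hi, -, -, h⟩ := hcell i
    rw [h, ← hi]
    exact f3 x hx
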